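/- **Setting.** A *polar space* is a set $Q$ of points with a family $\mathcal L$ of subsets of $Q$ (lines) such that every line has at least three points, two distinct lines share at most one point, every point is collinear with exactly one or with all points of any given line (Buekenhout–Shult axiom), and no point is collinear with all points; here $a\perp b$ ("collinear") means that $a=b$ or that $a,b$ lie on a common line. A *subspace* is a set of points containing every line that it meets in at least two points; it is *strong* if its points are pairwise collinear. The dimension of a strong subspace $X$ is $n-1$, where $n$ is the maximal length (number of strict inclusions) of a chain of strong subspaces ending in $X$ (so $\dim\emptyset=-1$, points have dimension $0$, lines dimension $1$). The polar space has *index* $m$ if $m$ is the maximal dimension of its strong subspaces. A *hyperplane* is a proper subspace $H\subsetneq Q$ that meets every line. Let $(Q,\mathcal L)$ be a polar space of index $m$ and $H$ a hyperplane of it. The *affine polar space* $\mathfrak U$ has the points $Q\setminus H$ and the lines $L\setminus H$ with $L\in\mathcal L$, $L\not\subseteq H$. Its subspaces are the sets $X\setminus H$ with $X$ a subspace of $Q$. For $d\ge 0$ let $\mathrm{Sub}_d(\mathfrak U)$ be the set of all $X\setminus H$, where $X$ is a $d$-dimensional strong subspace of $Q$ with $X\not\subseteq H$, and let $\mathrm{Sub}_{-1}(\mathfrak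 U)=\{\emptyset\}$. Write $A\sqcup B$ for the least subspace of $\mathfrak U$ containing $A\cup B$. On $\mathrm{Sub}_k(\mathfrak U)$ consider $$A\sim_- B \iff A\cap B\in \mathrm{Sub}_{k-1}(\mathfrak U),\qquad A\sim^+ B\iff A\sqcup B\in \mathrm{Sub}_{k+1}(\mathfrak U),\qquad A\approx B\iff A\sim_- B\ \text{and}\ A\sim^+ B .$$ **Recovering.** For fixed $m$, $k$ and a fixed choice of adjacency $\sim$, we say that $\mathfrak U$ *can be recovered from* $\langle \mathrm{Sub}_k(\mathfrak U),\sim\rangle$ if there is one finite system of parameter-free first-order formulas in a single binary relation symbol (depending only on $m$, $k$ and the type of adjacency) such that for every affine polar space $\mathfrak U$ as above, evaluating the formulas in $\langle \mathrm{Sub}_k(\mathfrak U),\sim\rangle$ has the following effect: the points and the lines of $\mathfrak U$ are identified with the classes of definable sets of tuples (of fixed finite lengths) of elements of $\mathrm{Sub}_k(\mathfrak U)$ modulo definable equivalence relations, and under this identification the incidence "point $a$ lies on line $l$" of $\mathfrak U$ and the incidence "point $a$ lies in $A\in\mathrm{Sub}_k(\mathfrak U)$" are definable by formulas of the system. **Theorem.**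 Let $m,k\ge 0$ be integers. 1. If $0<k\le m$, then the affine polar spaces $\mathfrak U$ obtained from polar spaces of index $m$ can be recovered from $\langle \mathrm{Sub}_k(\mathfrak U),\sim_-\rangle$. 2. If $k\le m-1$, then they can be recovered from $\langle \mathrm{Sub}_k(\mathfrak U),\sim^+\rangle$. 3. If $k\le m-1$, then they can be recovered from $\langle \mathrm{Sub}_k(\mathfrak U),\approx\rangle$. -/

import Mathlib

universe u v w x

/-! ### Polar spaces and hyperplanes

A point-line space is given by its type of points `Q` and its set of lines `𝓛 : Set (Set Q)`. -/

namespace PolarGeometry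

variable {Q : Type u}

/-- `a ⊥ b`: the points `a`, `b` coincide or lie on a common line. -/
def Perp (𝓛 : Set (Set Q)) (a b : Q) : Prop :=
  a = b ∨ ∃ L ∈ 𝓛, a ∈ L ∧ b ∈ L

/-- A subspace contains every line that it meets in at least two points. -/
def IsSubspace (𝓛 : Set (Set Q)) (X : Set Q) : Prop :=
  ∀ L ∈ 𝓛, (L ∩ X).Nontrivial → L ⊆ X

/-- A strong (singular) subspace: a subspace whose points are pairwise collinear. -/
def IsStrong (𝓛 : Set (Set Q)) (X : Set Q) : Prop :=
  IsSubspace 𝓛 X ∧ ∀ a ∈ X, ∀ b ∈ X, Perp 𝓛 a b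

/-- Nondegenerate polar spaces, by the Buekenhout–Shult axioms. -/
structure IsPolarSpace (𝓛 : Set (Set Q)) : Prop where
  /-- every line has at least three points -/
  three_le : ∀ L ∈ 𝓛, 3 ≤ L.encard
  /-- two distinct lines share at most one point -/
  eq_of_nontrivial : ∀ L ∈ 𝓛, ∀ M ∈ 𝓛, (L ∩ M).Nontrivial → L = M
  /-- a point is collinear with exactly one point or with all points of a line -/
  one_or_all : ∀ L ∈ 𝓛, ∀ p : Q,
    (∃! q, q ∈ L ∧ Perp 𝓛 p q) ∨ ∀ q ∈ L, Perp 𝓛 p q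
  /-- no point is collinear with all points -/
  nondegenerate : ∀ p : Q, ∃ q : Q, ¬ Perp 𝓛 p q

/-- The strong subspaces, ordered by inclusion. -/
abbrev StrongSubspace (𝓛 : Set (Set Q)) : Type u := {X : Set Q // IsStrong 𝓛 X}

/-- `sub 𝓛 d` is the family of all `d`-dimensional strong subspaces. A strong subspace has
dimension `n - 1` when the longest strictly increasing chains of strong subspaces ending in it
have `n` steps: the empty set has dimension `-1`, a point `0`, a line `1`, and so on. -/
def sub (𝓛 : Set (Set Q)) (d : ℤ) : Set (Set Q) :=
  {X | ∃ (hX : IsStrong 𝓛 X) (n : ℕ),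
    Order.height (⟨X, hX⟩ : StrongSubspace 𝓛) = (n : ℕ∞) ∧ d = (n : ℤ) - 1}

/-- The index is the maximal dimension of a strong subspace. -/
def HasIndex (𝓛 : Set (Set Q)) (m : ℕ) : Prop :=
  (sub 𝓛 (m : ℤ)).Nonempty ∧ ∀ X, IsStrong 𝓛 X → ∃ d : ℤ, d ≤ (m : ℤ) ∧ X ∈ sub 𝓛 d

/-- A (geometric) hyperplane: a proper subspace that meets every line. -/
def IsHyperplane (𝓛 : Set (Set Q)) (H : Set Q) : Prop :=
  IsSubspace 𝓛 H ∧ H ≠ Set.univ ∧ ∀ L ∈ 𝓛, (L ∩ H).Nonempty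

/-! ### The affine polar space obtained by deleting `H` -/

/-- The points of the affine polar space. -/
abbrev AfPoint (H : Set Q) : Type u := {a : Q // a ∉ H}

/-- The lines of the affine polar space: the nonempty sets `L \ H` for lines `L`. -/
abbrev AfLine (𝓛 : Set (Set Q)) (H : Set Q) : Type u :=
  {l : Set Q // l.Nonempty ∧ ∃ L ∈ 𝓛, l = L \ H}

/-- The subspaces of the affine polar space are the sets `X \ H` for subspaces `X`. -/
def IsAfSubspace (𝓛 : Set (Set Q)) (H : Set Q) (A : Set Q) : Prop :=
  ∃ X, IsSubspace 𝓛 X ∧ A = X \ H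

/-- The join of `A` and `B`: the least subspace of the affine polar space containing both. -/
def afJoin (𝓛 : Set (Set Q)) (H : Set Q) (A B : Set Q) : Set Q :=
  ⋂₀ {S | IsAfSubspace 𝓛 H S ∧ A ∪ B ⊆ S}

/-- The `d`-dimensional strong subspaces of the affine polar space: the sets `X \ H`, where `X` is
a `d`-dimensional strong subspace not contained in `H`. The empty set counts as the subspace of
dimension `-1`. -/
def afSub (𝓛 : Set (Set Q)) (H : Set Q) (d : ℤ) : Set (Set Q) :=
  {A | ∃ X ∈ sub 𝓛 d, (0 ≤ d → ¬ X ⊆ H) ∧ A = X \ H}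

/-- The type of `d`-dimensional strong subspaces of the affine polar space. -/
abbrev AfSub (𝓛 : Set (Set Q)) (H : Set Q) (d : ℤ) : Type u := {A : Set Q // A ∈ afSub 𝓛 H d}

/-- `A ∼₋ B`: the meet is a strong subspace of dimension one less. -/
def DownAdj (𝓛 : Set (Set Q)) (H : Set Q) (k : ℤ) (A B : AfSub 𝓛 H k) : Prop :=
  A.1 ∩ B.1 ∈ afSub 𝓛 H (k - 1)

/-- `A ∼⁺ B`: the join is a strong subspace of dimension one more. -/
def UpAdj (𝓛 : Set (Set Q)) (H : Set Q) (k : ℤ) (A B : AfSub 𝓛 H k) : Prop :=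
  afJoin 𝓛 H A.1 B.1 ∈ afSub 𝓛 H (k + 1)

/-- The combined adjacency. -/
def BothAdj (𝓛 : Set (Set Q)) (H : Set Q) (k : ℤ) (A B : AfSub 𝓛 H k) : Prop :=
  DownAdj 𝓛 H k A B ∧ UpAdj 𝓛 H k A B

/-! ### Definability -/

/-- A set with one binary relation, as a first-order structure over the language with one
binary relation symbol. -/
@[reducible]
def relStructure {V : Type v} (r : V → V → Prop) : FirstOrder.Language.graph.Structure V where
  RelMap | .adj => (fun z => r (z 0) (z 1))

/-- The truth of a first-order formula (without parameters) at a tuple of elements of `⟨V, r⟩`. -/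
def Holds {V : Type v} (r : V → V → Prop) {α : Type} (φ : FirstOrder.Language.graph.Formula α)
    (s : α → V) : Prop :=
  @FirstOrder.Language.Formula.Realize _ V (relStructure r) α φ s

/-- A system of first-order formulas in one binary relation symbol that is meant to define a
point-line structure: its points and lines are to be tuples of elements, up to definable
equivalences. -/
structure DefinitionScheme where
  /-- length of the tuples that represent points -/
  pointArity : ℕ
  /-- length of the tuples that represent lines -/
  lineArity : ℕ
  /-- "the tuple represents a point" -/
  isPoint : FirstOrder.Language.graph.Formula (Fin pointArity)
  /-- "the two tuples represent the same point" -/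
  samePoint : FirstOrder.Language.graph.Formula (Fin pointArity ⊕ Fin pointArity)
  /-- "the tuple represents a line" -/
  isLine : FirstOrder.Language.graph.Formula (Fin lineArity)
  /-- "the two tuples represent the same line" -/
  sameLine : FirstOrder.Language.graph.Formula (Fin lineArity ⊕ Fin lineArity)
  /-- "the point lies on the line" -/
  onLine : FirstOrder.Language.graph.Formula (Fin pointArity ⊕ Fin lineArity)
  /-- "the point lies on the given element" -/
  onElement : FirstOrder.Language.graph.Formula (Fin pointArity ⊕ Fin 1)

/-- The scheme `S`, evaluated in the structure `⟨V, r⟩`, defines the point-line structure with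
points `P`, lines `Λ` and incidence `inc`, together with the incidence `mem` between the points
and the elements of `V`: points and lines are identified with the equivalence classes of the
tuples specified by `S`, and under this identification both incidence relations are the ones
expressed by the formulas of `S`. -/
def DefinitionScheme.Defines (S : DefinitionScheme) {V : Type v} (r : V → V → Prop)
    {P : Type w} {Λ : Type x} (inc : P → Λ → Prop) (mem : P → V → Prop) : Prop :=
  ∃ (pt : {s : Fin S.pointArity → V // Holds r S.isPoint s} → P)
    (ln : {t : Fin S.lineArity → V // Holds r S.isLine t} → Λ),
    Function.Surjective pt ∧ Function.Surjective ln ∧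
    (∀ s s', pt s = pt s' ↔ Holds r S.samePoint (Sum.elim s.1 s'.1)) ∧
    (∀ t t', ln t = ln t' ↔ Holds r S.sameLine (Sum.elim t.1 t'.1)) ∧
    (∀ s t, inc (pt s) (ln t) ↔ Holds r S.onLine (Sum.elim s.1 t.1)) ∧
    (∀ s A, mem (pt s) A ↔ Holds r S.onElement (Sum.elim s.1 (fun _ => A)))

/-- The affine polar space with ambient polar space `𝓛` and deleted hyperplane `H` is recovered
by the scheme `S` from its `k`-dimensional strong subspaces with the relation `r`. -/
def RecoveredBy (S : DefinitionScheme) (𝓛 : Set (Set Q)) (H : Set Q) (k : ℤ)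
    (r : AfSub 𝓛 H k → AfSub 𝓛 H k → Prop) : Prop :=
  S.Defines r (fun (a : AfPoint H) (l : AfLine 𝓛 H) => a.1 ∈ l.1)
    (fun (a : AfPoint H) (A : AfSub 𝓛 H k) => a.1 ∈ A.1)

end PolarGeometry

namespace PolarGeometry

variable {Q : Type u} {𝓛 : Set (Set Q)}

/-! ### Collinearity -/

/-! A strong subspace X not inside H is never covered by H and a second proper subspace, so X \ H
determines X. The adjacencies thus become relations `Flat.Up`, `Flat.Down` and `Flat.Both` between
projective subspaces of rank k + 1 (rank is dimension plus one), and the recovery descends in the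
dimension.

A flat Y of dimension k is coded by an adjacent pair A, B of flats of dimension k + 1 with A ∩ B =
Y. Once the star relation "A ∩ B ⊆ C" is definable, so are equality of coded flats, the relation ∼⁺
between them (distinct and inside a common flat of dimension k + 1) and their incidence with the
given flats. Thus the flats of dimension k with ∼⁺ are interpreted one dimension higher
(`FlatRecoverable.succ`), and definability carries over along interpretations
(`IsCoding.translate`). In dimension 0 an affine line is the double perp of two of its points,
computed with affine points only (`mem_line_iff`).

The geometric task is to define the star. A common neighbour of A and B contains A ∩ B or lies in
their join, and in the join a flat through A ∩ B behaves differently from one off it: a flat through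
A ∩ B that leaves the join is never adjacent to a flat of the join that misses part of A ∩ B
(`not_down_of_not_subset`). Testing against suitable further neighbours therefore isolates the star
for ∼₋ (`downStar_iff`) and for the combined adjacency (`bothStar_iff`), and the pencils for ∼⁺
(`upPencil_iff`).

For ∼⁺ the parallel pairs, those with A ∩ B ⊆ H, must be detected as well. The hyperplanes of the
join M are the points of a dual projective space, in which the flats are all points except M ∩ H,
and A, B are parallel exactly when the line through them passes through this missing point.
`IsParallel` says that some line of a plane fails to meet the pencil of A and B.

When the flats are hyperplanes of maximal strong subspaces, there is no room above the join. Pencils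
and stars are then read off from quadrangles and prisms between maximal strong subspaces that share
only A ∩ B (`IsQuad.inter_eq`, `prismStar_iff`), and ∼⁺ is regained from the combined adjacency
(`isNearlyAdjacent_iff`).

The polar geometry needed is built from the Buekenhout–Shult axioms: separation of a point from a
strong subspace (`exists_separating`) gives the Veblen–Young axiom, hence the dimension formula
`rk_join`. -/

theorem Perp.refl (a : Q) : Perp 𝓛 a a := Or.inl rfl

theorem Perp.symm {a b : Q} (h : Perp 𝓛 a b) : Perp 𝓛 b a := by
  rcases h with rfl | ⟨L, hL, ha, hb⟩
  · exact Or.inl rfl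
  · exact Or.inr ⟨L, hL, hb, ha⟩

theorem Perp.of_mem {L : Set Q} (hL : L ∈ 𝓛) {a b : Q} (ha : a ∈ L) (hb : b ∈ L) : Perp 𝓛 a b :=
  Or.inr ⟨L, hL, ha, hb⟩

theorem Perp.exists_line {a b : Q} (h : Perp 𝓛 a b) (hne : a ≠ b) :
    ∃ L ∈ 𝓛, a ∈ L ∧ b ∈ L :=
  h.resolve_left hne

theorem IsSubspace.line_subset {X L : Set Q} (hX : IsSubspace 𝓛 X) (hL : L ∈ 𝓛) {a b : Q}
    (ha : a ∈ L) (hb : b ∈ L) (hne : a ≠ b) (haX : a ∈ X) (hbX : b ∈ X) : L ⊆ X :=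
  hX L hL ⟨a, ⟨ha, haX⟩, b, ⟨hb, hbX⟩, hne⟩

theorem IsSubspace.inter {X Y : Set Q} (hX : IsSubspace 𝓛 X) (hY : IsSubspace 𝓛 Y) :
    IsSubspace 𝓛 (X ∩ Y) := fun L hL h =>
  Set.subset_inter (hX L hL (h.mono fun _ hx => ⟨hx.1, hx.2.1⟩))
    (hY L hL (h.mono fun _ hx => ⟨hx.1, hx.2.2⟩))

theorem isSubspace_univ : IsSubspace 𝓛 Set.univ := fun _ _ _ => Set.subset_univ _

theorem isSubspace_sInter {S : Set (Set Q)} (hS : ∀ X ∈ S, IsSubspace 𝓛 X) :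
    IsSubspace 𝓛 (⋂₀ S) := fun L hL h =>
  Set.subset_sInter fun X hX => hS X hX L hL (h.mono fun _ hx => ⟨hx.1, hx.2 X hX⟩)

theorem IsStrong.inter {X Y : Set Q} (hX : IsStrong 𝓛 X) (hY : IsSubspace 𝓛 Y) :
    IsStrong 𝓛 (X ∩ Y) :=
  ⟨hX.1.inter hY, fun a ha b hb => hX.2 a ha.1 b hb.1⟩

theorem isStrong_empty : IsStrong 𝓛 ∅ :=
  ⟨fun _ _ h => absurd h (by simp), fun _ h => absurd h (by simp)⟩

theorem isStrong_singleton (a : Q) : IsStrong 𝓛 {a} := by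
  refine ⟨fun L _ h => ?_, ?_⟩
  · exact absurd (h.mono Set.inter_subset_right) Set.not_nontrivial_singleton
  · rintro x rfl y rfl
    exact Perp.refl _

namespace IsPolarSpace

theorem line_nontrivial (hP : IsPolarSpace 𝓛) {L : Set Q} (hL : L ∈ 𝓛) : L.Nontrivial := by
  rw [← Set.one_lt_encard_iff_nontrivial]
  exact lt_of_lt_of_le (by norm_num) (hP.three_le L hL)

theorem exists_third (hP : IsPolarSpace 𝓛) {L : Set Q} (hL : L ∈ 𝓛) (a b : Q) :
    ∃ c ∈ L, c ≠ a ∧ c ≠ b := by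
  by_contra! h
  have hsub : L ⊆ {a, b} := fun c hc => by
    by_cases hca : c = a
    · exact Or.inl hca
    · exact Or.inr (h c hc hca)
  have h1 := (hP.three_le L hL).trans ((Set.encard_le_encard hsub).trans
    (Set.encard_insert_le {b} a))
  rw [Set.encard_singleton] at h1
  exact absurd h1 (by norm_num)

theorem exists_perp (hP : IsPolarSpace 𝓛) {L : Set Q} (hL : L ∈ 𝓛) (p : Q) :
    ∃ q ∈ L, Perp 𝓛 p q := by
  rcases hP.one_or_all L hL p with ⟨q, hq, -⟩ | h
  · exact ⟨q, hq⟩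
  · obtain ⟨q, hq⟩ := (hP.line_nontrivial hL).nonempty
    exact ⟨q, hq, h q hq⟩

theorem perp_of_two (hP : IsPolarSpace 𝓛) {L : Set Q} (hL : L ∈ 𝓛) {p a b c : Q} (ha : a ∈ L)
    (hb : b ∈ L) (hne : a ≠ b) (hpa : Perp 𝓛 p a) (hpb : Perp 𝓛 p b) (hc : c ∈ L) :
    Perp 𝓛 p c := by
  rcases hP.one_or_all L hL p with ⟨q, _, hq⟩ | h
  · exact absurd ((hq a ⟨ha, hpa⟩).trans (hq b ⟨hb, hpb⟩).symm) hne
  · exact h c hc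

theorem line_eq (hP : IsPolarSpace 𝓛) {L M : Set Q} (hL : L ∈ 𝓛) (hM : M ∈ 𝓛) {a b : Q}
    (hne : a ≠ b) (haL : a ∈ L) (hbL : b ∈ L) (haM : a ∈ M) (hbM : b ∈ M) : L = M :=
  hP.eq_of_nontrivial L hL M hM ⟨a, ⟨haL, haM⟩, b, ⟨hbL, hbM⟩, hne⟩

theorem point_eq (hP : IsPolarSpace 𝓛) {L M : Set Q} (hL : L ∈ 𝓛) (hM : M ∈ 𝓛) (hne : L ≠ M)
    {a b : Q} (haL : a ∈ L) (haM : a ∈ M) (hbL : b ∈ L) (hbM : b ∈ M) : a = b := by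
  by_contra h
  exact hne (hP.line_eq hL hM h haL hbL haM hbM)

theorem isSubspace_perp (hP : IsPolarSpace 𝓛) (p : Q) : IsSubspace 𝓛 {x | Perp 𝓛 p x} := by
  rintro L hL ⟨a, ha, b, hb, hne⟩ c hc
  exact hP.perp_of_two hL ha.1 hb.1 hne ha.2 hb.2 hc

theorem isStrong_line (hP : IsPolarSpace 𝓛) {L : Set Q} (hL : L ∈ 𝓛) : IsStrong 𝓛 L :=
  ⟨fun M hM h => (hP.eq_of_nontrivial M hM L hL h).subset, fun _ ha _ hb => Perp.of_mem hL ha hb⟩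

end IsPolarSpace

/-- A subspace in which no point is collinear with all points. -/
structure IsNondegenerate (𝓛 : Set (Set Q)) (Γ : Set Q) : Prop where
  isSubspace : IsSubspace 𝓛 Γ
  exists_not_perp : ∀ p ∈ Γ, ∃ q ∈ Γ, ¬ Perp 𝓛 p q

theorem IsPolarSpace.isNondegenerate_univ (hP : IsPolarSpace 𝓛) :
    IsNondegenerate 𝓛 (Set.univ : Set Q) :=
  ⟨isSubspace_univ, fun p _ => (hP.nondegenerate p).imp fun _ h => ⟨trivial, h⟩⟩

namespace IsNondegenerate

variable {Γ : Set Q}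

/-- The hard case is x ⊥ y with a point w collinear with neither. Then w sees a third point t of the
line xy. A point s not collinear with t sees some s' ≠ t on the line tw, and v is the point of the
line ss' seen by x: if v ⊥ y, then v ⊥ t, so s ⊥ t unless v = s', and in that case x ⊥ w. -/
theorem exists_perp_not_perp (hP : IsPolarSpace 𝓛) (hΓ : IsNondegenerate 𝓛 Γ) {x y : Q}
    (hx : x ∈ Γ) (hy : y ∈ Γ) (hne : x ≠ y) : ∃ v ∈ Γ, Perp 𝓛 v x ∧ ¬ Perp 𝓛 v y := by
  by_cases hxy : Perp 𝓛 x y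
  swap
  · exact ⟨x, hx, Perp.refl x, hxy⟩
  obtain ⟨N, hN, hxN, hyN⟩ := hxy.exists_line hne
  have hNΓ : N ⊆ Γ := hΓ.isSubspace.line_subset hN hxN hyN hne hx hy
  obtain ⟨w, hw, hwy⟩ := hΓ.exists_not_perp y hy
  by_cases hwx : Perp 𝓛 w x
  · exact ⟨w, hw, hwx, fun h => hwy h.symm⟩
  obtain ⟨t, htN, hwt⟩ := hP.exists_perp hN w
  have htx : t ≠ x := by rintro rfl; exact hwx hwt
  have hty : t ≠ y := by rintro rfl; exact hwy hwt.symm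
  obtain ⟨s, hs, hst⟩ := hΓ.exists_not_perp t (hNΓ htN)
  have hwt' : w ≠ t := by
    rintro rfl
    exact hwx (Perp.of_mem hN htN hxN)
  obtain ⟨K, hK, hwK, htK⟩ := hwt.exists_line hwt'
  have hKΓ : K ⊆ Γ := hΓ.isSubspace.line_subset hK hwK htK hwt' hw (hNΓ htN)
  obtain ⟨s', hs'K, hss'⟩ := hP.exists_perp hK s
  have hs't : s' ≠ t := by rintro rfl; exact hst hss'.symm
  have hne' : s ≠ s' := by
    rintro rfl
    exact hst (Perp.of_mem hK htK hs'K)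
  obtain ⟨J, hJ, hsJ, hs'J⟩ := hss'.exists_line hne'
  have hJΓ : J ⊆ Γ := hΓ.isSubspace.line_subset hJ hsJ hs'J hne' hs (hKΓ hs'K)
  obtain ⟨v, hvJ, hxv⟩ := hP.exists_perp hJ x
  refine ⟨v, hJΓ hvJ, hxv.symm, fun hvy => ?_⟩
  have hvt : Perp 𝓛 v t := hP.perp_of_two hN hxN hyN hne hxv.symm hvy htN
  by_cases hvs' : v = s'
  · rw [hvs'] at hxv
    exact hwx (hP.perp_of_two hK htK hs'K hs't.symm (Perp.of_mem hN hxN htN) hxv hwK).symm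
  · exact hst (hP.perp_of_two hJ hvJ hs'J hvs' hvt.symm (Perp.of_mem hK htK hs'K) hsJ)

/-- A model of the residue at z inside Γ. A point v ⊥ z not collinear with t can be moved along the
line vz into the perp of y; it stays non-collinear with t because z ⊥ t. -/
theorem inter_perp (hP : IsPolarSpace 𝓛) (hΓ : IsNondegenerate 𝓛 Γ) {z y : Q}
    (hz : z ∈ Γ) (hzy : ¬ Perp 𝓛 z y) :
    IsNondegenerate 𝓛 (Γ ∩ ({x | Perp 𝓛 z x} ∩ {x | Perp 𝓛 y x})) := by
  refine ⟨hΓ.isSubspace.inter ((hP.isSubspace_perp z).inter (hP.isSubspace_perp y)), ?_⟩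
  rintro t ⟨htΓ, htz, hty⟩
  have htz' : z ≠ t := by rintro rfl; exact hzy (Perp.symm hty)
  obtain ⟨v, hv, hvz, hvt⟩ := hΓ.exists_perp_not_perp hP hz htΓ htz'
  have hvz' : v ≠ z := by rintro rfl; exact hvt htz
  obtain ⟨N, hN, hvN, hzN⟩ := hvz.exists_line hvz'
  have hNΓ : N ⊆ Γ := hΓ.isSubspace.line_subset hN hvN hzN hvz' hv hz
  obtain ⟨v', hv'N, hyv'⟩ := hP.exists_perp hN y
  have hv'z : v' ≠ z := by rintro rfl; exact hzy hyv'.symm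
  refine ⟨v', ⟨hNΓ hv'N, Perp.of_mem hN hzN hv'N, hyv'⟩, fun h => hvt ?_⟩
  exact (hP.perp_of_two hN hzN hv'N hv'z.symm (Perp.symm htz) h hvN).symm

end IsNondegenerate

/-! ### Rank -/

/-- A polar space all of whose strong subspaces have finite rank. -/
structure IsFinitePolarSpace (𝓛 : Set (Set Q)) : Prop extends IsPolarSpace 𝓛 where
  height_ne_top : ∀ X : StrongSubspace 𝓛, Order.height X ≠ ⊤

open Classical in
/-- The rank of a strong subspace: its dimension plus one. -/
noncomputable def rk (𝓛 : Set (Set Q)) (X : Set Q) : ℕ :=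
  if hX : IsStrong 𝓛 X then (Order.height (⟨X, hX⟩ : StrongSubspace 𝓛)).toNat else 0

variable {X Y Z W : Set Q}

namespace IsFinitePolarSpace

theorem coe_rk (hP : IsFinitePolarSpace 𝓛) (hX : IsStrong 𝓛 X) :
    (rk 𝓛 X : ℕ∞) = Order.height (⟨X, hX⟩ : StrongSubspace 𝓛) := by
  rw [rk, dif_pos hX]
  exact ENat.natCast_toNat (hP.height_ne_top _)

theorem rk_lt (hP : IsFinitePolarSpace 𝓛) (hX : IsStrong 𝓛 X) (hY : IsStrong 𝓛 Y) (h : X ⊂ Y) :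
    rk 𝓛 X < rk 𝓛 Y := by
  have h1 : (⟨X, hX⟩ : StrongSubspace 𝓛) < ⟨Y, hY⟩ := h
  have h2 := Order.height_strictMono h1 (lt_top_iff_ne_top.2 (hP.height_ne_top _))
  rw [← hP.coe_rk, ← hP.coe_rk] at h2
  exact_mod_cast h2

theorem rk_mono (hP : IsFinitePolarSpace 𝓛) (hX : IsStrong 𝓛 X) (hY : IsStrong 𝓛 Y) (h : X ⊆ Y) :
    rk 𝓛 X ≤ rk 𝓛 Y := by
  rcases h.eq_or_ssubset with rfl | h
  · exact le_rfl
  · exact (hP.rk_lt hX hY h).le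

theorem eq_of_subset (hP : IsFinitePolarSpace 𝓛) (hX : IsStrong 𝓛 X) (hY : IsStrong 𝓛 Y)
    (h : X ⊆ Y) (hr : rk 𝓛 Y ≤ rk 𝓛 X) : X = Y := by
  rcases h.eq_or_ssubset with rfl | h
  · rfl
  · exact absurd (hP.rk_lt hX hY h) (by omega)

theorem rk_empty (hP : IsFinitePolarSpace 𝓛) : rk 𝓛 (∅ : Set Q) = 0 := by
  have h : Order.height (⟨∅, isStrong_empty⟩ : StrongSubspace 𝓛) = 0 :=
    Order.height_eq_zero.2 fun Y _ => Set.empty_subset Y.1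
  rw [← hP.coe_rk] at h
  exact_mod_cast h

theorem nonempty_of_rk (hP : IsFinitePolarSpace 𝓛) (h : 0 < rk 𝓛 X) : X.Nonempty := by
  rw [Set.nonempty_iff_ne_empty]
  rintro rfl
  rw [hP.rk_empty] at h
  omega

/-- A point outside a strong subspace is separated from it by collinearity. -/
theorem exists_separating (hP : IsFinitePolarSpace 𝓛) {Γ : Set Q} (hΓ : IsNondegenerate 𝓛 Γ)
    (hX : IsStrong 𝓛 X) (hXΓ : X ⊆ Γ) {p : Q} (hp : p ∈ Γ) (hpX : p ∉ X) :
    ∃ q ∈ Γ, (∀ x ∈ X, Perp 𝓛 q x) ∧ ¬ Perp 𝓛 q p := by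
  induction hn : rk 𝓛 X using Nat.strong_induction_on generalizing X Γ p with
  | _ n ih =>
  have hP' := hP.toIsPolarSpace
  rcases X.eq_empty_or_nonempty with rfl | ⟨x, hx⟩
  · obtain ⟨q, hq, hqp⟩ := hΓ.exists_not_perp p hp
    exact ⟨q, hq, by simp, fun h => hqp h.symm⟩
  by_cases hxp : Perp 𝓛 x p
  swap
  · exact ⟨x, hXΓ hx, fun y hy => hX.2 x hx y hy, hxp⟩
  have hne : x ≠ p := by rintro rfl; exact hpX hx
  -- The perp of x and y in Γ replaces the residue at x: every line through x has a point other than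
  -- x in the perp of y. The subspace X and the point p are replaced by their traces, X ∩ y⊥ and p';
  -- the rank drops since x is lost.
  obtain ⟨y, hy, hxy⟩ := hΓ.exists_not_perp x (hXΓ hx)
  have hΓ' := hΓ.inter_perp hP' (hXΓ hx) hxy
  obtain ⟨L, hL, hxL, hpL⟩ := hxp.exists_line hne
  obtain ⟨p', hp'L, hyp'⟩ := hP'.exists_perp hL y
  have hp'x : x ≠ p' := by rintro rfl; exact hxy hyp'.symm
  have hX' : IsStrong 𝓛 (X ∩ {z | Perp 𝓛 y z}) := hX.inter (hP'.isSubspace_perp y)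
  have hlt : X ∩ {z | Perp 𝓛 y z} ⊂ X :=
    ⟨Set.inter_subset_left, fun h => hxy (Perp.symm (h hx).2)⟩
  obtain ⟨q, ⟨hqΓ, hqx, -⟩, hqX, hqp⟩ := ih (rk 𝓛 (X ∩ {z | Perp 𝓛 y z}))
    (hn ▸ hP.rk_lt hX' hX hlt) hΓ' hX'
    (fun z hz => ⟨hXΓ hz.1, hX.2 x hx z hz.1, hz.2⟩)
    (p := p') ⟨hΓ.isSubspace.line_subset hL hxL hpL hne (hXΓ hx) hp hp'L,
      Perp.of_mem hL hxL hp'L, hyp'⟩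
    (fun h => hpX (hX.1.line_subset hL hxL hp'L hp'x hx h.1 hpL)) rfl
  -- As q ⊥ x, collinearity of q with a point is equivalent to collinearity with its trace on the
  -- line through x.
  refine ⟨q, hqΓ, fun z hz => ?_, fun h => hqp ?_⟩
  · by_cases hzx : x = z
    · exact hzx ▸ Perp.symm hqx
    obtain ⟨M, hM, hxM, hzM⟩ := (hX.2 x hx z hz).exists_line hzx
    obtain ⟨z', hz'M, hyz'⟩ := hP'.exists_perp hM y
    have hz'x : x ≠ z' := by rintro rfl; exact hxy hyz'.symm
    exact hP'.perp_of_two hM hxM hz'M hz'x (Perp.symm hqx)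
      (hqX z' ⟨hX.1.line_subset hM hxM hzM hzx hx hz hz'M, hyz'⟩) hzM
  · exact hP'.perp_of_two hL hxL hpL hne (Perp.symm hqx) h hp'L

theorem exists_separating_univ (hP : IsFinitePolarSpace 𝓛) (hX : IsStrong 𝓛 X) {p : Q}
    (hpX : p ∉ X) : ∃ q, (∀ x ∈ X, Perp 𝓛 q x) ∧ ¬ Perp 𝓛 q p := by
  obtain ⟨q, -, h⟩ := hP.exists_separating hP.isNondegenerate_univ hX (Set.subset_univ _)
    (Set.mem_univ p) hpX
  exact ⟨q, h⟩

/-- The axiom of Veblen and Young. -/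
theorem veblen (hP : IsFinitePolarSpace 𝓛) {A B C D : Set Q} (hA : A ∈ 𝓛) (hB : B ∈ 𝓛)
    (hC : C ∈ 𝓛) (hD : D ∈ 𝓛) (hAB : A ≠ B) {p a₁ b₁ a₂ b₂ : Q} (hpA : p ∈ A) (hpB : p ∈ B)
    (ha₁A : a₁ ∈ A) (ha₁C : a₁ ∈ C) (hb₁B : b₁ ∈ B) (hb₁C : b₁ ∈ C)
    (ha₂A : a₂ ∈ A) (ha₂D : a₂ ∈ D) (hb₂B : b₂ ∈ B) (hb₂D : b₂ ∈ D)
    (ha₁ : p ≠ a₁) (hb₁ : p ≠ b₁) (ha₂ : p ≠ a₂) (hb₂ : p ≠ b₂) : (C ∩ D).Nonempty := by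
  have hP' := hP.toIsPolarSpace
  have hab₁ : a₁ ≠ b₁ := by
    rintro rfl; exact ha₁ (hP'.point_eq hA hB hAB hpA hpB ha₁A hb₁B)
  have hab₂ : a₂ ≠ b₂ := by
    rintro rfl; exact ha₂ (hP'.point_eq hA hB hAB hpA hpB ha₂A hb₂B)
  have hpD : p ∉ D := fun h => by
    have h1 := hP'.line_eq hD hA ha₂ h ha₂D hpA ha₂A
    have h2 := hP'.line_eq hD hB hb₂ h hb₂D hpB hb₂B
    exact hAB (h1.symm.trans h2)
  -- With q collinear with D but not with p, the common point must be the point c of C seen by q. If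
  -- c ∉ D, some v ⊥ p collinear with D is not collinear with c; but v ⊥ p and v ⊥ D force v ⊥ A and
  -- v ⊥ B, hence v ⊥ C.
  obtain ⟨q, hqD, hqp⟩ := hP.exists_separating_univ (hP'.isStrong_line hD) hpD
  obtain ⟨c, hcC, hqc⟩ := hP'.exists_perp hC q
  refine ⟨c, hcC, ?_⟩
  by_contra hcD
  have hpC : ∀ x ∈ C, Perp 𝓛 p x := fun x hx => hP'.perp_of_two hC ha₁C hb₁C hab₁
    (Perp.of_mem hA hpA ha₁A) (Perp.of_mem hB hpB hb₁B) hx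
  have hpD' : ∀ x ∈ D, Perp 𝓛 p x := fun x hx => hP'.perp_of_two hD ha₂D hb₂D hab₂
    (Perp.of_mem hA hpA ha₂A) (Perp.of_mem hB hpB hb₂B) hx
  have hΓ := hP'.isNondegenerate_univ.inter_perp hP' (Set.mem_univ p)
    (fun h => hqp h.symm)
  obtain ⟨v, ⟨-, hpv, -⟩, hvD, hvc⟩ := hP.exists_separating hΓ (hP'.isStrong_line hD)
    (fun x hx => ⟨trivial, hpD' x hx, hqD x hx⟩) (p := c) ⟨trivial, hpC c hcC, hqc⟩ hcD
  have h1 : Perp 𝓛 v a₁ :=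
    hP'.perp_of_two hA hpA ha₂A ha₂ (Perp.symm hpv) (hvD _ ha₂D) ha₁A
  have h2 : Perp 𝓛 v b₁ :=
    hP'.perp_of_two hB hpB hb₂B hb₂ (Perp.symm hpv) (hvD _ hb₂D) hb₁B
  exact hvc (hP'.perp_of_two hC ha₁C hb₁C hab₁ h1 h2 hcC)

end IsFinitePolarSpace
end PolarGeometry

namespace PolarGeometry

variable {Q : Type u} {𝓛 : Set (Set Q)} {X Y Z W S : Set Q}

/-! ### Span and join -/

/-- The least subspace containing `S`. -/
def span (𝓛 : Set (Set Q)) (S : Set Q) : Set Q := ⋂₀ {X | IsSubspace 𝓛 X ∧ S ⊆ X}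

/-- The least subspace containing `X` and `Y`. -/
abbrev join (𝓛 : Set (Set Q)) (X Y : Set Q) : Set Q := span 𝓛 (X ∪ Y)

theorem subset_span : S ⊆ span 𝓛 S := Set.subset_sInter fun _ h => h.2

theorem span_subset (hX : IsSubspace 𝓛 X) (h : S ⊆ X) : span 𝓛 S ⊆ X :=
  Set.sInter_subset_of_mem ⟨hX, h⟩

theorem isSubspace_span : IsSubspace 𝓛 (span 𝓛 S) := isSubspace_sInter fun _ h => h.1

theorem left_subset_join : X ⊆ join 𝓛 X Y := Set.subset_union_left.trans subset_span

theorem right_subset_join : Y ⊆ join 𝓛 X Y := Set.subset_union_right.trans subset_span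

theorem join_subset (hZ : IsSubspace 𝓛 Z) (hX : X ⊆ Z) (hY : Y ⊆ Z) : join 𝓛 X Y ⊆ Z :=
  span_subset hZ (Set.union_subset hX hY)

/-- Every point of `X` is collinear with every point of `Y`. -/
def PerpSets (𝓛 : Set (Set Q)) (X Y : Set Q) : Prop := ∀ a ∈ X, ∀ b ∈ Y, Perp 𝓛 a b

theorem PerpSets.symm (h : PerpSets 𝓛 X Y) : PerpSets 𝓛 Y X := fun a ha b hb => (h b hb a ha).symm

theorem PerpSets.mono {X' Y' : Set Q} (h : PerpSets 𝓛 X Y) (hX : X' ⊆ X) (hY : Y' ⊆ Y) :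
    PerpSets 𝓛 X' Y' := fun a ha b hb => h a (hX ha) b (hY hb)

theorem IsStrong.perpSets (h : IsStrong 𝓛 Z) (hX : X ⊆ Z) (hY : Y ⊆ Z) : PerpSets 𝓛 X Y :=
  fun a ha b hb => h.2 a (hX ha) b (hY hb)

theorem IsPolarSpace.perpSets_span (hP : IsPolarSpace 𝓛) (h : PerpSets 𝓛 X S) :
    PerpSets 𝓛 X (span 𝓛 S) := fun a ha =>
  span_subset (hP.isSubspace_perp a) (fun s hs => h a ha s hs)

theorem IsPolarSpace.perpSets_join (hP : IsPolarSpace 𝓛) (hX : PerpSets 𝓛 Z X)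
    (hY : PerpSets 𝓛 Z Y) : PerpSets 𝓛 Z (join 𝓛 X Y) :=
  hP.perpSets_span fun a ha b hb => hb.elim (hX a ha b) (hY a ha b)

theorem IsPolarSpace.isStrong_span (hP : IsPolarSpace 𝓛) (h : PerpSets 𝓛 S S) :
    IsStrong 𝓛 (span 𝓛 S) :=
  ⟨isSubspace_span, hP.perpSets_span (hP.perpSets_span h).symm⟩

theorem IsPolarSpace.isStrong_join (hP : IsPolarSpace 𝓛) (hX : IsStrong 𝓛 X) (hY : IsStrong 𝓛 Y)
    (h : PerpSets 𝓛 X Y) : IsStrong 𝓛 (join 𝓛 X Y) := by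
  refine hP.isStrong_span fun a ha b hb => ?_
  rcases ha with ha | ha <;> rcases hb with hb | hb
  · exact hX.2 a ha b hb
  · exact h a ha b hb
  · exact (h b hb a ha).symm
  · exact hY.2 a ha b hb

namespace IsFinitePolarSpace

/-- A proper subspace meeting all lines of a strong subspace has corank one. -/
theorem rk_eq_add_one (hP : IsFinitePolarSpace 𝓛) (hX : IsStrong 𝓛 X) (hW : IsStrong 𝓛 W)
    (hXW : X ⊂ W) (hline : ∀ L ∈ 𝓛, L ⊆ W → (L ∩ X).Nonempty) : rk 𝓛 W = rk 𝓛 X + 1 := by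
  induction hn : rk 𝓛 X using Nat.strong_induction_on generalizing X W with
  | _ n ih =>
  subst hn
  refine le_antisymm ?_ (hP.rk_lt hX hW hXW)
  -- It suffices to bound the rank of each strong Z ⊂ W by that of X. If Z is not inside X, it
  -- cannot contain X, so Z ∩ X has smaller rank than X and still meets all lines of Z; the
  -- induction hypothesis applies to Z ∩ X ⊂ Z.
  have key : Order.height (⟨W, hW⟩ : StrongSubspace 𝓛) ≤ ((rk 𝓛 X + 1 : ℕ) : ℕ∞) := by
    rw [Order.height_le_coe_iff]
    rintro ⟨Z, hZ⟩ hlt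
    have hZW : Z ⊂ W := hlt
    rw [← hP.coe_rk]
    have : rk 𝓛 Z ≤ rk 𝓛 X := by
      by_cases hZX : Z ⊆ X
      · exact hP.rk_mono hZ hX hZX
      obtain ⟨z, hz, hzX⟩ := Set.not_subset.1 hZX
      have hXZ : ¬ X ⊆ Z := fun h => by
        obtain ⟨w, hw, hwZ⟩ := Set.exists_of_ssubset hZW
        have hne : w ≠ z := by rintro rfl; exact hwZ hz
        obtain ⟨L, hL, hwL, hzL⟩ := (hW.2 w hw z (hZW.subset hz)).exists_line hne
        obtain ⟨y, hyL, hyX⟩ :=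
          hline L hL (hW.1.line_subset hL hwL hzL hne hw (hZW.subset hz))
        have hyz : y ≠ z := by rintro rfl; exact hzX hyX
        exact hwZ (hZ.1.line_subset hL hyL hzL hyz (h hyX) hz hwL)
      have hlt' : rk 𝓛 (Z ∩ X) < rk 𝓛 X := hP.rk_lt (hZ.inter hX.1) hX
        ⟨Set.inter_subset_right, fun h => hXZ fun y hy => (h hy).1⟩
      have := ih _ hlt' (hZ.inter hX.1) hZ
        ⟨Set.inter_subset_left, fun h => hZX fun y hy => (h hy).2⟩
        (fun L hL hLZ => by
          obtain ⟨y, hyL, hyX⟩ := hline L hL (hLZ.trans hZW.subset)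
          exact ⟨y, hyL, hLZ hyL, hyX⟩) rfl
      omega
    exact_mod_cast Nat.lt_succ_of_le this
  rw [← hP.coe_rk] at key
  exact_mod_cast key

/-- The points on the lines joining `p` to the points of `X`. -/
def cone (𝓛 : Set (Set Q)) (p : Q) (X : Set Q) : Set Q :=
  {z | z = p ∨ ∃ x ∈ X, ∃ L ∈ 𝓛, p ∈ L ∧ x ∈ L ∧ z ∈ L}

/-- The Veblen–Young axiom is used twice: with vertex p it makes L meet the line x₁x₂ in a point w,
and with vertex z₁ it makes each line from p to a point of L meet x₁x₂. The condition z₁ ≠ x₁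
ensures z₁ ≠ w. -/
theorem line_subset_cone_of_ne (hP : IsFinitePolarSpace 𝓛) (hX : IsStrong 𝓛 X) {p : Q}
    (hpX : p ∉ X) {L A B : Set Q} (hL : L ∈ 𝓛) (hA : A ∈ 𝓛) (hB : B ∈ 𝓛)
    {z₁ z₂ x₁ x₂ : Q} (hpL : p ∉ L) (h₁ : z₁ ∈ L) (h₂ : z₂ ∈ L) (hne : z₁ ≠ z₂)
    (hx₁ : x₁ ∈ X) (hx₂ : x₂ ∈ X) (hpA : p ∈ A) (hxA : x₁ ∈ A) (hzA : z₁ ∈ A)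
    (hpB : p ∈ B) (hxB : x₂ ∈ B) (hzB : z₂ ∈ B) (hzx : z₁ ≠ x₁) :
    L ⊆ cone 𝓛 p X ∧ (L ∩ X).Nonempty := by
  have hP' := hP.toIsPolarSpace
  have hpz₁ : p ≠ z₁ := by rintro rfl; exact hpL h₁
  have hpz₂ : p ≠ z₂ := by rintro rfl; exact hpL h₂
  have hpx₁ : p ≠ x₁ := by rintro rfl; exact hpX hx₁
  have hpx₂ : p ≠ x₂ := by rintro rfl; exact hpX hx₂
  have hAB : A ≠ B := by
    rintro rfl
    exact hpL ((hP'.line_eq hL hA hne h₁ h₂ hzA hzB) ▸ hpA)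
  have hx₁₂ : x₁ ≠ x₂ := by
    rintro rfl
    exact hAB (hP'.line_eq hA hB hpx₁ hpA hxA hpB hxB)
  obtain ⟨D, hD, hx₁D, hx₂D⟩ := (hX.2 x₁ hx₁ x₂ hx₂).exists_line hx₁₂
  have hDX : D ⊆ X := hX.1.line_subset hD hx₁D hx₂D hx₁₂ hx₁ hx₂
  obtain ⟨w, hwL, hwD⟩ := hP.veblen hA hB hL hD hAB hpA hpB hzA h₁ hzB h₂ hxA hx₁D hxB hx₂D
    hpz₁ hpz₂ hpx₁ hpx₂
  refine ⟨fun z hz => ?_, w, hwL, hDX hwD⟩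
  by_cases hzz : z₁ = z
  · exact Or.inr ⟨x₁, hx₁, A, hA, hpA, hxA, hzz ▸ hzA⟩
  have hpz : p ≠ z := by rintro rfl; exact hpL hz
  have hperp : Perp 𝓛 p z := hP'.perp_of_two hL h₁ h₂ hne (Perp.of_mem hA hpA hzA)
    (Perp.of_mem hB hpB hzB) hz
  obtain ⟨E, hE, hpE, hzE⟩ := hperp.exists_line hpz
  have hwz : z₁ ≠ w := by
    rintro rfl
    exact hpX (hX.1.line_subset hA hzA hxA hzx (hDX hwD) hx₁ hpA)
  have hAL : A ≠ L := by rintro rfl; exact hpL hpA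
  obtain ⟨y, hyE, hyD⟩ := hP.veblen hA hL hE hD hAL hzA h₁ hpA hpE hz hzE hxA hx₁D hwL hwD
    hpz₁.symm hzz hzx hwz
  exact Or.inr ⟨y, hDX hyD, E, hE, hpE, hyE, hzE⟩

theorem line_subset_cone (hP : IsFinitePolarSpace 𝓛) (hX : IsStrong 𝓛 X) {p : Q}
    (hpX : p ∉ X) {L : Set Q} (hL : L ∈ 𝓛) {z₁ z₂ : Q} (h₁ : z₁ ∈ L) (h₂ : z₂ ∈ L)
    (hne : z₁ ≠ z₂) (hz₁ : z₁ ∈ cone 𝓛 p X) (hz₂ : z₂ ∈ cone 𝓛 p X) :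
    L ⊆ cone 𝓛 p X ∧ (L ∩ X).Nonempty := by
  have hP' := hP.toIsPolarSpace
  have hthrough : ∀ z ∈ L, z ≠ p → p ∈ L → z ∈ cone 𝓛 p X →
      L ⊆ cone 𝓛 p X ∧ (L ∩ X).Nonempty := by
    rintro z hz hzp hpL (rfl | ⟨x, hx, A, hA, hpA, hxA, hzA⟩)
    · exact absurd rfl hzp
    · obtain rfl := hP'.line_eq hL hA hzp hz hpL hzA hpA
      exact ⟨fun y hy => Or.inr ⟨x, hx, L, hL, hpL, hxA, hy⟩, x, hxA, hx⟩
  by_cases hpL : p ∈ L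
  · by_cases h : z₁ = p
    · exact hthrough z₂ h₂ (by rw [← h]; exact hne.symm) hpL hz₂
    · exact hthrough z₁ h₁ h hpL hz₁
  rcases hz₁ with rfl | ⟨x₁, hx₁, A, hA, hpA, hxA, hzA⟩
  · exact absurd h₁ hpL
  rcases hz₂ with rfl | ⟨x₂, hx₂, B, hB, hpB, hxB, hzB⟩
  · exact absurd h₂ hpL
  by_cases hzx₁ : z₁ = x₁
  · by_cases hzx₂ : z₂ = x₂
    · subst hzx₁ hzx₂
      have hLX : L ⊆ X := hX.1.line_subset hL h₁ h₂ hne hx₁ hx₂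
      refine ⟨fun z hz => ?_, z₁, h₁, hx₁⟩
      have hperp : Perp 𝓛 p z := hP'.perp_of_two hL h₁ h₂ hne (Perp.of_mem hA hpA hzA)
        (Perp.of_mem hB hpB hzB) hz
      obtain ⟨E, hE, hpE, hzE⟩ := hperp.exists_line (by rintro rfl; exact hpL hz)
      exact Or.inr ⟨z, hLX hz, E, hE, hpE, hzE, hzE⟩
    · exact hP.line_subset_cone_of_ne hX hpX hL hB hA hpL h₂ h₁ hne.symm hx₂ hx₁ hpB hxB hzB
        hpA hxA hzA hzx₂
  · exact hP.line_subset_cone_of_ne hX hpX hL hA hB hpL h₁ h₂ hne hx₁ hx₂ hpA hxA hzA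
        hpB hxB hzB hzx₁

theorem span_insert_eq_cone (hP : IsFinitePolarSpace 𝓛) (hX : IsStrong 𝓛 X) {p : Q}
    (hpX : p ∉ X) (h : ∀ x ∈ X, Perp 𝓛 p x) : span 𝓛 (insert p X) = cone 𝓛 p X := by
  apply subset_antisymm
  · refine span_subset ?_ ?_
    · rintro L hL ⟨a, ha, b, hb, hne⟩
      exact (hP.line_subset_cone hX hpX hL ha.1 hb.1 hne ha.2 hb.2).1
    · refine Set.insert_subset (Or.inl rfl) fun x hx => ?_
      obtain ⟨E, hE, hpE, hzE⟩ := (h x hx).exists_line (by rintro rfl; exact hpX hx)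
      exact Or.inr ⟨x, hx, E, hE, hpE, hzE, hzE⟩
  · rintro z (rfl | ⟨x, hx, E, hE, hpE, hxE, hzE⟩)
    · exact subset_span (Set.mem_insert _ _)
    · exact isSubspace_span.line_subset hE hpE hxE (by rintro rfl; exact hpX hx)
        (subset_span (Set.mem_insert _ _)) (subset_span (Set.mem_insert_of_mem _ hx)) hzE

theorem isStrong_insert (hP : IsFinitePolarSpace 𝓛) (hX : IsStrong 𝓛 X) {p : Q}
    (h : ∀ x ∈ X, Perp 𝓛 p x) : IsStrong 𝓛 (span 𝓛 (insert p X)) := by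
  refine hP.isStrong_span ?_
  rintro a (rfl | ha) b (rfl | hb)
  · exact Perp.refl _
  · exact h b hb
  · exact (h a ha).symm
  · exact hX.2 a ha b hb

/-- The span is the cone over `X`, and every line in the cone meets `X`, so `rk_eq_add_one` applies.
-/
theorem rk_insert (hP : IsFinitePolarSpace 𝓛) (hX : IsStrong 𝓛 X) {p : Q}
    (hpX : p ∉ X) (h : ∀ x ∈ X, Perp 𝓛 p x) : rk 𝓛 (span 𝓛 (insert p X)) = rk 𝓛 X + 1 := by
  refine hP.rk_eq_add_one hX (hP.isStrong_insert hX h)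
    ⟨(Set.subset_insert _ _).trans subset_span,
      fun h' => hpX (h' (subset_span (Set.mem_insert _ _)))⟩ fun L hL hLW => ?_
  rw [hP.span_insert_eq_cone hX hpX h] at hLW
  obtain ⟨a, ha, b, hb, hne⟩ := hP.line_nontrivial hL
  exact (hP.line_subset_cone hX hpX hL ha hb hne (hLW ha) (hLW hb)).2

/-- The dimension formula. -/
theorem rk_join (hP : IsFinitePolarSpace 𝓛) (hX : IsStrong 𝓛 X) (hY : IsStrong 𝓛 Y)
    (h : PerpSets 𝓛 X Y) : rk 𝓛 (join 𝓛 X Y) + rk 𝓛 (X ∩ Y) = rk 𝓛 X + rk 𝓛 Y := by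
  induction hn : rk 𝓛 Y - rk 𝓛 (X ∩ Y) using Nat.strong_induction_on generalizing X with
  | _ n ih =>
  subst hn
  by_cases hYX : Y ⊆ X
  · have h1 : join 𝓛 X Y = X := (join_subset hX.1 subset_rfl hYX).antisymm left_subset_join
    rw [h1, Set.inter_eq_right.2 hYX]
  obtain ⟨y, hyY, hyX⟩ := Set.not_subset.1 hYX
  have hyX' : ∀ x ∈ X, Perp 𝓛 y x := fun x hx => (h x hx y hyY).symm
  have hX₁ := hP.isStrong_insert hX hyX'
  have hr := hP.rk_insert hX hyX hyX'
  -- The modular law for a point y of Y outside X. Adjoining y raises the ranks of X and of X ∩ Y by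
  -- one each and leaves the join unchanged.
  have hi : span 𝓛 (insert y X) ∩ Y = span 𝓛 (insert y (X ∩ Y)) := by
    rw [hP.span_insert_eq_cone hX hyX hyX', hP.span_insert_eq_cone (hX.inter hY.1)
      (fun h => hyX h.1) (fun x hx => hyX' x hx.1)]
    ext z
    constructor
    · rintro ⟨rfl | ⟨x, hx, E, hE, hyE, hxE, hzE⟩, hzY⟩
      · exact Or.inl rfl
      · by_cases hzy : z = y
        · exact Or.inl hzy
        · exact Or.inr ⟨x, ⟨hx, hY.1.line_subset hE hzE hyE hzy hzY hyY hxE⟩, E, hE, hyE,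
            hxE, hzE⟩
    · rintro (rfl | ⟨x, ⟨hx, hxY⟩, E, hE, hyE, hxE, hzE⟩)
      · exact ⟨Or.inl rfl, hyY⟩
      · exact ⟨Or.inr ⟨x, hx, E, hE, hyE, hxE, hzE⟩, hY.1.line_subset hE hyE hxE
          (by rintro rfl; exact hyX hx) hyY hxY hzE⟩
  have hri := hP.rk_insert (hX.inter hY.1) (p := y) (fun h => hyX h.1) (fun x hx => hyX' x hx.1)
  have hle : rk 𝓛 (span 𝓛 (insert y (X ∩ Y))) ≤ rk 𝓛 Y := by
    rw [← hi]
    exact hP.rk_mono (hX₁.inter hY.1) hY Set.inter_subset_right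
  have hj : join 𝓛 (span 𝓛 (insert y X)) Y = join 𝓛 X Y := by
    apply subset_antisymm
    · exact join_subset isSubspace_span
        (span_subset isSubspace_span (Set.insert_subset (right_subset_join hyY) left_subset_join))
        right_subset_join
    · exact join_subset isSubspace_span
        (((Set.subset_insert _ _).trans subset_span).trans left_subset_join) right_subset_join
  have := ih _ (by rw [hi]; omega) hX₁ (hP.perpSets_span (S := insert y X) (X := Y) (by
    rintro a ha b (rfl | hb)
    · exact hY.2 a ha _ hyY
    · exact (h b hb a ha).symm)).symm rfl
  rw [hj, hi] at this
  omega

end IsFinitePolarSpace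
end PolarGeometry

namespace PolarGeometry

variable {Q : Type u} {𝓛 : Set (Set Q)} {X Y Z W S A B M U V : Set Q}

/-! ### Subspaces of a strong subspace -/

theorem IsStrong.of_subset (hZ : IsStrong 𝓛 Z) (hX : IsSubspace 𝓛 X) (h : X ⊆ Z) :
    IsStrong 𝓛 X :=
  ⟨hX, hZ.perpSets h h⟩

theorem IsStrong.join_of_subset (hZ : IsStrong 𝓛 Z) (hX : X ⊆ Z) (hY : Y ⊆ Z) :
    IsStrong 𝓛 (join 𝓛 X Y) :=
  hZ.of_subset isSubspace_span (join_subset hZ.1 hX hY)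

/-- The points collinear with all points of `S`. -/
def perpSet (𝓛 : Set (Set Q)) (S : Set Q) : Set Q := {x | ∀ a ∈ S, Perp 𝓛 a x}

theorem IsPolarSpace.isSubspace_perpSet (hP : IsPolarSpace 𝓛) : IsSubspace 𝓛 (perpSet 𝓛 S) := by
  rintro L hL ⟨a, ha, b, hb, hne⟩ c hc s hs
  exact hP.perp_of_two hL ha.1 hb.1 hne (ha.2 s hs) (hb.2 s hs) hc

/-- A strong subspace is not the union of two proper subspaces, because the line from a point
outside U to a point outside V has a third point. Applied with V = H this lets affine parts
determine strong subspaces. -/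
theorem IsPolarSpace.exists_not_mem_two (hP : IsPolarSpace 𝓛) (hX : IsStrong 𝓛 X)
    (hU : IsSubspace 𝓛 U) (hV : IsSubspace 𝓛 V) (h₁ : ¬ X ⊆ U) (h₂ : ¬ X ⊆ V) :
    ∃ x ∈ X, x ∉ U ∧ x ∉ V := by
  by_contra! h
  obtain ⟨a, ha, haU⟩ := Set.not_subset.1 h₁
  obtain ⟨b, hb, hbV⟩ := Set.not_subset.1 h₂
  have haV := h a ha haU
  have hbU : b ∈ U := by
    by_contra hbU
    exact hbV (h b hb hbU)
  have hne : a ≠ b := by rintro rfl; exact haU hbU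
  obtain ⟨L, hL, haL, hbL⟩ := (hX.2 a ha b hb).exists_line hne
  obtain ⟨c, hc, hca, hcb⟩ := hP.exists_third hL a b
  have hcX := hX.1.line_subset hL haL hbL hne ha hb hc
  by_cases hcU : c ∈ U
  · exact haU (hU.line_subset hL hc hbL hcb hcU hbU haL)
  · exact hbV (hV.line_subset hL hc haL hca (h c hcX hcU) haV hbL)

namespace IsFinitePolarSpace

theorem rk_inter_of_ne (hP : IsFinitePolarSpace 𝓛) {k : ℕ} (hZ : IsStrong 𝓛 Z)
    (hX : IsStrong 𝓛 X) (hY : IsStrong 𝓛 Y) (hXZ : X ⊆ Z) (hYZ : Y ⊆ Z) (hrX : rk 𝓛 X = k + 1)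
    (hrY : rk 𝓛 Y = k + 1) (hrZ : rk 𝓛 Z = k + 2) (hne : X ≠ Y) : rk 𝓛 (X ∩ Y) = k := by
  have hJ := hZ.join_of_subset hXZ hYZ
  have h1 := hP.rk_join hX hY (hZ.perpSets hXZ hYZ)
  have h2 := hP.rk_mono hJ hZ (join_subset hZ.1 hXZ hYZ)
  have h3 : rk 𝓛 X < rk 𝓛 (join 𝓛 X Y) := by
    refine hP.rk_lt hX hJ ⟨left_subset_join, fun h => hne ?_⟩
    exact (hP.eq_of_subset hY hX (right_subset_join.trans h) (by omega)).symm
  omega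

theorem rk_join_of_ne (hP : IsFinitePolarSpace 𝓛) {k : ℕ} (hX : IsStrong 𝓛 X)
    (hY : IsStrong 𝓛 Y) (h : PerpSets 𝓛 X Y) (hrX : rk 𝓛 X = k + 1)
    (hrY : rk 𝓛 Y = k + 1) (hr : rk 𝓛 (X ∩ Y) = k) : rk 𝓛 (join 𝓛 X Y) = k + 2 := by
  have := hP.rk_join hX hY h
  omega

/-- Two hyperplanes of a strong subspace generate it. -/
theorem subset_of_two (hP : IsFinitePolarSpace 𝓛) (hZ : IsStrong 𝓛 Z)
    (hX : IsStrong 𝓛 X) (hY : IsStrong 𝓛 Y) (hXZ : X ⊆ Z) (hYZ : Y ⊆ Z)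
    (hr : rk 𝓛 X = rk 𝓛 Y) (hrZ : rk 𝓛 Z ≤ rk 𝓛 X + 1) (hne : X ≠ Y) (hS : IsSubspace 𝓛 S)
    (hXS : X ⊆ S) (hYS : Y ⊆ S) : Z ⊆ S := by
  have hJ := hZ.join_of_subset hXZ hYZ
  have h3 : rk 𝓛 X < rk 𝓛 (join 𝓛 X Y) := by
    refine hP.rk_lt hX hJ ⟨left_subset_join, fun h => hne ?_⟩
    exact (hP.eq_of_subset hY hX (right_subset_join.trans h) (by omega)).symm
  rw [← hP.eq_of_subset hJ hZ (join_subset hZ.1 hXZ hYZ) (by omega)]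
  exact join_subset hS hXS hYS

theorem inter_eq (hP : IsFinitePolarSpace 𝓛) (hY : IsStrong 𝓛 Y) (hA : IsStrong 𝓛 A)
    (hB : IsSubspace 𝓛 B) (hYA : Y ⊆ A) (hYB : Y ⊆ B) (hAB : ¬ A ⊆ B)
    (hr : rk 𝓛 A ≤ rk 𝓛 Y + 1) : A ∩ B = Y := by
  refine (hP.eq_of_subset hY (hA.inter hB) (Set.subset_inter hYA hYB) ?_).symm
  have : rk 𝓛 (A ∩ B) < rk 𝓛 A := hP.rk_lt (hA.inter hB) hA
    ⟨Set.inter_subset_left, fun h => hAB fun x hx => (h hx).2⟩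
  omega

theorem exists_between_avoiding (hP : IsFinitePolarSpace 𝓛) (hS : IsStrong 𝓛 S)
    (hW : IsStrong 𝓛 W) (hSW : S ⊆ W) {p : Q} (hpW : p ∈ W) (hpS : p ∉ S) {n : ℕ}
    (hn : rk 𝓛 S ≤ n) (hnW : n < rk 𝓛 W) :
    ∃ X, IsStrong 𝓛 X ∧ S ⊆ X ∧ X ⊆ W ∧ rk 𝓛 X = n ∧ p ∉ X := by
  induction n, hn using Nat.le_induction with
  | base => exact ⟨S, hS, subset_rfl, hSW, rfl, hpS⟩
  | succ n hn ih =>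
    obtain ⟨X, hX, hSX, hXW, hrX, hpX⟩ := ih (by omega)
    have hperp : ∀ q ∈ W, ∀ x ∈ X, Perp 𝓛 q x := fun q hq x hx => hW.2 q hq x (hXW hx)
    have hXp := hP.isStrong_insert hX (hperp p hpW)
    have hXpW : span 𝓛 (insert p X) ⊆ W := span_subset hW.1 (Set.insert_subset hpW hXW)
    have hr := hP.rk_insert hX hpX (hperp p hpW)
    obtain ⟨w, hwW, hw⟩ : ∃ w ∈ W, w ∉ span 𝓛 (insert p X) := by
      by_contra! h
      have := hP.rk_mono hW hXp h
      omega
    have hwX : w ∉ X := fun h => hw (subset_span (Set.mem_insert_of_mem _ h))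
    have hXw := hP.isStrong_insert hX (hperp w hwW)
    have hrw := hP.rk_insert hX hwX (hperp w hwW)
    refine ⟨_, hXw, (hSX.trans (Set.subset_insert _ _)).trans subset_span,
      span_subset hW.1 (Set.insert_subset hwW hXW), by omega, fun hp => ?_⟩
    have := hP.eq_of_subset hXp hXw (span_subset hXw.1 (Set.insert_subset hp
      ((Set.subset_insert _ _).trans subset_span))) (by omega)
    exact hw (this ▸ subset_span (Set.mem_insert _ _))

theorem exists_between (hP : IsFinitePolarSpace 𝓛) (hS : IsStrong 𝓛 S)
    (hW : IsStrong 𝓛 W) (hSW : S ⊆ W) {n : ℕ} (hn : rk 𝓛 S ≤ n) (hnW : n ≤ rk 𝓛 W) :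
    ∃ X, IsStrong 𝓛 X ∧ S ⊆ X ∧ X ⊆ W ∧ rk 𝓛 X = n := by
  rcases hnW.eq_or_lt with rfl | hlt
  · exact ⟨W, hW, hSW, subset_rfl, rfl⟩
  obtain ⟨p, hpW, hpS⟩ : ∃ p ∈ W, p ∉ S := by
    by_contra! h
    have := hP.rk_mono hW hS h
    omega
  obtain ⟨X, hX, h1, h2, h3, -⟩ := hP.exists_between_avoiding hS hW hSW hpW hpS hn hlt
  exact ⟨X, hX, h1, h2, h3⟩

/-- Adding a point to a strong subspace. -/
theorem exists_insert (hP : IsFinitePolarSpace 𝓛) (hX : IsStrong 𝓛 X) {p : Q} (hpX : p ∉ X)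
    (h : ∀ x ∈ X, Perp 𝓛 p x) : ∃ Z, IsStrong 𝓛 Z ∧ X ⊆ Z ∧ p ∈ Z ∧ rk 𝓛 Z = rk 𝓛 X + 1 ∧
      ∀ S, IsSubspace 𝓛 S → X ⊆ S → p ∈ S → Z ⊆ S :=
  ⟨_, hP.isStrong_insert hX h, (Set.subset_insert _ _).trans subset_span,
    subset_span (Set.mem_insert _ _), hP.rk_insert hX hpX h,
    fun _ hS h1 h2 => span_subset hS (Set.insert_subset h2 h1)⟩

theorem subset_of_insert (hP : IsFinitePolarSpace 𝓛) (hX : IsStrong 𝓛 X) (hZ : IsStrong 𝓛 Z)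
    (hXZ : X ⊆ Z) (hr : rk 𝓛 Z ≤ rk 𝓛 X + 1) {p : Q} (hpZ : p ∈ Z) (hpX : p ∉ X)
    (hS : IsSubspace 𝓛 S) (hXS : X ⊆ S) (hpS : p ∈ S) : Z ⊆ S := by
  have hperp : ∀ x ∈ X, Perp 𝓛 p x := fun x hx => hZ.2 p hpZ x (hXZ hx)
  obtain ⟨T, hT, h1, h2, h3, h4⟩ := hP.exists_insert hX hpX hperp
  rw [← hP.eq_of_subset hT hZ (h4 Z hZ.1 hXZ hpZ) (by omega)]
  exact h4 S hS hXS hpS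

/-- A pencil has at least three members. -/
theorem exists_third_member (hP : IsFinitePolarSpace 𝓛) {k : ℕ} (hY : IsStrong 𝓛 Y)
    (hM : IsStrong 𝓛 M) (hA : IsStrong 𝓛 A) (hB : IsStrong 𝓛 B) (hYA : Y ⊆ A)
    (hAM : A ⊆ M) (hBM : B ⊆ M) (hrY : rk 𝓛 Y = k) (hrA : rk 𝓛 A = k + 1)
    (hrB : rk 𝓛 B = k + 1) (hne : A ≠ B) :
    ∃ C, IsStrong 𝓛 C ∧ Y ⊆ C ∧ C ⊆ M ∧ rk 𝓛 C = k + 1 ∧ C ≠ A ∧ C ≠ B := by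
  have hAB : ¬ A ⊆ B := fun h => hne (hP.eq_of_subset hA hB h (by omega))
  have hBA : ¬ B ⊆ A := fun h => hne (hP.eq_of_subset hB hA h (by omega)).symm
  obtain ⟨a, haA, haB⟩ := Set.not_subset.1 hAB
  obtain ⟨b, hbB, hbA⟩ := Set.not_subset.1 hBA
  have hab : a ≠ b := by rintro rfl; exact haB hbB
  -- A third point c of the line ab lies in neither A nor B, so Y and c span a new member.
  obtain ⟨L, hL, haL, hbL⟩ := (hM.2 a (hAM haA) b (hBM hbB)).exists_line hab
  obtain ⟨c, hcL, hca, hcb⟩ := hP.exists_third hL a b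
  have hcM := hM.1.line_subset hL haL hbL hab (hAM haA) (hBM hbB) hcL
  have hcA : c ∉ A := fun h => hbA (hA.1.line_subset hL haL hcL hca.symm haA h hbL)
  have hcB : c ∉ B := fun h => haB (hB.1.line_subset hL hbL hcL hcb.symm hbB h haL)
  obtain ⟨C, hC, h1, h2, h3, h4⟩ := hP.exists_insert hY (fun h => hcA (hYA h))
    (fun x hx => hM.2 c hcM x (hAM (hYA hx)))
  exact ⟨C, hC, h1, h4 M hM.1 (hYA.trans hAM) hcM, by omega, fun h => hcA (h ▸ h2),
    fun h => hcB (h ▸ h2)⟩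

theorem rk_le_inter_perp (hP : IsFinitePolarSpace 𝓛) (hM : IsStrong 𝓛 M) (p : Q) :
    rk 𝓛 M ≤ rk 𝓛 (M ∩ {x | Perp 𝓛 p x}) + 1 := by
  have hs := hM.inter (hP.isSubspace_perp p)
  by_cases h : M ⊆ {x | Perp 𝓛 p x}
  · rw [Set.inter_eq_left.2 h]
    omega
  · refine (hP.rk_eq_add_one hs hM ⟨Set.inter_subset_left, fun h' => h fun x hx => (h' hx).2⟩
      fun L hL hLM => ?_).le
    obtain ⟨q, hq, hpq⟩ := hP.exists_perp hL p
    exact ⟨q, hq, hLM hq, hpq⟩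

/-- The perp of `A` meets a strong subspace `M` collinear with a hyperplane of `A` in a subspace of
corank at most one. -/
theorem rk_le_inter_perpSet (hP : IsFinitePolarSpace 𝓛) (hY : IsStrong 𝓛 Y) (hA : IsStrong 𝓛 A)
    (hYA : Y ⊆ A) (hr : rk 𝓛 A = rk 𝓛 Y + 1) (hM : IsStrong 𝓛 M) (hYM : PerpSets 𝓛 Y M) :
    rk 𝓛 M ≤ rk 𝓛 (M ∩ perpSet 𝓛 A) + 1 := by
  obtain ⟨a, haA, haY⟩ : ∃ a ∈ A, a ∉ Y := by
    by_contra! h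
    have := hP.rk_mono hA hY h
    omega
  have : M ∩ {x | Perp 𝓛 a x} = M ∩ perpSet 𝓛 A := by
    apply subset_antisymm
    · rintro x ⟨hxM, hax⟩
      refine ⟨hxM, fun b hb => ?_⟩
      have := hP.subset_of_insert hY hA hYA hr.le haA haY (hP.isSubspace_perp x)
        (fun y hy => (hYM y hy x hxM).symm) (Perp.symm hax) hb
      exact Perp.symm this
    · exact fun x hx => ⟨hx.1, hx.2 a haA⟩
  rw [← this]
  exact hP.rk_le_inter_perp hM a

theorem rk_inter_perpSet_le (hP : IsFinitePolarSpace 𝓛) (hM : IsStrong 𝓛 M)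
    (h : ¬ PerpSets 𝓛 A M) : rk 𝓛 (M ∩ perpSet 𝓛 A) < rk 𝓛 M :=
  hP.rk_lt (hM.inter hP.isSubspace_perpSet) hM
    ⟨Set.inter_subset_left, fun h' => h fun a ha _ hx => (h' hx).2 a ha⟩

end IsFinitePolarSpace

/-- A polar space in which the maximal rank of strong subspaces is `n`. -/
structure HasRank (𝓛 : Set (Set Q)) (n : ℕ) : Prop extends IsFinitePolarSpace 𝓛 where
  rk_le : ∀ X, IsStrong 𝓛 X → rk 𝓛 X ≤ n
  exists_rk : ∃ X, IsStrong 𝓛 X ∧ rk 𝓛 X = n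

namespace HasRank

variable {n : ℕ}

/-- One M of rank n suffices to extend every X of smaller rank. Points are adjoined to X ∩ M until X
is reached; each costs M at most one rank when M is cut by its perp. Hence M ∩ X⊥ has larger rank
than X ∩ M, and contains a point outside X. -/
theorem exists_perp_not_mem (hR : HasRank 𝓛 n) (hX : IsStrong 𝓛 X) (hr : rk 𝓛 X < n) :
    ∃ p ∉ X, ∀ x ∈ X, Perp 𝓛 p x := by
  have hP := hR.toIsFinitePolarSpace
  obtain ⟨M, hM, hrM⟩ := hR.exists_rk
  have key : ∀ j, ∀ D M : Set Q, IsStrong 𝓛 D → IsStrong 𝓛 M → D ⊆ X → PerpSets 𝓛 D M →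
      rk 𝓛 X = rk 𝓛 D + j → rk 𝓛 M + rk 𝓛 D ≤ rk 𝓛 (M ∩ perpSet 𝓛 X) + rk 𝓛 X := by
    intro j
    induction j with
    | zero =>
      intro D M hD hM hDX hDM hj
      obtain rfl := hP.eq_of_subset hD hX hDX (by omega)
      have : M ∩ perpSet 𝓛 D = M := Set.inter_eq_left.2 fun x hx a ha => hDM a ha x hx
      rw [this]
    | succ j ih =>
      intro D M hD hM hDX hDM hj
      obtain ⟨a, haX, haD⟩ : ∃ a ∈ X, a ∉ D := by
        by_contra! h
        have := hP.rk_mono hX hD h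
        omega
      obtain ⟨D', hD', h1, h2, h3, h4⟩ := hP.exists_insert hD haD
        (fun x hx => hX.2 a haX x (hDX hx))
      have hM' := hM.inter (hP.isSubspace_perp a)
      have h5 := ih D' _ hD' hM' (h4 X hX.1 hDX haX) (PerpSets.symm fun x hx =>
        h4 _ (hP.isSubspace_perp x) (fun y hy => (hDM y hy x hx.1).symm) (Perp.symm hx.2))
        (by omega)
      have h6 := hP.rk_le_inter_perp hM a
      have h7 : rk 𝓛 (M ∩ {x | Perp 𝓛 a x} ∩ perpSet 𝓛 X) ≤ rk 𝓛 (M ∩ perpSet 𝓛 X) :=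
        hP.rk_mono (hM'.inter hP.isSubspace_perpSet) (hM.inter hP.isSubspace_perpSet)
          (Set.inter_subset_inter_left _ Set.inter_subset_left)
      omega
  have hD := hX.inter hM.1
  obtain ⟨j, hj⟩ := Nat.exists_eq_add_of_le (hP.rk_mono hD hX Set.inter_subset_left)
  have h1 := key j _ M hD hM Set.inter_subset_left (hM.perpSets Set.inter_subset_right subset_rfl)
    hj
  by_contra! h
  have h2 : M ∩ perpSet 𝓛 X ⊆ X ∩ M := fun x hx => by
    refine ⟨?_, hx.1⟩
    by_contra hxX
    obtain ⟨y, hy, hxy⟩ := h x hxX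
    exact hxy (Perp.symm (hx.2 y hy))
  have := hP.rk_mono (hM.inter hP.isSubspace_perpSet) hD h2
  omega

theorem exists_super (hR : HasRank 𝓛 n) (hX : IsStrong 𝓛 X) {j : ℕ} (hj : rk 𝓛 X ≤ j)
    (hjn : j ≤ n) : ∃ W, IsStrong 𝓛 W ∧ X ⊆ W ∧ rk 𝓛 W = j := by
  induction j, hj using Nat.le_induction with
  | base => exact ⟨X, hX, subset_rfl, rfl⟩
  | succ j _ ih =>
    obtain ⟨W, hW, hXW, hrW⟩ := ih (by omega)
    obtain ⟨p, hp, hpW⟩ := hR.exists_perp_not_mem hW (by omega)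
    obtain ⟨Z, hZ, h1, -, h3, -⟩ := hR.exists_insert hW hp hpW
    exact ⟨Z, hZ, hXW.trans h1, by omega⟩

theorem subset_of_perp (hR : HasRank 𝓛 n) (hM : IsStrong 𝓛 M) (hr : rk 𝓛 M = n)
    (h : PerpSets 𝓛 S M) : S ⊆ M := by
  intro p hp
  by_contra hpM
  obtain ⟨Z, hZ, -, -, h3, -⟩ := hR.exists_insert hM hpM (h p hp)
  have := hR.rk_le Z hZ
  omega

end HasRank

/-! ### Traces on the hyperplane, and passage from index to rank -/

namespace IsHyperplane

variable {H : Set Q}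

theorem rk_inter (hH : IsHyperplane 𝓛 H) (hP : IsFinitePolarSpace 𝓛) (hX : IsStrong 𝓛 X)
    (h : ¬ X ⊆ H) : rk 𝓛 X = rk 𝓛 (X ∩ H) + 1 :=
  hP.rk_eq_add_one (hX.inter hH.1) hX
    ⟨Set.inter_subset_left, fun h' => h fun _ hx => (h' hx).2⟩ fun L hL hLX => by
      obtain ⟨q, hq, hqH⟩ := hH.2.2 L hL
      exact ⟨q, hq, hLX hq, hqH⟩

theorem subset_of_diff_subset (hH : IsHyperplane 𝓛 H) (hP : IsPolarSpace 𝓛) (hX : IsStrong 𝓛 X)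
    (h : ¬ X ⊆ H) (hS : IsSubspace 𝓛 S) (hXS : X \ H ⊆ S) : X ⊆ S := by
  by_contra hne
  obtain ⟨x, hx, h1, h2⟩ := hP.exists_not_mem_two hX hH.1 hS h hne
  exact h2 (hXS ⟨hx, h1⟩)

end IsHyperplane

theorem HasIndex.hasRank {m : ℕ} (hm : HasIndex 𝓛 m) (hP : IsPolarSpace 𝓛) :
    HasRank 𝓛 (m + 1) := by
  have hF : IsFinitePolarSpace 𝓛 := ⟨hP, fun X => by
    obtain ⟨d, -, hX, n, hn, -⟩ := hm.2 X.1 X.2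
    have : Order.height X = n := hn
    simp [this]⟩
  refine ⟨hF, fun X hX => ?_, ?_⟩
  · obtain ⟨d, hd, hX', n, hn, hdn⟩ := hm.2 X hX
    rw [← hF.coe_rk] at hn
    have : rk 𝓛 X = n := by exact_mod_cast hn
    omega
  · obtain ⟨X, hX, n, hn, hdn⟩ := hm.1
    rw [← hF.coe_rk] at hn
    have : rk 𝓛 X = n := by exact_mod_cast hn
    exact ⟨X, hX, by omega⟩

theorem IsFinitePolarSpace.mem_sub_iff (hP : IsFinitePolarSpace 𝓛) {d : ℤ} :
    X ∈ sub 𝓛 d ↔ IsStrong 𝓛 X ∧ d = rk 𝓛 X - 1 := by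
  constructor
  · rintro ⟨hX, n, hn, rfl⟩
    rw [← hP.coe_rk] at hn
    have : rk 𝓛 X = n := by exact_mod_cast hn
    exact ⟨hX, by rw [this]⟩
  · rintro ⟨hX, rfl⟩
    exact ⟨hX, rk 𝓛 X, (hP.coe_rk hX).symm, rfl⟩

end PolarGeometry

namespace PolarGeometry

variable {Q : Type u} {𝓛 : Set (Set Q)} {X Y Z W S A B C M U V H : Set Q} {k n : ℕ}

/-! ### Configurations of subspaces -/

namespace IsFinitePolarSpace

theorem rk_singleton (hP : IsFinitePolarSpace 𝓛) (a : Q) : rk 𝓛 ({a} : Set Q) = 1 := by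
  obtain ⟨Z, hZ, -, h2, h3, h4⟩ := hP.exists_insert isStrong_empty (Set.notMem_empty a)
    (by simp)
  have : Z = {a} := (h4 _ (isStrong_singleton a).1 (Set.empty_subset _) rfl).antisymm
    (Set.singleton_subset_iff.2 h2)
  rw [← this, h3, hP.rk_empty]

theorem rk_line (hP : IsFinitePolarSpace 𝓛) {L : Set Q} (hL : L ∈ 𝓛) : rk 𝓛 L = 2 := by
  obtain ⟨a, ha, b, hb, hne⟩ := hP.line_nontrivial hL
  obtain ⟨Z, hZ, h1, h2, h3, h4⟩ := hP.exists_insert (isStrong_singleton a)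
    (p := b) (fun h => hne h.symm) (by rintro x rfl; exact Perp.of_mem hL hb ha)
  have hLs := hP.isStrong_line hL
  have : Z = L := (h4 L hLs.1 (Set.singleton_subset_iff.2 ha) hb).antisymm
    (hZ.1.line_subset hL ha hb hne (h1 rfl) h2)
  rw [← this, h3, hP.rk_singleton]

theorem not_subset_of_rk_lt (hP : IsFinitePolarSpace 𝓛) (hX : IsStrong 𝓛 X) (hY : IsStrong 𝓛 Y)
    (h : rk 𝓛 Y < rk 𝓛 X) : ¬ X ⊆ Y := fun h' => by
  have := hP.rk_mono hX hY h'
  omega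

/-- `C` is generated by its hyperplanes `A ∩ C` and `B ∩ C`; they are distinct, as otherwise both
would equal `A ∩ B`, which does not lie in `C`. -/
theorem subset_of_triangle (hP : IsFinitePolarSpace 𝓛) (hA : IsStrong 𝓛 A) (hB : IsStrong 𝓛 B)
    (hC : IsStrong 𝓛 C) (hrC : rk 𝓛 C = k + 1) (hAB : rk 𝓛 (A ∩ B) = k)
    (hAC : rk 𝓛 (A ∩ C) = k) (hBC : rk 𝓛 (B ∩ C) = k) (h : ¬ A ∩ B ⊆ C)
    (hS : IsSubspace 𝓛 S) (hAS : A ⊆ S) (hBS : B ⊆ S) : C ⊆ S := by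
  refine hP.subset_of_two hC (hA.inter hC.1) (hB.inter hC.1) Set.inter_subset_right
    Set.inter_subset_right (by omega) (by omega) (fun he => h ?_) hS
    (Set.inter_subset_left.trans hAS) (Set.inter_subset_left.trans hBS)
  have h1 : A ∩ C ⊆ A ∩ B := fun x hx => ⟨hx.1, (he.subset hx).1⟩
  rw [← hP.eq_of_subset (hA.inter hC.1) (hA.inter hB.1) h1 (by omega)]
  exact Set.inter_subset_right

/-- `A ∩ C` is collinear with `A ∩ B` and `B ∩ C`, which generate `B`. Then `B` is collinear with `A
∩ B` and `A ∩ C`, which generate `A`. -/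
theorem perpSets_of_triangle (hP : IsFinitePolarSpace 𝓛) (hA : IsStrong 𝓛 A) (hB : IsStrong 𝓛 B)
    (hC : IsStrong 𝓛 C) (hrA : rk 𝓛 A = k + 1) (hrB : rk 𝓛 B = k + 1)
    (hAB : rk 𝓛 (A ∩ B) = k)
    (hAC : rk 𝓛 (A ∩ C) = k) (hBC : rk 𝓛 (B ∩ C) = k) (h : ¬ A ∩ B ⊆ C) :
    PerpSets 𝓛 A B := by
  have h1 : PerpSets 𝓛 (A ∩ C) B := fun u hu => by
    refine hP.subset_of_two hB (hA.inter hB.1) (hB.inter hC.1) Set.inter_subset_right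
      Set.inter_subset_left (by omega) (by omega) (fun he => h ?_) (hP.isSubspace_perp u)
      (fun x hx => hA.2 u hu.1 x hx.1) (fun x hx => hC.2 u hu.2 x hx.2)
    rw [he]
    exact Set.inter_subset_right
  refine PerpSets.symm fun b hb => ?_
  refine hP.subset_of_two hA (hA.inter hB.1) (hA.inter hC.1) Set.inter_subset_left
      Set.inter_subset_left (by omega) (by omega) (fun he => h ?_) (hP.isSubspace_perp b)
      (fun x hx => hB.2 b hb x hx.2) (fun x hx => (h1 x hx b hb).symm)
  rw [he]
  exact Set.inter_subset_right

/-- A hyperplane of `M` that does not contain `A ∩ B` but meets `A` and `B` outside `H`. -/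
theorem exists_transversal (hP : IsFinitePolarSpace 𝓛) (hH : IsSubspace 𝓛 H) (hk : 0 < k)
    (hA : IsStrong 𝓛 A) (hB : IsStrong 𝓛 B) (hM : IsStrong 𝓛 M) (hAM : A ⊆ M) (hBM : B ⊆ M)
    (hrA : rk 𝓛 A = k + 1) (hrB : rk 𝓛 B = k + 1) (hrM : rk 𝓛 M = k + 2)
    (hAB : rk 𝓛 (A ∩ B) = k) (hAH : ¬ A ⊆ H) (hBH : ¬ B ⊆ H) :
    ∃ C, IsStrong 𝓛 C ∧ C ⊆ M ∧ rk 𝓛 C = k + 1 ∧ ¬ A ∩ B ⊆ C ∧ ¬ C ∩ A ⊆ H ∧ ¬ C ∩ B ⊆ H := by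
  have hne : A ≠ B := by rintro rfl; rw [Set.inter_self] at hAB; omega
  obtain ⟨a, ha, haB, haH⟩ := hP.exists_not_mem_two hA hB.1 hH
    (fun h => hne (hP.eq_of_subset hA hB h (by omega))) hAH
  obtain ⟨b, hb, hbA, hbH⟩ := hP.exists_not_mem_two hB hA.1 hH
    (fun h => hne (hP.eq_of_subset hB hA h (by omega)).symm) hBH
  -- Here k > 0 is needed. The line ab misses y, so it extends to a hyperplane of M avoiding y,
  -- which meets A and B in the points a and b off H.
  obtain ⟨y, hyA, hyB⟩ := hP.nonempty_of_rk (X := A ∩ B) (by omega)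
  have hab : a ≠ b := by rintro rfl; exact haB hb
  obtain ⟨L, hL, haL, hbL⟩ := (hM.2 a (hAM ha) b (hBM hb)).exists_line hab
  have hLM := hM.1.line_subset hL haL hbL hab (hAM ha) (hBM hb)
  have hay : a ≠ y := by rintro rfl; exact haB hyB
  have hyL : y ∉ L := fun h => hbA (hA.1.line_subset hL haL h hay ha hyA hbL)
  obtain ⟨C, hC, h1, h2, h3, h4⟩ := hP.exists_between_avoiding (hP.isStrong_line hL) hM hLM
    (hAM hyA) hyL (n := k + 1) (by rw [hP.rk_line hL]; omega) (by omega)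
  exact ⟨C, hC, h2, h3, fun h => h4 (h ⟨hyA, hyB⟩), fun h => haH (h ⟨h1 haL, ha⟩),
    fun h => hbH (h ⟨h1 hbL, hb⟩)⟩

theorem exists_not_perp (hP : IsFinitePolarSpace 𝓛) (hY : IsStrong 𝓛 Y) (hrY : rk 𝓛 Y = k)
    {a : Q} (haY : a ∉ Y) (ha : ∀ y ∈ Y, Perp 𝓛 a y) :
    ∃ D, IsStrong 𝓛 D ∧ Y ⊆ D ∧ rk 𝓛 D = k + 1 ∧ ∃ d ∈ D, ¬ Perp 𝓛 d a := by
  obtain ⟨d, hdY, hda⟩ := hP.exists_separating_univ hY haY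
  obtain ⟨D, hD, h1, h2, h3, -⟩ := hP.exists_insert hY (fun h => hda (ha d h).symm) hdY
  exact ⟨D, hD, h1, by omega, d, h2, hda⟩

end IsFinitePolarSpace

/-! ### Flats of the affine polar space -/

/-- The `k`-dimensional strong subspaces that are not contained in `H`. -/
def IsFlat (𝓛 : Set (Set Q)) (H : Set Q) (k : ℕ) (X : Set Q) : Prop :=
  IsStrong 𝓛 X ∧ rk 𝓛 X = k + 1 ∧ ¬ X ⊆ H

/-- The type of `k`-dimensional strong subspaces that are not contained in `H`. -/
abbrev Flat (𝓛 : Set (Set Q)) (H : Set Q) (k : ℕ) : Type u := {X : Set Q // IsFlat 𝓛 H k X}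

namespace Flat

/-- `A` and `B` are hyperplanes of a common strong subspace. -/
def Up (A B : Flat 𝓛 H k) : Prop :=
  A ≠ B ∧ ∃ M, IsStrong 𝓛 M ∧ rk 𝓛 M = k + 2 ∧ A.1 ⊆ M ∧ B.1 ⊆ M

/-- `A` and `B` meet in a common hyperplane that is not contained in `H`. -/
def Down (A B : Flat 𝓛 H k) : Prop := rk 𝓛 (A.1 ∩ B.1) = k ∧ ¬ A.1 ∩ B.1 ⊆ H

/-- The combined adjacency of flats. -/
def Both (A B : Flat 𝓛 H k) : Prop := Down A B ∧ Up A B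

variable {A B C D : Flat 𝓛 H k}

theorem strong (A : Flat 𝓛 H k) : IsStrong 𝓛 A.1 := A.2.1

theorem rk_eq (A : Flat 𝓛 H k) : rk 𝓛 A.1 = k + 1 := A.2.2.1

theorem not_subset (A : Flat 𝓛 H k) : ¬ A.1 ⊆ H := A.2.2.2

theorem strong_inter (A B : Flat 𝓛 H k) : IsStrong 𝓛 (A.1 ∩ B.1) := A.strong.inter B.strong.1

theorem ne_of_not_subset (hB : B.1 ⊆ S) (hA : ¬ A.1 ⊆ S) : A ≠ B := fun h => hA (h ▸ hB)

theorem Up.symm (h : Up A B) : Up B A :=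
  ⟨h.1.symm, h.2.imp fun _ h => ⟨h.1, h.2.1, h.2.2.2, h.2.2.1⟩⟩

theorem Down.symm (h : Down A B) : Down B A := by
  rwa [Down, Set.inter_comm]

theorem Both.symm (h : Both A B) : Both B A := ⟨h.1.symm, h.2.symm⟩

theorem Down.ne (h : Down A B) : A ≠ B := by
  rintro rfl
  have h1 := h.1
  rw [Set.inter_self, A.rk_eq] at h1
  omega

theorem eq_of_subset (hP : IsFinitePolarSpace 𝓛) (h : A.1 ⊆ B.1) : A = B :=
  Subtype.ext (hP.eq_of_subset A.strong B.strong h (by rw [A.rk_eq, B.rk_eq]))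

theorem Up.rk_inter (hP : IsFinitePolarSpace 𝓛) (h : Up A B) : rk 𝓛 (A.1 ∩ B.1) = k := by
  obtain ⟨hne, M, hM, hr, h1, h2⟩ := h
  exact hP.rk_inter_of_ne hM A.strong B.strong h1 h2 A.rk_eq B.rk_eq hr
    fun h => hne (Subtype.ext h)

theorem Up.perpSets (h : Up A B) : PerpSets 𝓛 A.1 B.1 := by
  obtain ⟨_, M, hM, hr, h1, h2⟩ := h
  exact hM.perpSets h1 h2

theorem up_of_perpSets (hP : IsFinitePolarSpace 𝓛) (h : rk 𝓛 (A.1 ∩ B.1) = k)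
    (hp : PerpSets 𝓛 A.1 B.1) : Up A B := by
  refine ⟨?_, join 𝓛 A.1 B.1, hP.isStrong_join A.strong B.strong hp,
    hP.rk_join_of_ne A.strong B.strong hp A.rk_eq B.rk_eq h, left_subset_join,
    right_subset_join⟩
  rintro rfl
  rw [Set.inter_self, A.rk_eq] at h
  omega

theorem Up.strong_join (hP : IsFinitePolarSpace 𝓛) (h : Up A B) :
    IsStrong 𝓛 (join 𝓛 A.1 B.1) :=
  hP.isStrong_join A.strong B.strong h.perpSets

theorem Up.rk_join (hP : IsFinitePolarSpace 𝓛) (h : Up A B) :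
    rk 𝓛 (join 𝓛 A.1 B.1) = k + 2 :=
  hP.rk_join_of_ne A.strong B.strong h.perpSets A.rk_eq B.rk_eq (h.rk_inter hP)

theorem up_of_subset (hM : IsStrong 𝓛 M) (hr : rk 𝓛 M = k + 2) (hA : A.1 ⊆ M) (hB : B.1 ⊆ M)
    (hne : A ≠ B) : Up A B :=
  ⟨hne, M, hM, hr, hA, hB⟩

theorem rk_inter_of_subset (hP : IsFinitePolarSpace 𝓛) (hY : IsStrong 𝓛 Y) (hr : rk 𝓛 Y = k)
    (hA : Y ⊆ A.1) (hB : Y ⊆ B.1) (hne : A ≠ B) : A.1 ∩ B.1 = Y := by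
  refine hP.inter_eq hY A.strong B.strong.1 hA hB (fun h => hne (eq_of_subset hP h)) ?_
  rw [A.rk_eq, hr]

theorem down_of_subset (hP : IsFinitePolarSpace 𝓛) (hY : IsStrong 𝓛 Y) (hr : rk 𝓛 Y = k)
    (hYH : ¬ Y ⊆ H) (hA : Y ⊆ A.1) (hB : Y ⊆ B.1) (hne : A ≠ B) : Down A B := by
  rw [Down, rk_inter_of_subset hP hY hr hA hB hne]
  exact ⟨hr, hYH⟩

end Flat

/-! ### Containing the meet, from `∼₋` -/

section Formulas

variable {T : Type v} (r : T → T → Prop)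

/-- The common neighbours of `A` and `B` are pairwise equal or adjacent. -/
def IsTightPair (A B : T) : Prop :=
  ∀ C D, r C A → r C B → r D A → r D B → C = D ∨ r C D

/-- For `r = ∼₋` and adjacent `A`, `B`: the element `C` contains the meet of `A` and `B`. -/
def DownStar (A B C : T) : Prop :=
  C = A ∨ C = B ∨ (r C A ∧ r C B ∧
    ∃ D, r D A ∧ IsTightPair r D A ∧ (D = B ∨ r D B) ∧ (D = C ∨ r D C))

end Formulas

namespace Flat

variable {A B C D : Flat 𝓛 H k}

/-- The star–triangle alternative: a common neighbour off the star completes a triangle, and this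
forces A and B to be collinear. -/
theorem Down.up_or_subset (hP : IsFinitePolarSpace 𝓛) (hAB : Down A B) (hCA : Down C A)
    (hCB : Down C B) :
    A.1 ∩ B.1 ⊆ C.1 ∨ (Up A B ∧ ∀ S, IsSubspace 𝓛 S → A.1 ⊆ S → B.1 ⊆ S → C.1 ⊆ S) := by
  by_cases h : A.1 ∩ B.1 ⊆ C.1
  · exact Or.inl h
  · exact Or.inr ⟨up_of_perpSets hP hAB.1 (hP.perpSets_of_triangle A.strong B.strong C.strong
      A.rk_eq B.rk_eq hAB.1 hCA.symm.1 hCB.symm.1 h), fun S hS hA hB =>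
      hP.subset_of_triangle A.strong B.strong C.strong C.rk_eq hAB.1 hCA.symm.1 hCB.symm.1 h
        hS hA hB⟩

/-- `C` meets `M` exactly in `A ∩ B`, so `C ∩ D` lies in `A ∩ B`, and equal rank would put `A ∩ B`
inside `D`. This non-adjacency separates stars from joins throughout. -/
theorem not_down_of_not_subset (hP : IsFinitePolarSpace 𝓛) (hM : IsStrong 𝓛 M)
    (hAM : A.1 ⊆ M) (hAB : rk 𝓛 (A.1 ∩ B.1) = k)
    (hC : A.1 ∩ B.1 ⊆ C.1) (hCM : ¬ C.1 ⊆ M) (hD : ¬ A.1 ∩ B.1 ⊆ D.1) (hDM : D.1 ⊆ M) :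
    rk 𝓛 (C.1 ∩ D.1) ≠ k := fun h => by
  have h1 : C.1 ∩ M = A.1 ∩ B.1 := hP.inter_eq (A.strong_inter B) C.strong hM.1 hC
    (Set.inter_subset_left.trans hAM) hCM (by rw [C.rk_eq]; omega)
  have h2 : C.1 ∩ D.1 ⊆ A.1 ∩ B.1 := fun x hx => h1 ▸ ⟨hx.1, hDM hx.2⟩
  refine hD ?_
  rw [← hP.eq_of_subset (C.strong_inter D) (A.strong_inter B) h2 (by omega)]
  exact Set.inter_subset_right

/-- If A and B are not collinear, only the star remains and its members are pairwise adjacent. If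
they are collinear, a star member leaving the join and a transversal inside the join are
non-adjacent common neighbours. -/
theorem isTightPair_down_iff (hP : IsFinitePolarSpace 𝓛) (hH : IsSubspace 𝓛 H) (hk : 0 < k)
    (hAB : Down A B) : IsTightPair Down A B ↔ ¬ PerpSets 𝓛 A.1 B.1 := by
  constructor
  · intro h hp
    have hup := up_of_perpSets hP hAB.1 hp
    have hM := hup.strong_join hP
    obtain ⟨a, haA, haB⟩ : ∃ a ∈ A.1, a ∉ A.1 ∩ B.1 := by
      by_contra! h'
      have := hP.rk_mono A.strong (A.strong_inter B) h'
      rw [A.rk_eq, hAB.1] at this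
      omega
    obtain ⟨C, hC, h1, h2, c, hc, hca⟩ := hP.exists_not_perp (A.strong_inter B) hAB.1 haB
      (fun y hy => A.strong.2 a haA y hy.1)
    have hCH : ¬ C ⊆ H := fun h' => hAB.2 (h1.trans h')
    obtain ⟨D, hD, g1, g2, g3, g4, g5⟩ := hP.exists_transversal hH hk A.strong B.strong hM
      left_subset_join right_subset_join A.rk_eq B.rk_eq (hup.rk_join hP) hAB.1 A.not_subset
      B.not_subset
    let C' : Flat 𝓛 H k := ⟨C, hC, h2, hCH⟩
    let D' : Flat 𝓛 H k := ⟨D, hD, g2, fun h' => g4 (Set.inter_subset_left.trans h')⟩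
    have hCM : ¬ C ⊆ join 𝓛 A.1 B.1 := fun h' => hca (hM.2 c (h' hc) a (left_subset_join haA))
    have hCA : C' ≠ A := ne_of_not_subset left_subset_join hCM
    have hCB : C' ≠ B := ne_of_not_subset right_subset_join hCM
    have hDA : D' ≠ A := fun he => g3 (he ▸ Set.inter_subset_left : A.1 ∩ B.1 ⊆ D'.1)
    have hDB : D' ≠ B := fun he => g3 (he ▸ Set.inter_subset_right : A.1 ∩ B.1 ⊆ D'.1)
    have hYs := A.strong_inter B
    have hn := not_down_of_not_subset hP hM left_subset_join
      hAB.1 (C := C') (D := D') h1 hCM g3 g1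
    rcases h C' D' (down_of_subset hP hYs hAB.1 hAB.2 h1 Set.inter_subset_left hCA)
      (down_of_subset hP hYs hAB.1 hAB.2 h1 Set.inter_subset_right hCB)
      ⟨(up_of_subset hM (hup.rk_join hP) g1 left_subset_join hDA).rk_inter hP, g4⟩
      ⟨(up_of_subset hM (hup.rk_join hP) g1 right_subset_join hDB).rk_inter hP, g5⟩ with h' | h'
    · exact hCM ((congrArg Subtype.val h').subset.trans g1)
    · exact hn h'.1
  · intro h C D hCA hCB hDA hDB
    have h1 := (hAB.up_or_subset hP hCA hCB).resolve_right fun h' => h h'.1.perpSets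
    have h2 := (hAB.up_or_subset hP hDA hDB).resolve_right fun h' => h h'.1.perpSets
    by_cases he : C = D
    · exact Or.inl he
    · exact Or.inr (down_of_subset hP (A.strong_inter B) hAB.1 hAB.2 h1 h2 he)

/-- The auxiliary `D` is a star member not collinear with `A`. It cannot be of triangle type and
lies outside the join of collinear `A`, `B`, so no flat of triangle type is adjacent to it. Such a
`D` always exists, whether or not `A` and `B` are collinear. -/
theorem downStar_iff (hP : IsFinitePolarSpace 𝓛) (hH : IsSubspace 𝓛 H) (hk : 0 < k)
    (hAB : Down A B) : DownStar Down A B C ↔ A.1 ∩ B.1 ⊆ C.1 := by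
  have hYs := A.strong_inter B
  constructor
  · rintro (rfl | rfl | ⟨hCA, hCB, D, hDA, ht, hDB, hDC⟩)
    · exact Set.inter_subset_left
    · exact Set.inter_subset_right
    rw [isTightPair_down_iff hP hH hk hDA] at ht
    have hYD : A.1 ∩ B.1 ⊆ D.1 := by
      rcases hDB with rfl | hDB
      · exact Set.inter_subset_right
      · refine (hAB.up_or_subset hP hDA hDB).resolve_right fun h' => ht ?_
        have hM := h'.1.strong_join hP
        exact hM.perpSets (h'.2 _ hM.1 left_subset_join right_subset_join) left_subset_join
    by_contra h
    obtain ⟨hup, hC⟩ := (hAB.up_or_subset hP hCA hCB).resolve_left h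
    have hM := hup.strong_join hP
    rcases hDC with rfl | hDC
    · exact h hYD
    · exact not_down_of_not_subset hP hM left_subset_join
        hAB.1 hYD (fun h' => ht (hM.perpSets h' left_subset_join)) h
        (hC _ hM.1 left_subset_join right_subset_join) hDC.1
  · intro h
    by_cases hCA : C = A
    · exact Or.inl hCA
    by_cases hCB : C = B
    · exact Or.inr (Or.inl hCB)
    obtain ⟨a, haA, haB⟩ : ∃ a ∈ A.1, a ∉ A.1 ∩ B.1 := by
      by_contra! h'
      have := hP.rk_mono A.strong (A.strong_inter B) h'
      rw [A.rk_eq, hAB.1] at this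
      omega
    obtain ⟨D, hD, h1, h2, d, hd, hda⟩ := hP.exists_not_perp (A.strong_inter B) hAB.1 haB
      (fun y hy => A.strong.2 a haA y hy.1)
    let D' : Flat 𝓛 H k := ⟨D, hD, h2, fun h' => hAB.2 (h1.trans h')⟩
    have hDA : D' ≠ A := fun he => hda (hD.2 d hd a (he ▸ haA : a ∈ D'.1))
    have hd' := down_of_subset (A := D') (B := A) hP hYs hAB.1 hAB.2 h1 Set.inter_subset_left hDA
    refine Or.inr (Or.inr ⟨down_of_subset hP hYs hAB.1 hAB.2 h Set.inter_subset_left hCA,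
      down_of_subset hP hYs hAB.1 hAB.2 h Set.inter_subset_right hCB, D', hd', ?_, ?_, ?_⟩)
    · rw [isTightPair_down_iff hP hH hk hd']
      exact fun h' => hda (h' d hd a haA)
    · by_cases he : D' = B
      · exact Or.inl he
      · exact Or.inr (down_of_subset hP hYs hAB.1 hAB.2 h1 Set.inter_subset_right he)
    · by_cases he : D' = C
      · exact Or.inl he
      · exact Or.inr (down_of_subset hP hYs hAB.1 hAB.2 h1 h he)

end Flat
end PolarGeometry

namespace PolarGeometry

variable {Q : Type u} {𝓛 : Set (Set Q)} {X Y Z W S M U V H : Set Q} {k n : ℕ}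

theorem IsFinitePolarSpace.rk_join_of_common (hP : IsFinitePolarSpace 𝓛) (hM : IsStrong 𝓛 M)
    (hX : IsStrong 𝓛 X) (hY : IsStrong 𝓛 Y) (hW : IsStrong 𝓛 W) (hXM : X ⊆ M) (hYM : Y ⊆ M)
    (hWX : W ⊆ X) (hWY : W ⊆ Y) (hrX : rk 𝓛 X = k + 1) (hrY : rk 𝓛 Y = k + 1)
    (hrW : rk 𝓛 W = k) (hne : X ≠ Y) : rk 𝓛 (join 𝓛 X Y) = k + 2 := by
  have h1 := hP.rk_join hX hY (hM.perpSets hXM hYM)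
  rw [hP.inter_eq hW hX hY.1 hWX hWY (fun h => hne (hP.eq_of_subset hX hY h (by omega)))
    (by omega)] at h1
  omega

namespace Flat

variable {A B C D : Flat 𝓛 H k}

/-- `C` belongs to the pencil spanned by `A` and `B`. -/
def InPencil (A B C : Flat 𝓛 H k) : Prop := A.1 ∩ B.1 ⊆ C.1 ∧ C.1 ⊆ join 𝓛 A.1 B.1

theorem Up.inter_subset_or (hP : IsFinitePolarSpace 𝓛) (hAB : Up A B) (hCA : Up C A)
    (hCB : Up C B) : A.1 ∩ B.1 ⊆ C.1 ∨ C.1 ⊆ join 𝓛 A.1 B.1 :=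
  or_iff_not_imp_left.2 fun h => hP.subset_of_triangle A.strong B.strong C.strong C.rk_eq
    (hAB.rk_inter hP) (hCA.symm.rk_inter hP) (hCB.symm.rk_inter hP) h isSubspace_span
    left_subset_join right_subset_join

theorem Up.join_eq (hP : IsFinitePolarSpace 𝓛) (hAB : Up A B) (hM : IsStrong 𝓛 M)
    (hrM : rk 𝓛 M = k + 2) (hA : A.1 ⊆ M) (hB : B.1 ⊆ M) : join 𝓛 A.1 B.1 = M :=
  hP.eq_of_subset (hAB.strong_join hP) hM (join_subset hM.1 hA hB)
    (by rw [hAB.rk_join hP, hrM])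

theorem up_of_common (hP : IsFinitePolarSpace 𝓛) (hY : IsStrong 𝓛 Y) (hr : rk 𝓛 Y = k)
    (hA : Y ⊆ A.1) (hB : Y ⊆ B.1) (hne : A ≠ B) (hp : PerpSets 𝓛 A.1 B.1) : Up A B :=
  up_of_perpSets hP (by rw [rk_inter_of_subset hP hY hr hA hB hne, hr]) hp

/-- The bound k + 3 ≤ n leaves room for a strong subspace strictly above the join. For n = k + 2
everything collinear with the join lies in it, and prisms take over. -/
theorem exists_outside (hR : HasRank 𝓛 n) (hH : IsSubspace 𝓛 H) (hn : k + 3 ≤ n) (hAB : Up A B) :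
    ∃ D : Flat 𝓛 H k, A.1 ∩ B.1 ⊆ D.1 ∧ PerpSets 𝓛 D.1 (join 𝓛 A.1 B.1) ∧
      ¬ D.1 ⊆ join 𝓛 A.1 B.1 := by
  have hP := hR.toIsFinitePolarSpace
  have hM := hAB.strong_join hP
  have hrM := hAB.rk_join hP
  obtain ⟨N, hN, hMN, hrN⟩ := hR.exists_super hM (j := k + 3) (by omega) hn
  obtain ⟨d, hdN, hdH, hdM⟩ := hP.exists_not_mem_two hN hH hM.1
    (fun h => A.not_subset ((left_subset_join.trans hMN).trans h))
    (hP.not_subset_of_rk_lt hN hM (by omega))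
  have hYM : A.1 ∩ B.1 ⊆ join 𝓛 A.1 B.1 := Set.inter_subset_left.trans left_subset_join
  obtain ⟨D, hD, h1, h2, h3, h4⟩ := hP.exists_insert (A.strong_inter B)
    (fun h => hdM (hYM h)) (fun x hx => hN.2 d hdN x (hMN (hYM hx)))
  rw [hAB.rk_inter hP] at h3
  exact ⟨⟨D, hD, h3, fun h => hdH (h h2)⟩, h1,
    hN.perpSets (h4 N hN.1 (hYM.trans hMN) hdN) hMN, fun h => hdM (h h2)⟩

end Flat

/-! ### Pencils and parallelism, from `∼⁺` -/

section Formulas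

variable {T : Type v} (r : T → T → Prop) (J : T → T → T → Prop)

/-- `C` is equal or adjacent to every common neighbour of `A` and `B`. -/
def UpPencil (A B C : T) : Prop :=
  C = A ∨ C = B ∨ (r C A ∧ r C B ∧ ∀ D, r D A → r D B → D = C ∨ r D C)

/-- A configuration of a triangle with two transversals whose existence shows that the flats
`A` and `B` are parallel, where `J` describes the pencils. -/
def IsParallel (A B : T) : Prop :=
  ∃ C D E, r C A ∧ r C B ∧ ¬ J A B C ∧ J C A D ∧ D ≠ C ∧ D ≠ A ∧ J C B E ∧
    ∀ F, J A B F → r D F ∧ ∃ G, G ≠ E ∧ J C B G ∧ J D F G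

end Formulas

namespace Flat

variable {A B C D : Flat 𝓛 H k}

/-- Common neighbours contain the meet or lie in the join. Pencil members do both and so are
adjacent or equal to either kind. A flat of the join off the star is refuted by a flat from
`exists_outside`, a star member leaving the join by one from `exists_transversal`. -/
theorem upPencil_iff (hR : HasRank 𝓛 n) (hH : IsSubspace 𝓛 H) (hk : 0 < k) (hn : k + 3 ≤ n)
    (hAB : Up A B) : UpPencil Up A B C ↔ InPencil A B C := by
  have hP := hR.toIsFinitePolarSpace
  have hM := hAB.strong_join hP
  have hrM := hAB.rk_join hP
  have hrY := hAB.rk_inter hP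
  have hYs := A.strong_inter B
  constructor
  · rintro (rfl | rfl | ⟨hCA, hCB, h⟩)
    · exact ⟨Set.inter_subset_left, left_subset_join⟩
    · exact ⟨Set.inter_subset_right, right_subset_join⟩
    have hor := hAB.inter_subset_or hP hCA hCB
    by_cases hCM : C.1 ⊆ join 𝓛 A.1 B.1
    · refine ⟨?_, hCM⟩
      by_contra hYC
      obtain ⟨D, hYD, hDp, hDM⟩ := exists_outside hR hH hn hAB
      have hDA : D ≠ A := ne_of_not_subset left_subset_join hDM
      have hDB : D ≠ B := ne_of_not_subset right_subset_join hDM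
      rcases h D (up_of_common hP hYs hrY hYD Set.inter_subset_left hDA
          (hDp.mono subset_rfl left_subset_join))
        (up_of_common hP hYs hrY hYD Set.inter_subset_right hDB
          (hDp.mono subset_rfl right_subset_join)) with rfl | h'
      · exact hDM hCM
      · exact not_down_of_not_subset hP hM left_subset_join hrY hYD hDM hYC hCM (h'.rk_inter hP)
    · have hYC := hor.resolve_right hCM
      exfalso
      obtain ⟨D, hD, g1, g2, g3, g4, g5⟩ := hP.exists_transversal hH hk A.strong B.strong hM
        left_subset_join right_subset_join A.rk_eq B.rk_eq hrM hrY A.not_subset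
        B.not_subset
      let D' : Flat 𝓛 H k := ⟨D, hD, g2, fun h' => g4 (Set.inter_subset_left.trans h')⟩
      have hDA : D' ≠ A := fun he => g3 (he ▸ Set.inter_subset_left : A.1 ∩ B.1 ⊆ D'.1)
      have hDB : D' ≠ B := fun he => g3 (he ▸ Set.inter_subset_right : A.1 ∩ B.1 ⊆ D'.1)
      rcases h D' (up_of_subset hM hrM g1 left_subset_join hDA)
        (up_of_subset hM hrM g1 right_subset_join hDB) with h' | h'
      · exact hCM (h' ▸ g1)
      · exact not_down_of_not_subset hP hM left_subset_join hrY hYC hCM g3 g1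
          (h'.symm.rk_inter hP)
  · rintro ⟨h1, h2⟩
    by_cases hCA : C = A
    · exact Or.inl hCA
    by_cases hCB : C = B
    · exact Or.inr (Or.inl hCB)
    refine Or.inr (Or.inr ⟨up_of_subset hM hrM h2 left_subset_join hCA,
      up_of_subset hM hrM h2 right_subset_join hCB, fun D hDA hDB => ?_⟩)
    by_cases hDC : D = C
    · exact Or.inl hDC
    refine Or.inr ?_
    rcases hAB.inter_subset_or hP hDA hDB with h | h
    · exact up_of_common hP hYs hrY h h1 hDC
        ((hP.perpSets_join hDA.perpSets hDB.perpSets).mono subset_rfl h2)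
    · exact up_of_subset hM hrM h h2 hDC

variable {J : Flat 𝓛 H k → Flat 𝓛 H k → Flat 𝓛 H k → Prop}

/-- Pencils act as the lines of a projective plane containing the triangle A, B, C. As A ∩ B is not
inside H, no member of the pencil of A and B is missing, so the line DE meets it in a flat F. The
line DF is then DE and meets the pencil of C and B only in E, so no G ≠ E exists for this F.
Completeness of `J` is only asked for pairs with affine meet, since prisms provide no more. -/
theorem not_isParallel (hP : IsFinitePolarSpace 𝓛) (hk : 0 < k)
    (sound : ∀ A B C, Up A B → J A B C → InPencil A B C)
    (complete : ∀ A B C, Both A B → InPencil A B C → J A B C)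
    (hAB : Both A B) : ¬ IsParallel Up J A B := by
  obtain ⟨j, rfl⟩ : ∃ j, k = j + 1 := ⟨k - 1, by omega⟩
  have hup := hAB.2
  have hYH := hAB.1.2
  have hM := hup.strong_join hP
  have hrM := hup.rk_join hP
  have hrY := hup.rk_inter hP
  have hYs := A.strong_inter B
  rintro ⟨C, D, E, hCA, hCB, hnJ, hD, hDC, hDA, hE, h⟩
  obtain ⟨hD1, hD2⟩ := sound _ _ _ hCA hD
  obtain ⟨hE1, hE2⟩ := sound _ _ _ hCB hE
  have hnot : ¬ InPencil A B C := fun h => hnJ (complete A B C hAB h)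
  have hrCA := hCA.rk_inter hP
  have hrCB := hCB.rk_inter hP
  rcases hup.inter_subset_or hP hCA hCB with hYC | hCM
  · have hCM : ¬ C.1 ⊆ join 𝓛 A.1 B.1 := fun h => hnot ⟨hYC, h⟩
    have eCA : C.1 ∩ A.1 = A.1 ∩ B.1 :=
      rk_inter_of_subset hP hYs hrY hYC Set.inter_subset_left hCA.1
    have eCB : C.1 ∩ B.1 = A.1 ∩ B.1 :=
      rk_inter_of_subset hP hYs hrY hYC Set.inter_subset_right hCB.1
    rw [eCA] at hD1
    rw [eCB] at hE1
    have hpMC : PerpSets 𝓛 (join 𝓛 A.1 B.1) C.1 :=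
      (hP.perpSets_join hCA.perpSets hCB.perpSets).symm
    have hN := hP.isStrong_join hM C.strong hpMC
    have hrN := hP.rk_join hM C.strong hpMC
    rw [Set.inter_comm, hP.inter_eq hYs C.strong hM.1 hYC
      (Set.inter_subset_left.trans left_subset_join) hCM (by rw [C.rk_eq, hrY]), hrM, hrY,
      C.rk_eq] at hrN
    have hJ1 := hCA.strong_join hP
    have hJ2 := hCB.strong_join hP
    have hr1 := hCA.rk_join hP
    have hr2 := hCB.rk_join hP
    have hJ12 : join 𝓛 C.1 A.1 ∩ join 𝓛 C.1 B.1 = C.1 := by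
      refine hP.inter_eq C.strong hJ1 hJ2.1 left_subset_join left_subset_join (fun h' => hCM ?_)
        (by rw [C.rk_eq, hr1])
      rw [hup.join_eq hP hJ2 hr2 (right_subset_join.trans h') right_subset_join]
      exact left_subset_join
    have hDN : D.1 ⊆ join 𝓛 (join 𝓛 A.1 B.1) C.1 := hD2.trans
      (join_subset hN.1 right_subset_join (left_subset_join.trans left_subset_join))
    have hEN : E.1 ⊆ join 𝓛 (join 𝓛 A.1 B.1) C.1 := hE2.trans
      (join_subset hN.1 right_subset_join (right_subset_join.trans left_subset_join))
    have hDJ2 : ¬ D.1 ⊆ join 𝓛 C.1 B.1 := fun h' =>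
      hDC (eq_of_subset hP ((Set.subset_inter hD2 h').trans hJ12.subset))
    have hDE : D ≠ E := (ne_of_not_subset hE2 hDJ2)
    have hDEu : Up D E := up_of_common hP hYs hrY hD1 hE1 hDE (hN.perpSets hDN hEN)
    have hK := hDEu.strong_join hP
    have hrK := hDEu.rk_join hP
    have hKN : join 𝓛 D.1 E.1 ⊆ join 𝓛 (join 𝓛 A.1 B.1) C.1 := join_subset hN.1 hDN hEN
    -- Triangle through the common meet: the joins of A, B and of D, E have rank k + 2 in a strong
    -- subspace of rank k + 3, so they share at least rank k + 1, enough for F.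
    have h1 := hP.rk_join hM hK (hN.perpSets left_subset_join hKN)
    have h2 := hP.rk_mono (hN.join_of_subset left_subset_join hKN) hN
      (join_subset hN.1 left_subset_join hKN)
    obtain ⟨F, hF, f1, f2, f3⟩ := hP.exists_between hYs (hM.inter hK.1) (n := j + 1 + 1)
      (Set.subset_inter (Set.inter_subset_left.trans left_subset_join)
        (hD1.trans left_subset_join)) (by omega) (by omega)
    let F' : Flat 𝓛 H (j + 1) := ⟨F, hF, f3, fun h' => hYH (f1.trans h')⟩
    obtain ⟨hDF, G, hGE, hG1, hG2⟩ := h F' (complete _ _ _ hAB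
      ⟨f1, f2.trans Set.inter_subset_left⟩)
    have hG3 := (sound _ _ _ hCB hG1).2
    have hG4 := (sound _ _ _ hDF hG2).2.trans
      (join_subset hK.1 left_subset_join (f2.trans Set.inter_subset_right))
    have : join 𝓛 C.1 B.1 ∩ join 𝓛 D.1 E.1 = E.1 := by
      refine hP.inter_eq E.strong hJ2 hK.1 hE2 right_subset_join (fun h' => hDJ2 ?_)
        (by rw [E.rk_eq, hr2])
      rw [hP.eq_of_subset hJ2 hK h' (by omega)]
      exact left_subset_join
    exact hGE (eq_of_subset hP ((Set.subset_inter hG3 hG4).trans this.subset))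
  · have hYC : ¬ A.1 ∩ B.1 ⊆ C.1 := fun h => hnot ⟨h, hCM⟩
    have hDM : D.1 ⊆ join 𝓛 A.1 B.1 := hD2.trans (join_subset hM.1 hCM left_subset_join)
    have hEM : E.1 ⊆ join 𝓛 A.1 B.1 := hE2.trans (join_subset hM.1 hCM right_subset_join)
    have hCACB : C.1 ∩ A.1 ≠ C.1 ∩ B.1 := fun he => hYC <| by
      rw [← hP.eq_of_subset (C.strong_inter A) hYs
        (fun x hx => ⟨hx.2, (he.subset hx).2⟩) (by omega)]
      exact Set.inter_subset_left
    have hCD : ¬ C.1 ∩ B.1 ⊆ D.1 := fun h' => hDC <| Eq.symm <| eq_of_subset hP <|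
      hP.subset_of_two C.strong (C.strong_inter A) (C.strong_inter B) Set.inter_subset_left
        Set.inter_subset_left (by omega) (by rw [C.rk_eq]; omega) hCACB D.strong.1 hD1 h'
    have hYCA : A.1 ∩ B.1 ≠ C.1 ∩ A.1 := fun he => hYC (he.subset.trans Set.inter_subset_left)
    have hYD : ¬ A.1 ∩ B.1 ⊆ D.1 := fun h' => hDA <| Eq.symm <| eq_of_subset hP <|
      hP.subset_of_two A.strong hYs (C.strong_inter A) Set.inter_subset_left
        Set.inter_subset_right (by omega) (by rw [A.rk_eq]; omega) hYCA D.strong.1 h' hD1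
    have hDE : D ≠ E := by rintro rfl; exact hCD hE1
    have hDEu : Up D E := up_of_subset hM hrM hDM hEM hDE
    have hrDE := hDEu.rk_inter hP
    have hrW : rk 𝓛 ((A.1 ∩ B.1) ∩ (C.1 ∩ A.1)) = j := hP.rk_inter_of_ne A.strong hYs
      (C.strong_inter A) Set.inter_subset_left Set.inter_subset_right hrY hrCA A.rk_eq hYCA
    -- Triangle inside the join: F is spanned by A ∩ B and D ∩ E, which both have rank j + 1 and
    -- share A ∩ B ∩ C of rank j.
    have hFr : rk 𝓛 (join 𝓛 (A.1 ∩ B.1) (D.1 ∩ E.1)) = j + 2 := by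
      refine hP.rk_join_of_common hM hYs (D.strong_inter E) (hYs.inter (C.strong_inter A).1)
        (Set.inter_subset_left.trans left_subset_join) (Set.inter_subset_left.trans hDM)
        Set.inter_subset_left
        (fun x hx => ⟨hD1 hx.2, hE1 ⟨hx.2.1, hx.1.2⟩⟩) hrY hrDE hrW
        (fun he => hYD (he.subset.trans Set.inter_subset_left))
    have hFM : join 𝓛 (A.1 ∩ B.1) (D.1 ∩ E.1) ⊆ join 𝓛 A.1 B.1 :=
      join_subset hM.1 (Set.inter_subset_left.trans left_subset_join)
        (Set.inter_subset_left.trans hDM)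
    let F' : Flat 𝓛 H (j + 1) := ⟨_, hM.of_subset isSubspace_span hFM, hFr,
      fun h' => hYH (left_subset_join.trans h')⟩
    obtain ⟨hDF, G, hGE, hG1, hG2⟩ := h F' (complete _ _ _ hAB ⟨left_subset_join, hFM⟩)
    have hG3 := (sound _ _ _ hCB hG1).1
    have hG4 : D.1 ∩ E.1 ⊆ G.1 := fun x hx =>
      (sound _ _ _ hDF hG2).1 ⟨hx.1, right_subset_join hx⟩
    refine hGE (Eq.symm <| eq_of_subset hP <| hP.subset_of_two E.strong (C.strong_inter B)
      (D.strong_inter E) hE1 Set.inter_subset_right (by omega) (by rw [E.rk_eq]; omega)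
      (fun he => hCD (he.subset.trans Set.inter_subset_left)) G.strong.1 hG3 hG4)

/-- The pencil of A and B lacks its member M ∩ H, where M is the join. Choosing E through D ∩ H aims
the line DE at this missing member, so for every F in the pencil the line DF meets the pencil of C
and B elsewhere than in E. -/
theorem isParallel_of_subset (hP : IsFinitePolarSpace 𝓛) (hH : IsHyperplane 𝓛 H) (hk : 0 < k)
    (sound : ∀ A B C, Up A B → J A B C → InPencil A B C)
    (complete : ∀ A B C, Both A B → InPencil A B C → J A B C)
    (hup : Up A B) (hYH : A.1 ∩ B.1 ⊆ H) : IsParallel Up J A B := by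
  obtain ⟨j, rfl⟩ : ∃ j, k = j + 1 := ⟨k - 1, by omega⟩
  have hM := hup.strong_join hP
  have hrM := hup.rk_join hP
  have hrY := hup.rk_inter hP
  have hYs := A.strong_inter B
  obtain ⟨C₀, hC₀, g1, g2, g3, g4, g5⟩ := hP.exists_transversal hH.1 hk A.strong B.strong hM
    left_subset_join right_subset_join A.rk_eq B.rk_eq hrM hrY A.not_subset B.not_subset
  obtain ⟨C, rfl⟩ : ∃ C : Flat 𝓛 H (j + 1), C.1 = C₀ :=
    ⟨⟨C₀, hC₀, g2, fun h' => g4 (Set.inter_subset_left.trans h')⟩, rfl⟩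
  have hCA : Up C A := up_of_subset hM hrM g1 left_subset_join
    (by rintro rfl; exact g3 Set.inter_subset_left)
  have hCB : Up C B := up_of_subset hM hrM g1 right_subset_join
    (by rintro rfl; exact g3 Set.inter_subset_right)
  have hrCA := hCA.rk_inter hP
  have hrCB := hCB.rk_inter hP
  have eCA := hCA.join_eq hP hM hrM g1 left_subset_join
  have eCB := hCB.join_eq hP hM hrM g1 right_subset_join
  obtain ⟨D₀, hD₀, d1, d2, d3, d4, d5⟩ := hP.exists_third_member (C.strong_inter A) hM C.strong
    A.strong Set.inter_subset_left g1 left_subset_join hrCA C.rk_eq A.rk_eq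
    (fun h => hCA.1 (Subtype.ext h))
  obtain ⟨D, rfl⟩ : ∃ D : Flat 𝓛 H (j + 1), D.1 = D₀ :=
    ⟨⟨D₀, hD₀, d3, fun h' => g4 (d1.trans h')⟩, rfl⟩
  have hCACB : C.1 ∩ A.1 ≠ C.1 ∩ B.1 := fun he => g3 <| by
    rw [← hP.eq_of_subset (C.strong_inter A) hYs
      (fun x hx => ⟨hx.2, (he.subset hx).2⟩) (by omega)]
    exact Set.inter_subset_left
  have hCD : ¬ C.1 ∩ B.1 ⊆ D.1 := fun h' => d4 <| Eq.symm <| congrArg _ <|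
    eq_of_subset hP <|
    hP.subset_of_two C.strong (C.strong_inter A) (C.strong_inter B) Set.inter_subset_left
      Set.inter_subset_left (by omega) (by rw [C.rk_eq]; omega) hCACB D.strong.1 d1 h'
  have hYCA : A.1 ∩ B.1 ≠ C.1 ∩ A.1 := fun he => g3 (he.subset.trans Set.inter_subset_left)
  have hYD : ¬ A.1 ∩ B.1 ⊆ D.1 := fun h' => d5 <| Eq.symm <| congrArg _ <| eq_of_subset hP <|
    hP.subset_of_two A.strong hYs (C.strong_inter A) Set.inter_subset_left
      Set.inter_subset_right (by omega) (by rw [A.rk_eq]; omega) hYCA D.strong.1 h' d1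
  have hrW : rk 𝓛 ((A.1 ∩ B.1) ∩ (C.1 ∩ A.1)) = j := hP.rk_inter_of_ne A.strong hYs
    (C.strong_inter A) Set.inter_subset_left Set.inter_subset_right hrY hrCA A.rk_eq hYCA
  have hWs := hYs.inter (C.strong_inter A).1
  have hWCB : (A.1 ∩ B.1) ∩ (C.1 ∩ A.1) ⊆ C.1 ∩ B.1 := fun x hx => ⟨hx.2.1, hx.1.2⟩
  have hCBM : C.1 ∩ B.1 ⊆ join 𝓛 A.1 B.1 := Set.inter_subset_left.trans g1
  -- Hyperplanes X of D through A ∩ B ∩ C correspond to lines through D in the dual plane; the line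
  -- of X meets the pencil of C and B in the span of C ∩ B and X. This yields E from X = D ∩ H and G
  -- from X = D ∩ F.
  have hmk : ∀ X, IsStrong 𝓛 X → X ⊆ D.1 → rk 𝓛 X = j + 1 →
      (A.1 ∩ B.1) ∩ (C.1 ∩ A.1) ⊆ X → ∃ E : Flat 𝓛 H (j + 1), J C B E ∧ X ⊆ E.1 ∧
        E.1 ⊆ join 𝓛 A.1 B.1 := by
    intro X hX hXD hrX hWX
    have hEM : join 𝓛 (C.1 ∩ B.1) X ⊆ join 𝓛 A.1 B.1 :=
      join_subset hM.1 hCBM (hXD.trans d2)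
    refine ⟨⟨join 𝓛 (C.1 ∩ B.1) X, hM.of_subset isSubspace_span hEM, ?_,
      fun h => g5 (left_subset_join.trans h)⟩, complete _ _ _ ⟨⟨hrCB, g5⟩, hCB⟩
      ⟨left_subset_join, eCB.symm ▸ hEM⟩, right_subset_join, hEM⟩
    exact hP.rk_join_of_common hM (C.strong_inter B) hX hWs hCBM (hXD.trans d2) hWCB hWX hrCB
      hrX hrW (fun he => hCD (he.subset.trans hXD))
  have hrDH := hH.rk_inter hP D.strong D.not_subset
  rw [D.rk_eq] at hrDH
  have hDHs := D.strong.inter hH.1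
  obtain ⟨E, hE, hDHE, hEM⟩ := hmk (D.1 ∩ H) hDHs Set.inter_subset_left (by omega)
    (fun x hx => ⟨d1 hx.2, hYH hx.1⟩)
  refine ⟨C, D, E, hCA, hCB, fun h => g3 (sound _ _ _ hup h).1,
    complete _ _ _ ⟨⟨hrCA, g4⟩, hCA⟩ ⟨d1, eCA.symm ▸ d2⟩, fun h => d4 (congrArg _ h),
    fun h => d5 (congrArg _ h), hE, fun F hF => ?_⟩
  obtain ⟨f1, f2⟩ := sound _ _ _ hup hF
  have hrFH := hH.rk_inter hP F.strong F.not_subset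
  rw [F.rk_eq] at hrFH
  have hFH : F.1 ∩ H = A.1 ∩ B.1 :=
    (hP.eq_of_subset hYs (F.strong.inter hH.1) (Set.subset_inter f1 hYH) (by omega)).symm
  have hDF : Up D F := up_of_subset hM hrM d2 f2 (by rintro rfl; exact hYD f1)
  have hrDF := hDF.rk_inter hP
  have hDFH : ¬ D.1 ∩ F.1 ⊆ H := fun h => hYD <| by
    rw [← hP.eq_of_subset (D.strong_inter F) hYs
      (fun x hx => hFH ▸ ⟨hx.2, h hx⟩) (by omega)]
    exact Set.inter_subset_left
  obtain ⟨G, hG, hDFG, hGM⟩ := hmk (D.1 ∩ F.1) (D.strong_inter F) Set.inter_subset_left hrDF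
    (fun x hx => ⟨d1 hx.2, f1 hx.1⟩)
  refine ⟨hDF, G, ?_, hG, complete _ _ _ ⟨⟨hrDF, hDFH⟩, hDF⟩
    ⟨hDFG, (hDF.join_eq hP hM hrM d2 f2).symm ▸ hGM⟩⟩
  rintro rfl
  have hDG : Up D G := up_of_subset hM hrM d2 hEM
    (by rintro rfl; exact hCD (sound _ _ _ hCB hG).1)
  have e1 : D.1 ∩ H = D.1 ∩ G.1 := hP.eq_of_subset hDHs (D.strong_inter G)
    (Set.subset_inter Set.inter_subset_left hDHE) (by rw [hDG.rk_inter hP]; omega)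
  refine hDFH ?_
  have : D.1 ∩ F.1 ⊆ D.1 ∩ G.1 := Set.subset_inter Set.inter_subset_left hDFG
  rw [← e1] at this
  exact this.trans Set.inter_subset_right

theorem both_iff_not_isParallel (hP : IsFinitePolarSpace 𝓛) (hH : IsHyperplane 𝓛 H) (hk : 0 < k)
    (sound : ∀ A B C, Up A B → J A B C → InPencil A B C)
    (complete : ∀ A B C, Both A B → InPencil A B C → J A B C) :
    Both A B ↔ Up A B ∧ ¬ IsParallel Up J A B := by
  constructor
  · exact fun h => ⟨h.2, not_isParallel hP hk sound complete h⟩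
  · rintro ⟨h1, h2⟩
    exact ⟨⟨h1.rk_inter hP, fun h => h2 (isParallel_of_subset hP hH hk sound complete h1 h)⟩, h1⟩

end Flat
end PolarGeometry

namespace PolarGeometry

variable {Q : Type u} {𝓛 : Set (Set Q)} {X Y Z W S M U V H : Set Q} {k n : ℕ}

/-! ### Containing the meet, from the combined adjacency -/

section Formulas

variable {T : Type v} (r : T → T → Prop)

/-- Among the common neighbours of `A` and `B`, some element is adjacent or equal to
everything that `C` is adjacent or equal to. -/
def IsDominated (A B C : T) : Prop :=
  r C A ∧ r C B ∧ ∃ D, D ≠ C ∧ r D A ∧ r D B ∧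
    ∀ E, r E A → r E B → (E = C ∨ r E C) → (E = D ∨ r E D)

/-- For the combined adjacency and adjacent `A`, `B`: the element `C` contains the meet of `A` and
`B` and is collinear with `A` and `B`. -/
def PerpStar (A B C : T) : Prop :=
  C = A ∨ C = B ∨ (r C A ∧ r C B ∧ ∃ E, IsDominated r A B E ∧ (C = E ∨ r C E))

/-- A path from `A` to `C` through elements containing the meet of `A` and `B`. -/
def StarStep (A B C : T) : Prop :=
  ∃ D, PerpStar r A B D ∧ r A D ∧ r D C ∧ ∃ E, E ≠ D ∧ PerpStar r A D E ∧ PerpStar r D C E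

/-- For the combined adjacency and adjacent `A`, `B`: the element `C` contains the meet of `A` and
`B`. -/
def BothStar (A B C : T) : Prop := PerpStar r A B C ∨ StarStep r A B C ∨ StarStep r B A C

end Formulas

namespace Flat

variable {A B C D : Flat 𝓛 H k}

theorem both_of_common (hP : IsFinitePolarSpace 𝓛) (hY : IsStrong 𝓛 Y) (hr : rk 𝓛 Y = k)
    (hYH : ¬ Y ⊆ H) (hA : Y ⊆ A.1) (hB : Y ⊆ B.1) (hne : A ≠ B) (hp : PerpSets 𝓛 A.1 B.1) :
    Both A B :=
  ⟨down_of_subset hP hY hr hYH hA hB hne, up_of_common hP hY hr hA hB hne hp⟩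

theorem inter_subset_of_both (hP : IsFinitePolarSpace 𝓛) (hAB : Both A B) (hCA : Both C A)
    (hCB : Both C B) (hDA : Both D A) (hDB : Both D B) (hD : ¬ D.1 ⊆ join 𝓛 A.1 B.1)
    (hCD : C = D ∨ Both C D) : A.1 ∩ B.1 ⊆ C.1 := by
  have hYD := (hAB.2.inter_subset_or hP hDA.2 hDB.2).resolve_right hD
  rcases hCD with rfl | hCD
  · exact hYD
  rcases hAB.2.inter_subset_or hP hCA.2 hCB.2 with h | h
  · exact h
  · by_contra hYC
    exact not_down_of_not_subset hP (hAB.2.strong_join hP) left_subset_join hAB.1.1 hYD hD hYC h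
      hCD.symm.1.1

/-- A common neighbour C outside the join is adjacent only to star members, and all of these are
adjacent or equal to any pencil member D. For C inside the join no D dominates, as a witness E
adjacent to C but not to D always exists. -/
theorem isDominated_iff (hP : IsFinitePolarSpace 𝓛) (hH : IsHyperplane 𝓛 H) (hAB : Both A B) :
    IsDominated Both A B C ↔ Both C A ∧ Both C B ∧ ¬ C.1 ⊆ join 𝓛 A.1 B.1 := by
  have hM := hAB.2.strong_join hP
  have hrM := hAB.2.rk_join hP
  have hrY := hAB.1.1
  have hYH := hAB.1.2
  have hYs := A.strong_inter B
  constructor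
  · rintro ⟨hCA, hCB, D, hDC, hDA, hDB, h⟩
    refine ⟨hCA, hCB, fun hCM => ?_⟩
    have hCD : Both C D := (h C hCA hCB (Or.inl rfl)).resolve_left hDC.symm
    by_cases hDM : D.1 ⊆ join 𝓛 A.1 B.1
    · have hMH : ¬ join 𝓛 A.1 B.1 ⊆ H := fun h' => A.not_subset (left_subset_join.trans h')
      have hrMH := hH.rk_inter hP hM hMH
      have hrDH := hH.rk_inter hP D.strong D.not_subset
      rw [D.rk_eq] at hrDH
      have hDHs := D.strong.inter hH.1
      obtain ⟨E₀, hE₀, e1, e2, e3, e4, e5⟩ := hP.exists_third_member hDHs hM D.strong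
        (hM.inter hH.1) Set.inter_subset_left hDM Set.inter_subset_left (k := k) (by omega)
        D.rk_eq (by omega) (fun h' => D.not_subset (h'.subset.trans Set.inter_subset_right))
      obtain ⟨E, rfl⟩ : ∃ E : Flat 𝓛 H k, E.1 = E₀ := ⟨⟨E₀, hE₀, e3, fun h' =>
        e5 (hP.eq_of_subset hE₀ (hM.inter hH.1) (Set.subset_inter e2 h') (by omega))⟩, rfl⟩
      have hrEH := hH.rk_inter hP E.strong E.not_subset
      rw [E.rk_eq] at hrEH
      have eEH : D.1 ∩ H = E.1 ∩ H := hP.eq_of_subset hDHs (E.strong.inter hH.1)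
        (Set.subset_inter e1 Set.inter_subset_right) (by omega)
      have hmeet : ∀ F : Flat 𝓛 H k, D.1 ∩ H ⊆ F.1 → ¬ Both F D := fun F hF hFD => hFD.1.2 <| by
        rw [← hP.eq_of_subset hDHs (F.strong_inter D)
          (Set.subset_inter hF Set.inter_subset_left) (by rw [hFD.1.1]; omega)]
        exact Set.inter_subset_right
      have key : ∀ F : Flat 𝓛 H k, F.1 ⊆ join 𝓛 A.1 B.1 → Both F D → Both E F := by
        intro F hFM hFD
        have hne : E ≠ F := by rintro rfl; exact hmeet E e1 hFD
        have hup := up_of_subset hM hrM e2 hFM hne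
        refine ⟨⟨hup.rk_inter hP, fun h' => hmeet F ?_ hFD⟩, hup⟩
        rw [eEH, ← hP.eq_of_subset (E.strong_inter F) (E.strong.inter hH.1)
          (Set.subset_inter Set.inter_subset_left h') (by rw [hup.rk_inter hP]; omega)]
        exact Set.inter_subset_right
      rcases h E (key A left_subset_join hDA.symm) (key B right_subset_join hDB.symm)
        (Or.inr (key C hCM hCD)) with rfl | h'
      · exact e4 rfl
      · exact hmeet E e1 h'
    · obtain ⟨p, hpD, hpM⟩ := Set.not_subset.1 hDM
      -- D outside the join: the flat spanned by A ∩ B and q is collinear with the whole join, but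
      -- not with D.
      obtain ⟨q, hqM, hqp⟩ := hP.exists_separating_univ hM hpM
      have hYC := inter_subset_of_both hP hAB hCA hCB hDA hDB hDM (Or.inr hCD)
      have hYD := inter_subset_of_both hP hAB hDA hDB hDA hDB hDM (Or.inl rfl)
      have hpDM : PerpSets 𝓛 D.1 (join 𝓛 A.1 B.1) :=
        hP.perpSets_join hDA.2.perpSets hDB.2.perpSets
      have hqM' : q ∉ join 𝓛 A.1 B.1 := fun h' => hqp (hpDM p hpD q h').symm
      have hYM : A.1 ∩ B.1 ⊆ join 𝓛 A.1 B.1 := Set.inter_subset_left.trans left_subset_join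
      obtain ⟨E₀, hE₀, e1, e2, e3, e4⟩ := hP.exists_insert hYs (fun h' => hqM' (hYM h'))
        (fun x hx => hqM x (hYM hx))
      obtain ⟨E, rfl⟩ : ∃ E : Flat 𝓛 H k, E.1 = E₀ :=
        ⟨⟨E₀, hE₀, by omega, fun h' => hYH (e1.trans h')⟩, rfl⟩
      have hEM : PerpSets 𝓛 E.1 (join 𝓛 A.1 B.1) := PerpSets.symm fun x hx =>
        e4 _ (hP.isSubspace_perp x) (fun y hy => hM.2 x hx y (hYM hy)) (hqM x hx).symm
      have hEM' : ¬ E.1 ⊆ join 𝓛 A.1 B.1 := fun h' => hqM' (h' e2)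
      have key : ∀ F : Flat 𝓛 H k, F.1 ⊆ join 𝓛 A.1 B.1 → A.1 ∩ B.1 ⊆ F.1 → Both E F :=
        fun F hFM hYF => both_of_common hP hYs hrY hYH e1 hYF (ne_of_not_subset hFM hEM')
          (hEM.mono subset_rfl hFM)
      rcases h E (key A left_subset_join Set.inter_subset_left)
        (key B right_subset_join Set.inter_subset_right) (Or.inr (key C hCM hYC)) with rfl | h'
      · exact hqp (E.strong.2 q e2 p hpD)
      · exact hqp (h'.2.perpSets q e2 p hpD)
  · rintro ⟨hCA, hCB, hCM⟩
    obtain ⟨D₀, hD₀, d1, d2, d3, d4, d5⟩ := hP.exists_third_member hYs hM A.strong B.strong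
      Set.inter_subset_left left_subset_join right_subset_join hrY A.rk_eq B.rk_eq
      (fun h => hAB.1.ne (Subtype.ext h))
    obtain ⟨D, rfl⟩ : ∃ D : Flat 𝓛 H k, D.1 = D₀ :=
      ⟨⟨D₀, hD₀, d3, fun h' => hYH (d1.trans h')⟩, rfl⟩
    refine ⟨hCA, hCB, D, (ne_of_not_subset d2 hCM).symm,
      both_of_common hP hYs hrY hYH d1 Set.inter_subset_left (fun h => d4 (congrArg _ h))
        (hM.perpSets d2 left_subset_join),
      both_of_common hP hYs hrY hYH d1 Set.inter_subset_right (fun h => d5 (congrArg _ h))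
        (hM.perpSets d2 right_subset_join), fun E hEA hEB hEC => or_iff_not_imp_left.2 fun hED => ?_⟩
    exact both_of_common hP hYs hrY hYH (inter_subset_of_both hP hAB hEA hEB hCA hCB hCM hEC) d1 hED
      ((hP.perpSets_join hEA.2.perpSets hEB.2.perpSets).mono subset_rfl d2)

/-- Adjacency or equality to a star member outside the join excludes the triangle type. For C inside
the join such a member comes from `exists_outside`. -/
theorem perpStar_iff (hR : HasRank 𝓛 n) (hH : IsHyperplane 𝓛 H) (hn : k + 3 ≤ n)
    (hAB : Both A B) : PerpStar Both A B C ↔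
      A.1 ∩ B.1 ⊆ C.1 ∧ PerpSets 𝓛 C.1 A.1 ∧ PerpSets 𝓛 C.1 B.1 := by
  have hP := hR.toIsFinitePolarSpace
  have hYs := A.strong_inter B
  constructor
  · rintro (rfl | rfl | ⟨hCA, hCB, E, hE, hCE⟩)
    · exact ⟨Set.inter_subset_left, C.strong.perpSets subset_rfl subset_rfl, hAB.2.perpSets⟩
    · exact ⟨Set.inter_subset_right, hAB.2.perpSets.symm,
        C.strong.perpSets subset_rfl subset_rfl⟩
    · obtain ⟨hEA, hEB, hEM⟩ := (isDominated_iff hP hH hAB).1 hE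
      exact ⟨inter_subset_of_both hP hAB hCA hCB hEA hEB hEM hCE, hCA.2.perpSets,
        hCB.2.perpSets⟩
  · rintro ⟨hYC, hpA, hpB⟩
    by_cases hCA : C = A
    · exact Or.inl hCA
    by_cases hCB : C = B
    · exact Or.inr (Or.inl hCB)
    have bothOf : ∀ E F : Flat 𝓛 H k, A.1 ∩ B.1 ⊆ E.1 → A.1 ∩ B.1 ⊆ F.1 → E ≠ F →
        PerpSets 𝓛 E.1 F.1 → Both E F := fun E F h1 h2 h3 h4 =>
      both_of_common hP hYs hAB.1.1 hAB.1.2 h1 h2 h3 h4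
    have hCA' := bothOf C A hYC Set.inter_subset_left hCA hpA
    have hCB' := bothOf C B hYC Set.inter_subset_right hCB hpB
    refine Or.inr (Or.inr ⟨hCA', hCB', ?_⟩)
    by_cases hCM : C.1 ⊆ join 𝓛 A.1 B.1
    · obtain ⟨E, h1, h2, h3⟩ := exists_outside hR hH.1 hn hAB.2
      refine ⟨E, (isDominated_iff hP hH hAB).2 ⟨bothOf E A h1 Set.inter_subset_left
        (ne_of_not_subset left_subset_join h3) (h2.mono subset_rfl left_subset_join),
        bothOf E B h1 Set.inter_subset_right (ne_of_not_subset right_subset_join h3)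
          (h2.mono subset_rfl right_subset_join), h3⟩, Or.inr ?_⟩
      exact (bothOf E C h1 hYC (ne_of_not_subset hCM h3) (h2.mono subset_rfl hCM)).symm
    · exact ⟨C, (isDominated_iff hP hH hAB).2 ⟨hCA', hCB', hCM⟩, Or.inl rfl⟩

/-- If A ∩ D and D ∩ C differed, they would generate D; the flat E contains both and would equal D.
-/
theorem StarStep.inter_subset (hR : HasRank 𝓛 n) (hH : IsHyperplane 𝓛 H) (hn : k + 3 ≤ n)
    (hAB : Both A B) (h : StarStep Both A B C) : A.1 ∩ B.1 ⊆ C.1 := by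
  have hP := hR.toIsFinitePolarSpace
  obtain ⟨D, hD, hAD, hDC, E, hED, h1, h2⟩ := h
  rw [perpStar_iff hR hH hn hAB] at hD
  rw [perpStar_iff hR hH hn hAD] at h1
  rw [perpStar_iff hR hH hn hDC] at h2
  have e1 := rk_inter_of_subset hP (A.strong_inter B) hAB.1.1 Set.inter_subset_left hD.1 hAD.1.ne
  have e2 : A.1 ∩ D.1 = D.1 ∩ C.1 := by
    by_contra hne
    refine hED (Eq.symm <| eq_of_subset hP <| hP.subset_of_two D.strong (A.strong_inter D)
      (D.strong_inter C) Set.inter_subset_right Set.inter_subset_left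
      (by rw [hAD.1.1, hDC.1.1]) (by rw [hAD.1.1, D.rk_eq]) hne E.strong.1 h1.1 h2.1)
  rw [← e1, e2]
  exact Set.inter_subset_right

theorem starStep_of_subset (hR : HasRank 𝓛 n) (hH : IsHyperplane 𝓛 H) (hn : k + 3 ≤ n)
    (hAB : Both A B) (hYC : A.1 ∩ B.1 ⊆ C.1) (hYD : A.1 ∩ B.1 ⊆ D.1)
    (hDM : D.1 ⊆ join 𝓛 A.1 B.1) (hDC : PerpSets 𝓛 D.1 C.1) (hDA : D ≠ A) (hne : D ≠ C) :
    StarStep Both A B C := by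
  have hP := hR.toIsFinitePolarSpace
  have hYs := A.strong_inter B
  have hM := hAB.2.strong_join hP
  have hAD : Both A D := both_of_common hP hYs hAB.1.1 hAB.1.2 Set.inter_subset_left hYD hDA.symm
    (hM.perpSets left_subset_join hDM)
  have hDC' : Both D C := both_of_common hP hYs hAB.1.1 hAB.1.2 hYD hYC hne hDC
  have hN := hDC'.2.strong_join hP
  obtain ⟨N, hNs, hDN, hrN⟩ := hR.exists_super hN (j := k + 3)
    (by rw [hDC'.2.rk_join hP]; omega) hn
  have hYN : A.1 ∩ B.1 ⊆ N := hYD.trans (left_subset_join.trans hDN)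
  -- The part of N collinear with A has rank at least k + 2, more than D, so it has a point q
  -- outside D. The flat E is spanned by A ∩ B and q.
  have hr := hP.rk_le_inter_perpSet hYs A.strong Set.inter_subset_left
    (by rw [A.rk_eq, hAB.1.1]) hNs (hNs.perpSets hYN subset_rfl)
  obtain ⟨q, hq, hqD⟩ := Set.not_subset.1 (hP.not_subset_of_rk_lt (hNs.inter
    hP.isSubspace_perpSet) D.strong (by rw [D.rk_eq]; omega : _ < rk 𝓛 (N ∩ perpSet 𝓛 A.1)))
  obtain ⟨E₀, hE₀, e1, e2, e3, e4⟩ := hP.exists_insert hYs (fun h' => hqD (hYD h'))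
        (fun x hx => hNs.2 q hq.1 x (hYN hx))
  obtain ⟨E, rfl⟩ : ∃ E : Flat 𝓛 H k, E.1 = E₀ :=
    ⟨⟨E₀, hE₀, by rw [e3, hAB.1.1], fun h' => hAB.1.2 (e1.trans h')⟩, rfl⟩
  have hEN : E.1 ⊆ N := e4 N hNs.1 hYN hq.1
  have hEA : PerpSets 𝓛 E.1 A.1 := PerpSets.symm fun x hx =>
    e4 _ (hP.isSubspace_perp x) (fun y hy => A.strong.2 x hx y hy.1) (hq.2 x hx)
  refine ⟨D, (perpStar_iff hR hH hn hAB).2 ⟨hYD, hM.perpSets hDM left_subset_join,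
    hM.perpSets hDM right_subset_join⟩, hAD, hDC', E, fun h => hqD (h ▸ e2),
    (perpStar_iff hR hH hn hAD).2 ⟨?_, hEA, hNs.perpSets hEN (left_subset_join.trans hDN)⟩,
    (perpStar_iff hR hH hn hDC').2 ⟨?_, hNs.perpSets hEN (left_subset_join.trans hDN),
      hNs.perpSets hEN (right_subset_join.trans hDN)⟩⟩
  · rw [rk_inter_of_subset hP hYs hAB.1.1 Set.inter_subset_left hYD hDA.symm]
    exact e1
  · rw [rk_inter_of_subset hP hYs hAB.1.1 hYD hYC hne]
    exact e1

/-- If C is not collinear with the join M, the intermediate flat is D = M ∩ C⊥; it has corank one in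
M because C is spanned by A ∩ B and a point. As D cannot equal both A and B, a step from A or from B
reaches C. -/
theorem bothStar_iff (hR : HasRank 𝓛 n) (hH : IsHyperplane 𝓛 H) (hn : k + 3 ≤ n)
    (hAB : Both A B) : BothStar Both A B C ↔ A.1 ∩ B.1 ⊆ C.1 := by
  have hP := hR.toIsFinitePolarSpace
  constructor
  · rintro (h | h | h)
    · exact ((perpStar_iff hR hH hn hAB).1 h).1
    · exact StarStep.inter_subset hR hH hn hAB h
    · rw [Set.inter_comm]
      exact StarStep.inter_subset hR hH hn hAB.symm h
  · intro hYC
    by_cases hp : PerpSets 𝓛 C.1 A.1 ∧ PerpSets 𝓛 C.1 B.1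
    · exact Or.inl ((perpStar_iff hR hH hn hAB).2 ⟨hYC, hp⟩)
    refine Or.inr ?_
    have hYs := A.strong_inter B
    have hM := hAB.2.strong_join hP
    have hYM : A.1 ∩ B.1 ⊆ join 𝓛 A.1 B.1 := Set.inter_subset_left.trans left_subset_join
    have hCM : ¬ PerpSets 𝓛 C.1 (join 𝓛 A.1 B.1) := fun h =>
      hp ⟨h.mono subset_rfl left_subset_join, h.mono subset_rfl right_subset_join⟩
    have h1 := hP.rk_le_inter_perpSet hYs C.strong hYC (by rw [C.rk_eq, hAB.1.1]) hM
      (hM.perpSets hYM subset_rfl)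
    have h2 := hP.rk_inter_perpSet_le hM hCM
    rw [hAB.2.rk_join hP] at h1 h2
    have hYD : A.1 ∩ B.1 ⊆ join 𝓛 A.1 B.1 ∩ perpSet 𝓛 C.1 :=
      fun x hx => ⟨hYM hx, fun c hc => C.strong.2 c hc x (hYC hx)⟩
    obtain ⟨D, hD⟩ : ∃ D : Flat 𝓛 H k, D.1 = join 𝓛 A.1 B.1 ∩ perpSet 𝓛 C.1 :=
      ⟨⟨_, hM.inter hP.isSubspace_perpSet, by omega, fun h' => hAB.1.2 (hYD.trans h')⟩, rfl⟩
    rw [← hD] at hYD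
    have hDM : D.1 ⊆ join 𝓛 A.1 B.1 := hD ▸ Set.inter_subset_left
    have hDC : PerpSets 𝓛 D.1 C.1 := fun d hd c hc => ((hD.subset hd).2 c hc).symm
    have hne : D ≠ C := by
      rintro rfl
      exact hCM (hM.perpSets hDM subset_rfl)
    by_cases hDA : D = A
    · right
      have hDB : D ≠ B := hDA ▸ hAB.1.ne
      rw [Set.inter_comm] at hYC hYD
      rw [join, Set.union_comm] at hDM
      exact starStep_of_subset hR hH hn hAB.symm hYC hYD hDM hDC hDB hne
    · exact Or.inl (starStep_of_subset hR hH hn hAB hYC hYD hDM hDC hDA hne)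

end Flat
end PolarGeometry

namespace PolarGeometry

variable {Q : Type u} {𝓛 : Set (Set Q)} {X Y Z W S M N U V H : Set Q} {k n : ℕ}

/-! ### Hyperplanes of maximal strong subspaces -/

section Formulas

variable {T : Type v} (r : T → T → Prop)

/-- An induced quadrangle `A`, `B`, `B'`, `A'`. -/
def IsQuad (A B A' B' : T) : Prop :=
  r A B ∧ r A' B' ∧ r A A' ∧ r B B' ∧ ¬ r A B' ∧ ¬ r B A' ∧ A ≠ B' ∧ B ≠ A'

/-- `A`, `B` and `C` are the base of a prism. -/
def IsPrismBase (A B C : T) : Prop :=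
  ∃ A' B' C', IsQuad r A B A' B' ∧ IsQuad r A C A' C' ∧ IsQuad r B C B' C'

/-- The pencil of `A` and `B`, described by prisms. -/
def PrismPencil (A B C : T) : Prop := C = A ∨ C = B ∨ IsPrismBase r A B C

/-- Prisms and quadrangles show that `C` contains the meet of `A` and `B`. -/
def PrismStar (A B C : T) : Prop :=
  PrismPencil r A B C ∨ ∃ A' B', IsQuad r A B A' B' ∧ PrismPencil r A' B' C

/-- `A` and `B` are adjacent, or distinct and adjacent to the members of a common edge. -/
def IsNearlyAdjacent (A B : T) : Prop :=
  r A B ∨ (A ≠ B ∧ ∃ C D, r C D ∧ r A C ∧ r A D ∧ r B C ∧ r B D)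

end Formulas

/-- A strong subspace of maximal rank through `U` that has only `Y` in common with `M`. -/
theorem HasRank.exists_opposite (hR : HasRank 𝓛 (k + 2)) (hY : IsStrong 𝓛 Y) (hU : IsStrong 𝓛 U)
    (hM : IsStrong 𝓛 M) (hrY : rk 𝓛 Y = k) (hrU : rk 𝓛 U = k + 1) (hrM : rk 𝓛 M = k + 2)
    (hUM : U ∩ M = Y) :
    ∃ N, IsStrong 𝓛 N ∧ rk 𝓛 N = k + 2 ∧ U ⊆ N ∧ N ∩ M = Y := by
  have hP := hR.toIsFinitePolarSpace
  have hYU : Y ⊆ U := hUM ▸ Set.inter_subset_left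
  have hYM : Y ⊆ M := hUM ▸ Set.inter_subset_right
  have hr := hP.rk_le_inter_perpSet hY hU hYU (by omega) hM (hM.perpSets hYM subset_rfl)
  obtain ⟨a, ha, haY⟩ := Set.not_subset.1 (hP.not_subset_of_rk_lt (hM.inter
    hP.isSubspace_perpSet) hY (by omega : _ < rk 𝓛 (M ∩ perpSet 𝓛 U)))
  have haU : a ∉ U := fun h => haY (hUM ▸ ⟨h, ha.1⟩)
  obtain ⟨v, hvU, hva⟩ := hP.exists_separating_univ hU haU
  obtain ⟨N, hN, n1, n2, n3, n4⟩ := hP.exists_insert hU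
    (fun h => hva (ha.2 v h)) hvU
  obtain ⟨K, hK, k1, k2, k3, k4⟩ := hP.exists_insert hU haU
    (fun x hx => (ha.2 x hx).symm)
  refine ⟨N, hN, by omega, n1, subset_antisymm ?_ (Set.subset_inter (hYU.trans n1) hYM)⟩
  rintro z ⟨hzN, hzM⟩
  by_contra hzY
  have hzU : z ∉ U := fun h => hzY (hUM ▸ ⟨h, hzM⟩)
  -- The point z is collinear with U and a, so it lies in the maximal subspace K. Then N, spanned by
  -- U and z, lies in K, against the choice of v.
  have hzK : z ∈ K := hR.subset_of_perp hK (by omega) (S := {z}) (fun y hy => by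
    rw [Set.mem_singleton_iff.1 hy]
    exact k4 _ (hP.isSubspace_perp z) (fun x hx => hN.2 z hzN x (n1 hx)) (hM.2 z hzM a ha.1)) rfl
  have hNK : N ⊆ K := hP.subset_of_insert hU hN n1 (by omega) hzN hzU hK.1 k1 hzK
  exact hva (hK.2 v (hNK n2) a k2)

namespace Flat

variable {A B C D A' B' : Flat 𝓛 H k}

theorem IsQuad.symm (h : IsQuad Up A B A' B') : IsQuad Up A' B' A B := by
  obtain ⟨h1, h2, h3, h4, h5, h6, h7, h8⟩ := h
  exact ⟨h2, h1, h3.symm, h4.symm, fun h => h6 h.symm, fun h => h5 h.symm, h8.symm, h7.symm⟩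

/-- A point of both joins is collinear with A and B, so it lies in their join, which has maximal
rank. As A, B' and B, A' are non-adjacent, that join meets the other two only in A and in B. -/
theorem IsQuad.join_inter_join (hR : HasRank 𝓛 (k + 2)) (h : IsQuad Up A B A' B') :
    join 𝓛 A.1 A'.1 ∩ join 𝓛 B.1 B'.1 = A.1 ∩ B.1 := by
  have hP := hR.toIsFinitePolarSpace
  obtain ⟨h1, -, h3, h4, h5, h6, h7, h8⟩ := h
  have hM := h1.strong_join hP
  have hrM := h1.rk_join hP
  have e1 : join 𝓛 A.1 A'.1 ∩ join 𝓛 A.1 B.1 = A.1 := hP.inter_eq A.strong (h3.strong_join hP)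
    hM.1 left_subset_join left_subset_join
    (fun h => h6 (up_of_subset hM hrM right_subset_join (right_subset_join.trans h) h8))
    (by rw [A.rk_eq, h3.rk_join hP])
  have e2 : join 𝓛 B.1 B'.1 ∩ join 𝓛 A.1 B.1 = B.1 := hP.inter_eq B.strong (h4.strong_join hP)
    hM.1 left_subset_join right_subset_join
    (fun h => h5 (up_of_subset hM hrM left_subset_join (right_subset_join.trans h) h7))
    (by rw [B.rk_eq, h4.rk_join hP])
  refine subset_antisymm (fun z hz => ?_) (Set.inter_subset_inter left_subset_join
    left_subset_join)
  have hzM : z ∈ join 𝓛 A.1 B.1 := hR.subset_of_perp hM hrM (S := {z})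
    (hP.perpSets_join ((h3.strong_join hP).perpSets (Set.singleton_subset_iff.2 hz.1)
      left_subset_join) ((h4.strong_join hP).perpSets (Set.singleton_subset_iff.2 hz.2)
      left_subset_join)) rfl
  exact ⟨e1 ▸ ⟨hz.1, hzM⟩, e2 ▸ ⟨hz.2, hzM⟩⟩

theorem IsQuad.inter_eq (hR : HasRank 𝓛 (k + 2)) (h : IsQuad Up A B A' B') :
    A.1 ∩ B.1 = A'.1 ∩ B'.1 := by
  rw [← IsQuad.join_inter_join hR h, ← IsQuad.join_inter_join hR (IsQuad.symm h)]
  simp only [join, Set.union_comm]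

/-- By the quadrangles, A' contains A ∩ B and A ∩ C. If these differed, they would generate A and
give A = A'. Maximality of the join puts C inside it. -/
theorem inPencil_of_prismPencil (hR : HasRank 𝓛 (k + 2)) (hAB : Up A B)
    (h : PrismPencil Up A B C) : InPencil A B C := by
  have hP := hR.toIsFinitePolarSpace
  rcases h with rfl | rfl | ⟨A', B', C', h1, h2, h3⟩
  · exact ⟨Set.inter_subset_left, left_subset_join⟩
  · exact ⟨Set.inter_subset_right, right_subset_join⟩
  have hAC := h2.1
  have hBC := h3.1
  refine ⟨?_, hR.subset_of_perp (hAB.strong_join hP) (hAB.rk_join hP)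
    (hP.perpSets_join hAC.perpSets.symm hBC.perpSets.symm)⟩
  by_contra hYC
  have e1 := IsQuad.inter_eq hR h1
  have e2 := IsQuad.inter_eq hR h2
  refine h1.2.2.1.1 (eq_of_subset hP (hP.subset_of_two A.strong (A.strong_inter B)
    (A.strong_inter C) Set.inter_subset_left Set.inter_subset_left
    (by rw [hAB.rk_inter hP, hAC.rk_inter hP]) (by rw [hAB.rk_inter hP, A.rk_eq])
    (fun he => hYC (he.subset.trans Set.inter_subset_right)) A'.strong.1
    (e1.subset.trans Set.inter_subset_left) (e2.subset.trans Set.inter_subset_left)))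

section Projection

variable (hR : HasRank 𝓛 (k + 2)) (hY : IsStrong 𝓛 Y) (hrY : rk 𝓛 Y = k) (hM : IsStrong 𝓛 M)
  (hrM : rk 𝓛 M = k + 2) (hN : IsStrong 𝓛 N) (hrN : rk 𝓛 N = k + 2) (hNM : N ∩ M = Y)

include hR hY hrY hrN hNM hN

/-- The projection is N ∩ A⊥. It has corank at most one in N as A is spanned by Y and a point, and
it is proper because otherwise A would lie in the maximal N, hence in N ∩ M = Y. -/
theorem exists_projection (hYH : ¬ Y ⊆ H) (hYA : Y ⊆ A.1) (hAM : A.1 ⊆ M) :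
    ∃ A' : Flat 𝓛 H k, Y ⊆ A'.1 ∧ A'.1 ⊆ N ∧ PerpSets 𝓛 A.1 A'.1 := by
  have hP := hR.toIsFinitePolarSpace
  have hYN : Y ⊆ N := hNM ▸ Set.inter_subset_left
  have h1 := hP.rk_le_inter_perpSet hY A.strong hYA (by rw [A.rk_eq, hrY]) hN
    (hN.perpSets hYN subset_rfl)
  have h2 : rk 𝓛 (N ∩ perpSet 𝓛 A.1) < rk 𝓛 N := hP.rk_inter_perpSet_le hN fun h =>
    hP.not_subset_of_rk_lt A.strong hY (by rw [A.rk_eq]; omega)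
      ((Set.subset_inter (hR.subset_of_perp hN hrN h) hAM).trans hNM.subset)
  have hYA' : Y ⊆ N ∩ perpSet 𝓛 A.1 :=
    fun x hx => ⟨hYN hx, fun a ha => A.strong.2 a ha x (hYA hx)⟩
  exact ⟨⟨_, hN.inter hP.isSubspace_perpSet, by omega, fun h => hYH (hYA'.trans h)⟩, hYA',
    Set.inter_subset_left, fun a ha x hx => hx.2 a ha⟩

include hM hrM

theorem isQuad_of_projection (hYA : Y ⊆ A.1) (hYB : Y ⊆ B.1) (hAM : A.1 ⊆ M) (hBM : B.1 ⊆ M)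
    (hne : A ≠ B) (hYA' : Y ⊆ A'.1) (hYB' : Y ⊆ B'.1) (hAN : A'.1 ⊆ N) (hBN : B'.1 ⊆ N)
    (hAA : PerpSets 𝓛 A.1 A'.1) (hBB : PerpSets 𝓛 B.1 B'.1) : IsQuad Up A B A' B' := by
  have hP := hR.toIsFinitePolarSpace
  have hAB : Up A B := up_of_subset hM hrM hAM hBM hne
  have key : ∀ X : Flat 𝓛 H k, X.1 ⊆ N → PerpSets 𝓛 A.1 X.1 → PerpSets 𝓛 B.1 X.1 → False := by
    intro X hXN h1 h2
    have hXM : X.1 ⊆ M := by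
      rw [← hAB.join_eq hP hM hrM hAM hBM]
      exact hR.subset_of_perp (hAB.strong_join hP) (hAB.rk_join hP)
        (hP.perpSets_join h1.symm h2.symm)
    exact hP.not_subset_of_rk_lt X.strong hY (by rw [X.rk_eq]; omega)
      ((Set.subset_inter hXN hXM).trans hNM.subset)
  have key2 : ∀ X X' : Flat 𝓛 H k, X.1 ⊆ M → X'.1 ⊆ N → X ≠ X' := by
    rintro X _ hXM hXN rfl
    exact hP.not_subset_of_rk_lt X.strong hY (by rw [X.rk_eq]; omega)
      ((Set.subset_inter hXN hXM).trans hNM.subset)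
  exact ⟨hAB, up_of_subset hN hrN hAN hBN (by rintro rfl; exact key _ hAN hAA hBB),
    up_of_common hP hY hrY hYA hYA' (key2 _ _ hAM hAN) hAA,
    up_of_common hP hY hrY hYB hYB' (key2 _ _ hBM hBN) hBB,
    fun h => key _ hBN h.perpSets hBB, fun h => key _ hAN hAA h.perpSets,
    key2 _ _ hAM hBN, key2 _ _ hBM hAN⟩

end Projection

/-- The top of the prism consists of the projections of A, B and C to a maximal subspace N sharing
only A ∩ B with the join. They are flats because A ∩ B is not inside H. -/
theorem prismPencil_of_inPencil (hR : HasRank 𝓛 (k + 2)) (hAB : Both A B)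
    (h : InPencil A B C) : PrismPencil Up A B C := by
  have hP := hR.toIsFinitePolarSpace
  by_cases hCA : C = A
  · exact Or.inl hCA
  by_cases hCB : C = B
  · exact Or.inr (Or.inl hCB)
  refine Or.inr (Or.inr ?_)
  have hYs := A.strong_inter B
  have hrY := hAB.1.1
  have hYH := hAB.1.2
  have hM := hAB.2.strong_join hP
  have hrM := hAB.2.rk_join hP
  have hYM : A.1 ∩ B.1 ⊆ join 𝓛 A.1 B.1 := Set.inter_subset_left.trans left_subset_join
  obtain ⟨a, haA, haY⟩ := Set.not_subset.1 (hP.not_subset_of_rk_lt A.strong hYs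
    (by rw [A.rk_eq]; omega))
  obtain ⟨U, hU, u1, u2, d, hdU, hda⟩ := hP.exists_not_perp hYs hrY haY
    (fun y hy => A.strong.2 a haA y hy.1)
  have hUM := hP.inter_eq hYs hU hM.1 u1 hYM
    (fun h => hda (hM.2 d (h hdU) a (left_subset_join haA))) (by omega)
  obtain ⟨N, hN, hrN, -, hNM⟩ := hR.exists_opposite hYs hU hM hrY u2 hrM hUM
  obtain ⟨A', a1, a2, a3⟩ := exists_projection (A := A) hR hYs hrY hN hrN hNM hYH
    Set.inter_subset_left left_subset_join
  obtain ⟨B', b1, b2, b3⟩ := exists_projection (A := B) hR hYs hrY hN hrN hNM hYH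
    Set.inter_subset_right right_subset_join
  obtain ⟨C', c1, c2, c3⟩ := exists_projection (A := C) hR hYs hrY hN hrN hNM hYH h.1 h.2
  exact ⟨A', B', C',
    isQuad_of_projection hR hYs hrY hM hrM hN hrN hNM Set.inter_subset_left Set.inter_subset_right
      left_subset_join right_subset_join hAB.1.ne a1 b1 a2 b2 a3 b3,
    isQuad_of_projection hR hYs hrY hM hrM hN hrN hNM Set.inter_subset_left h.1
      left_subset_join h.2 (Ne.symm hCA) a1 c1 a2 c2 a3 c3,
    isQuad_of_projection hR hYs hrY hM hrM hN hrN hNM Set.inter_subset_right h.1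
      right_subset_join h.2 (Ne.symm hCB) b1 c1 b2 c2 b3 c3⟩

/-- A star member C outside the join lies in some opposite N; projecting A and B to N gives a
quadrangle with the same meet, and C lies in the pencil of the projections. -/
theorem prismStar_iff (hR : HasRank 𝓛 (k + 2)) (hAB : Both A B) :
    PrismStar Up A B C ↔ A.1 ∩ B.1 ⊆ C.1 := by
  have hP := hR.toIsFinitePolarSpace
  constructor
  · rintro (h | ⟨A', B', h1, h2⟩)
    · exact (inPencil_of_prismPencil hR hAB.2 h).1
    · rw [IsQuad.inter_eq hR h1]
      exact (inPencil_of_prismPencil hR h1.2.1 h2).1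
  · intro hYC
    by_cases hCM : C.1 ⊆ join 𝓛 A.1 B.1
    · exact Or.inl (prismPencil_of_inPencil hR hAB ⟨hYC, hCM⟩)
    right
    have hYs := A.strong_inter B
    have hrY := hAB.1.1
    have hYH := hAB.1.2
    have hM := hAB.2.strong_join hP
    have hrM := hAB.2.rk_join hP
    have hYM : A.1 ∩ B.1 ⊆ join 𝓛 A.1 B.1 := Set.inter_subset_left.trans left_subset_join
    have hUM := hP.inter_eq hYs C.strong hM.1 hYC hYM hCM (by rw [C.rk_eq]; omega)
    obtain ⟨N, hN, hrN, hCN, hNM⟩ := hR.exists_opposite hYs C.strong hM hrY C.rk_eq hrM hUM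
    obtain ⟨A', a1, a2, a3⟩ := exists_projection (A := A) hR hYs hrY hN hrN hNM hYH
      Set.inter_subset_left left_subset_join
    obtain ⟨B', b1, b2, b3⟩ := exists_projection (A := B) hR hYs hrY hN hrN hNM hYH
      Set.inter_subset_right right_subset_join
    have hq := isQuad_of_projection hR hYs hrY hM hrM hN hrN hNM Set.inter_subset_left
      Set.inter_subset_right left_subset_join right_subset_join hAB.1.ne a1 b1 a2 b2 a3 b3
    have he := rk_inter_of_subset hP hYs hrY a1 b1 hq.2.1.1
    refine ⟨A', B', hq, prismPencil_of_inPencil hR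
      (both_of_common hP hYs hrY hYH a1 b1 hq.2.1.1 hq.2.1.perpSets)
      ⟨he ▸ hYC, (hq.2.1.join_eq hP hN hrN a2 b2).symm ▸ hCN⟩⟩

/-- A flat collinear with C and D lies in their join, which is maximal, so nearly adjacent flats
share it. Conversely, for parallel A and B, take a in A and b ≠ c in B off H; flats through the
lines ab and ac form the intermediate edge. -/
theorem isNearlyAdjacent_iff (hR : HasRank 𝓛 (k + 2)) (hH : IsSubspace 𝓛 H) (hk : 0 < k) :
    IsNearlyAdjacent Both A B ↔ Up A B := by
  have hP := hR.toIsFinitePolarSpace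
  constructor
  · rintro (h | ⟨hne, C, D, hCD, hAC, hAD, hBC, hBD⟩)
    · exact h.2
    · have hM := hCD.2.strong_join hP
      have hrM := hCD.2.rk_join hP
      exact up_of_subset hM hrM
        (hR.subset_of_perp hM hrM (hP.perpSets_join hAC.2.perpSets hAD.2.perpSets))
        (hR.subset_of_perp hM hrM (hP.perpSets_join hBC.2.perpSets hBD.2.perpSets)) hne
  · intro hup
    by_cases hYH : A.1 ∩ B.1 ⊆ H
    swap
    · exact Or.inl ⟨⟨hup.rk_inter hP, hYH⟩, hup⟩
    refine Or.inr ⟨hup.1, ?_⟩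
    have hM := hup.strong_join hP
    have hrM := hup.rk_join hP
    obtain ⟨a, haA, haH⟩ := Set.not_subset.1 A.not_subset
    obtain ⟨b, hbB, hbH⟩ := Set.not_subset.1 B.not_subset
    obtain ⟨c, hcB, hcH, hcb⟩ := hP.exists_not_mem_two B.strong hH (isStrong_singleton b).1
      B.not_subset (hP.not_subset_of_rk_lt B.strong (isStrong_singleton b)
        (by rw [B.rk_eq, hP.rk_singleton]; omega))
    have haB : a ∉ B.1 := fun h => haH (hYH ⟨haA, h⟩)
    have hbA : b ∉ A.1 := fun h => hbH (hYH ⟨h, hbB⟩)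
    have hcA : c ∉ A.1 := fun h => hcH (hYH ⟨h, hcB⟩)
    have hline : ∀ x ∈ B.1, ∃ L ∈ 𝓛, a ∈ L ∧ x ∈ L ∧ L ⊆ join 𝓛 A.1 B.1 := by
      intro x hx
      have hax : a ≠ x := by rintro rfl; exact haB hx
      obtain ⟨L, hL, h1, h2⟩ := (hup.perpSets a haA x hx).exists_line hax
      exact ⟨L, hL, h1, h2, hM.1.line_subset hL h1 h2 hax (left_subset_join haA)
        (right_subset_join hx)⟩
    obtain ⟨L, hL, haL, hbL, hLM⟩ := hline b hbB
    obtain ⟨K, hK, haK, hcK, hKM⟩ := hline c hcB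
    have hcL : c ∉ L := fun h =>
      haB (B.strong.1.line_subset hL hbL h (fun h' => hcb h'.symm) hbB hcB haL)
    obtain ⟨C₀, hC₀, c1, c2, c3, c4⟩ := hP.exists_between_avoiding (hP.isStrong_line hL) hM hLM
      (right_subset_join hcB) hcL (n := k + 1) (by rw [hP.rk_line hL]; omega) (by omega)
    obtain ⟨D₀, hD₀, d1, d2, d3⟩ := hP.exists_between (hP.isStrong_line hK) hM hKM
      (n := k + 1) (by rw [hP.rk_line hK]; omega) (by omega)
    let C : Flat 𝓛 H k := ⟨C₀, hC₀, c3, fun h => haH (h (c1 haL))⟩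
    let D : Flat 𝓛 H k := ⟨D₀, hD₀, d3, fun h => haH (h (d1 haK))⟩
    have key : ∀ X Z : Flat 𝓛 H k, X.1 ⊆ join 𝓛 A.1 B.1 → Z.1 ⊆ join 𝓛 A.1 B.1 →
        ∀ x ∈ X.1, x ∈ Z.1 → x ∉ H → ∀ z ∈ Z.1, z ∉ X.1 → Both X Z := by
      intro X Z hX hZ x hxX hxZ hxH z hzZ hzX
      have h := up_of_subset hM hrM hX hZ (fun h => hzX (h ▸ hzZ))
      exact ⟨⟨h.rk_inter hP, fun h' => hxH (h' ⟨hxX, hxZ⟩)⟩, h⟩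
    exact ⟨C, D, key C D c2 d2 a (c1 haL) (d1 haK) haH c (d1 hcK) c4,
      key A C left_subset_join c2 a haA (c1 haL) haH b (c1 hbL) hbA,
      key A D left_subset_join d2 a haA (d1 haK) haH c (d1 hcK) hcA,
      key B C right_subset_join c2 b hbB (c1 hbL) hbH a (c1 haL) haB,
      key B D right_subset_join d2 c hcB (d1 hcK) hcH a (d1 haK) haB⟩

end Flat
end PolarGeometry

namespace PolarGeometry
open FirstOrder FirstOrder.Language

/-! ### Uniform definability

The structures `⟨V i, r i⟩` range over a family; a relation on all of them is definable when one
formula defines it everywhere. -/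

section Definability

variable {I : Type x} {V : I → Type v} {r : ∀ i, V i → V i → Prop} {α β γ : Type}

/-- One first-order formula defines the relations `R i` in all structures `⟨V i, r i⟩`. -/
def Def (r : ∀ i, V i → V i → Prop) {α : Type} (R : ∀ i, (α → V i) → Prop) : Prop :=
  ∃ φ : Language.graph.Formula α, ∀ i s, R i s ↔ Holds (r i) φ s

/-- The term `t` is a variable. -/
def IsVar {α : Type} (t : ∀ i, (α → V i) → V i) : Prop := ∃ a, ∀ i s, t i s = s a

theorem IsVar.intro (a : α) : IsVar (V := V) fun _ s => s a := ⟨a, fun _ _ => rfl⟩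

theorem Def.congr {R R' : ∀ i, (α → V i) → Prop} (h : Def r R) (e : ∀ i s, R' i s ↔ R i s) :
    Def r R' := by
  obtain ⟨φ, hφ⟩ := h
  exact ⟨φ, fun i s => (e i s).trans (hφ i s)⟩

theorem Def.eq {t t' : ∀ i, (α → V i) → V i} (ht : IsVar t) (ht' : IsVar t') :
    Def r fun i s => t i s = t' i s := by
  obtain ⟨a, ha⟩ := ht
  obtain ⟨b, hb⟩ := ht'
  refine ⟨Term.equal (Term.var a) (Term.var b), fun i s => ?_⟩
  let := relStructure (r i)
  beta_reduce
  rw [ha, hb]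
  exact (Formula.realize_equal (t₁ := Term.var a) (t₂ := Term.var b)).symm

theorem Def.base {t t' : ∀ i, (α → V i) → V i} (ht : IsVar t) (ht' : IsVar t') :
    Def r fun i s => r i (t i s) (t' i s) := by
  obtain ⟨a, ha⟩ := ht
  obtain ⟨b, hb⟩ := ht'
  refine ⟨Relations.formula (graphRel.adj : Language.graph.Relations 2)
    ![Term.var a, Term.var b], fun i s => ?_⟩
  let := relStructure (r i)
  beta_reduce
  rw [ha, hb]
  exact (Formula.realize_rel (L := Language.graph) (M := V i) (v := s) (R := graphRel.adj)
    (ts := ![Term.var a, Term.var b])).symm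

theorem Def.true : Def r fun _ (_ : α → V _) => True := by
  refine ⟨⊤, fun i s => ?_⟩
  let := relStructure (r i)
  exact Formula.realize_top.symm

theorem Def.not {R : ∀ i, (α → V i) → Prop} (h : Def r R) : Def r fun i s => ¬ R i s := by
  obtain ⟨φ, hφ⟩ := h
  refine ⟨φ.not, fun i s => ?_⟩
  let := relStructure (r i)
  beta_reduce
  rw [hφ]
  exact Formula.realize_not.symm

theorem Def.and {R R' : ∀ i, (α → V i) → Prop} (h : Def r R) (h' : Def r R') :
    Def r fun i s => R i s ∧ R' i s := by
  obtain ⟨φ, hφ⟩ := h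
  obtain ⟨ψ, hψ⟩ := h'
  refine ⟨φ ⊓ ψ, fun i s => ?_⟩
  let := relStructure (r i)
  beta_reduce
  rw [hφ, hψ]
  exact Formula.realize_inf.symm

theorem Def.or {R R' : ∀ i, (α → V i) → Prop} (h : Def r R) (h' : Def r R') :
    Def r fun i s => R i s ∨ R' i s :=
  (h.not.and h'.not).not.congr fun _ _ => by tauto

theorem Def.imp {R R' : ∀ i, (α → V i) → Prop} (h : Def r R) (h' : Def r R') :
    Def r fun i s => R i s → R' i s :=
  (h.not.or h').congr fun _ _ => by tauto

/-- Substitution of variables. -/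
theorem Def.relabel {R : ∀ i, (α → V i) → Prop} (h : Def r R) (g : α → β) :
    Def r fun i s => R i (fun a => s (g a)) := by
  obtain ⟨φ, hφ⟩ := h
  refine ⟨Formula.relabel g φ, fun i s => ?_⟩
  let := relStructure (r i)
  beta_reduce
  rw [hφ]
  exact (Formula.realize_relabel (φ := φ) (g := g) (v := s)).symm

theorem Def.exs [Finite β] {R : ∀ i, (α → V i) → (β → V i) → Prop}
    (h : Def r fun i (s : α ⊕ β → V i) => R i (fun a => s (.inl a)) (fun b => s (.inr b))) :
    Def r fun i s => ∃ t, R i s t := by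
  obtain ⟨φ, hφ⟩ := h
  refine ⟨Formula.iExs β φ, fun i s => ?_⟩
  let := relStructure (r i)
  refine Iff.trans ?_ (BoundedFormula.realize_iExs (φ := φ) (v := s) (v' := default)).symm
  exact exists_congr fun t => hφ i (Sum.elim s t)

theorem Def.alls [Finite β] {R : ∀ i, (α → V i) → (β → V i) → Prop}
    (h : Def r fun i (s : α ⊕ β → V i) => R i (fun a => s (.inl a)) (fun b => s (.inr b))) :
    Def r fun i s => ∀ t, R i s t :=
  (Def.exs (R := fun i s t => ¬ R i s t) h.not).not.congr fun _ _ => by simp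

theorem Def.ex {R : ∀ i, (α → V i) → V i → Prop}
    (h : Def r fun i (s : Option α → V i) => R i (fun a => s (some a)) (s none)) :
    Def r fun i s => ∃ x, R i s x := by
  have h' := h.relabel (β := α ⊕ Unit) fun a => a.elim (.inr ()) .inl
  refine (Def.exs (R := fun i s (t : Unit → V i) => R i s (t ())) h').congr fun i s => ?_
  exact ⟨fun ⟨x, hx⟩ => ⟨fun _ => x, hx⟩, fun ⟨t, ht⟩ => ⟨t (), ht⟩⟩

theorem Def.all {R : ∀ i, (α → V i) → V i → Prop}
    (h : Def r fun i (s : Option α → V i) => R i (fun a => s (some a)) (s none)) :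
    Def r fun i s => ∀ x, R i s x :=
  (Def.ex (R := fun i s x => ¬ R i s x) h.not).not.congr fun _ _ => by simp

theorem Def.forall_finite [Finite β] {R : β → ∀ i, (α → V i) → Prop} (h : ∀ b, Def r (R b)) :
    Def r fun i s => ∀ b, R b i s := by
  choose φ hφ using h
  refine ⟨BoundedFormula.iInf φ, fun i s => ?_⟩
  let := relStructure (r i)
  refine Iff.trans ?_ (BoundedFormula.realize_iInf (f := φ) (v := s) (v' := default)).symm
  exact forall_congr' fun b => hφ b i s

/-- Definability of a binary relation. -/
def Def₂ (r : ∀ i, V i → V i → Prop) (R : ∀ i, V i → V i → Prop) : Prop :=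
  Def r fun i (s : Fin 2 → V i) => R i (s 0) (s 1)

/-- Definability of a ternary relation. -/
def Def₃ (r : ∀ i, V i → V i → Prop) (R : ∀ i, V i → V i → V i → Prop) : Prop :=
  Def r fun i (s : Fin 3 → V i) => R i (s 0) (s 1) (s 2)

theorem Def₂.comp {R : ∀ i, V i → V i → Prop} (h : Def₂ r R) {t t' : ∀ i, (α → V i) → V i}
    (ht : IsVar t) (ht' : IsVar t') : Def r fun i s => R i (t i s) (t' i s) := by
  obtain ⟨a, ha⟩ := ht
  obtain ⟨b, hb⟩ := ht'
  exact (Def.relabel h ![a, b]).congr fun i s => by rw [ha, hb]; rfl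

theorem Def₃.comp {R : ∀ i, V i → V i → V i → Prop} (h : Def₃ r R)
    {t t' t'' : ∀ i, (α → V i) → V i} (ht : IsVar t) (ht' : IsVar t') (ht'' : IsVar t'') :
    Def r fun i s => R i (t i s) (t' i s) (t'' i s) := by
  obtain ⟨a, ha⟩ := ht
  obtain ⟨b, hb⟩ := ht'
  obtain ⟨c, hc⟩ := ht''
  exact (Def.relabel h ![a, b, c]).congr fun i s => by rw [ha, hb, hc]; rfl

theorem Def₂.base : Def₂ r r := Def.base (IsVar.intro 0) (IsVar.intro 1)

theorem Def₂.congr {R R' : ∀ i, V i → V i → Prop} (h : Def₂ r R)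
    (e : ∀ i a b, R' i a b ↔ R i a b) : Def₂ r R' := Def.congr h fun i _ => e i _ _

end Definability

/-! ### Interpretations -/

section Interpretation

variable {I : Type x} {V W P Λ : I → Type*} {r : ∀ i, V i → V i → Prop}
  {r' : ∀ i, W i → W i → Prop} {α β γ : Type}

/-- The relation `R` between objects coded by tuples is definable. -/
def DefBetween (r : ∀ i, V i → V i → Prop) (c : ∀ i, (α → V i) → P i → Prop)
    (d : ∀ i, (β → V i) → Λ i → Prop) (R : ∀ i, P i → Λ i → Prop) : Prop :=
  Def r fun i (s : α ⊕ β → V i) =>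
    ∃ p l, c i (fun a => s (.inl a)) p ∧ d i (fun b => s (.inr b)) l ∧ R i p l

/-- A definable coding of the elements of `P i` by tuples of elements of `V i`. -/
structure IsCoding (r : ∀ i, V i → V i → Prop) (c : ∀ i, (α → V i) → P i → Prop) : Prop where
  unique : ∀ i s p q, c i s p → c i s q → p = q
  exists_code : ∀ i p, ∃ s, c i s p
  dom : Def r fun i s => ∃ p, c i s p
  same : DefBetween r c c fun _ => Eq

/-- The tuples of elements of `W i` that are coded by families of codes. -/
def codeTuple (c : ∀ i, (α → V i) → W i → Prop) (γ : Type) (i : I) (s : γ × α → V i)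
    (t : γ → W i) : Prop :=
  ∀ a, c i (fun j => s (a, j)) (t a)

/-- Induction on the formula: equality and the relation symbol are replaced by their definitions on
codes, and quantifiers are relativised to codes. The latter is sound because every element has a
code and truth does not depend on which one is chosen. -/
theorem IsCoding.exists_translation [Finite α] {c : ∀ i, (α → V i) → W i → Prop}
    (hc : IsCoding r c) (hr : DefBetween r c c r') {l : ℕ}
    (φ : Language.graph.BoundedFormula γ l) :
    ∃ R : ∀ i, ((γ ⊕ Fin l) × α → V i) → Prop, Def r R ∧
      ∀ i s t, codeTuple c (γ ⊕ Fin l) i s t →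
        (R i s ↔ @BoundedFormula.Realize _ (W i) (relStructure (r' i)) γ l φ
          (fun a => t (.inl a)) (fun b => t (.inr b))) := by
  induction φ with
  | falsum => exact ⟨fun _ _ => ¬ True, Def.true.not, fun i s t _ =>
      ⟨fun h => h trivial, fun h => h.elim⟩⟩
  | equal t₁ t₂ =>
    rcases t₁ with a | ⟨f, _⟩
    swap
    · exact f.elim
    rcases t₂ with b | ⟨f, _⟩
    swap
    · exact f.elim
    refine ⟨_, Def.relabel hc.same (Sum.elim (fun j => (a, j)) fun j => (b, j)), ?_⟩
    intro i s t hst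
    have e : (@BoundedFormula.Realize _ (W i) (relStructure (r' i)) γ _
        (BoundedFormula.equal (Term.var a) (Term.var b))
          (fun a => t (.inl a)) (fun b => t (.inr b))) ↔ t a = t b := by
      rcases a with a | a <;> rcases b with b | b <;> rfl
    rw [e]
    constructor
    · rintro ⟨p, q, hp, hq, rfl⟩
      exact (hc.unique i _ _ _ (hst a) hp).trans (hc.unique i _ _ _ (hst b) hq).symm
    · intro h
      exact ⟨t a, t b, hst a, hst b, h⟩
  | rel R ts =>
    cases R
    rcases h₁ : ts 0 with a | ⟨f, _⟩
    swap
    · exact f.elim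
    rcases h₂ : ts 1 with b | ⟨f, _⟩
    swap
    · exact f.elim
    refine ⟨_, Def.relabel hr (Sum.elim (fun j => (a, j)) fun j => (b, j)), ?_⟩
    intro i s t hst
    have e : (@BoundedFormula.Realize _ (W i) (relStructure (r' i)) γ _
        (BoundedFormula.rel (graphRel.adj : Language.graph.Relations 2) ts)
          (fun a => t (.inl a)) (fun b => t (.inr b))) ↔ r' i (t a) (t b) := by
      change r' i (@Term.realize _ (W i) (relStructure (r' i)) _ _ (ts 0))
        (@Term.realize _ (W i) (relStructure (r' i)) _ _ (ts 1)) ↔ _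
      rw [h₁, h₂]
      rcases a with a | a <;> rcases b with b | b <;> rfl
    rw [e]
    constructor
    · rintro ⟨p, q, hp, hq, h⟩
      rwa [hc.unique i _ _ _ (hst a) hp, hc.unique i _ _ _ (hst b) hq]
    · intro h
      exact ⟨t a, t b, hst a, hst b, h⟩
  | imp φ ψ ih₁ ih₂ =>
    obtain ⟨R₁, hR₁, h₁⟩ := ih₁
    obtain ⟨R₂, hR₂, h₂⟩ := ih₂
    exact ⟨_, hR₁.imp hR₂, fun i s t hst => imp_congr (h₁ i s t hst) (h₂ i s t hst)⟩
  | @all l φ ih =>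
    obtain ⟨R, hR, h⟩ := ih
    -- The coordinates of the last bound variable become the newly quantified tuple; all others
    -- remain free.
    let g : (γ ⊕ Fin (l + 1)) × α → ((γ ⊕ Fin l) × α) ⊕ α := fun x =>
      Sum.elim (fun a => .inl (.inl a, x.2))
        (fun b => Fin.lastCases (motive := fun _ => ((γ ⊕ Fin l) × α) ⊕ α) (.inr x.2)
          (fun b => .inl (.inr b, x.2)) b) x.1
    have h₁ := hR.relabel g
    have h₂ := hc.dom.relabel (β := ((γ ⊕ Fin l) × α) ⊕ α) Sum.inr
    refine ⟨_, Def.alls (R := fun i s u => (∃ p, c i u p) →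
      R i (fun x => Sum.elim s u (g x))) ((h₂.imp h₁).congr fun i s => ?_), ?_⟩
    · have : Sum.elim (fun a => s (.inl a)) (fun b => s (.inr b)) = s := by
        funext x; rcases x with x | x <;> rfl
      simp only [this]
    · intro i s t hst
      have key : ∀ u p, c i u p → (R i (fun x => Sum.elim s u (g x)) ↔
          @BoundedFormula.Realize _ (W i) (relStructure (r' i)) γ (l + 1) φ
            (fun a => t (.inl a)) (Fin.snoc (fun b => t (.inr b)) p)) := by
        intro u p hup
        refine h i _ (Sum.elim (fun a => t (.inl a)) (Fin.snoc (fun b => t (.inr b)) p)) ?_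
        rintro (a | b)
        · exact hst (.inl a)
        · refine Fin.lastCases ?_ (fun b => ?_) b
          · simpa [g] using hup
          · simpa [g] using hst (.inr b)
      constructor
      · intro H p
        obtain ⟨u, hu⟩ := hc.exists_code i p
        exact (key u p hu).1 (H u ⟨p, hu⟩)
      · rintro H u ⟨p, hp⟩
        exact (key u p hp).2 (H p)

/-- Definability carries over along an interpretation. -/
theorem IsCoding.translate [Finite α] [Finite γ] {c : ∀ i, (α → V i) → W i → Prop}
    (hc : IsCoding r c) (hr : DefBetween r c c r') {R : ∀ i, (γ → W i) → Prop} (hR : Def r' R) :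
    Def r fun i s => ∃ t, codeTuple c γ i s t ∧ R i t := by
  obtain ⟨φ, hφ⟩ := hR
  obtain ⟨T, hT, h⟩ := hc.exists_translation hr φ
  have h₁ := hT.relabel (β := γ × α) fun x => (Sum.elim id finZeroElim x.1, x.2)
  have h₂ : Def r fun i (s : γ × α → V i) => ∀ a, ∃ p, c i (fun j => s (a, j)) p :=
    Def.forall_finite fun a => hc.dom.relabel fun j => (a, j)
  refine (h₂.and h₁).congr fun i s => ?_
  have key : ∀ t, codeTuple c γ i s t → (T i (fun x => s (Sum.elim id finZeroElim x.1, x.2)) ↔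
      R i t) := by
    intro t ht
    rw [hφ]
    refine (h i _ (fun a => t (Sum.elim id finZeroElim a)) ?_).trans ?_
    · rintro (a | a)
      · exact ht a
      · exact a.elim0
    have e : (fun b : Fin 0 => t (Sum.elim id finZeroElim (Sum.inr b : γ ⊕ Fin 0))) = default :=
      Subsingleton.elim _ _
    rw [e]; rfl
  constructor
  · rintro ⟨t, ht, hRt⟩
    exact ⟨fun a => ⟨t a, ht a⟩, (key t ht).2 hRt⟩
  · rintro ⟨h₁, h₂⟩
    choose t ht using h₁
    exact ⟨t, ht, (key t ht).1 h₂⟩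

/-- The points `P i` and lines `Λ i`, with the incidences `inc i` and `mem i`, are uniformly
definable in the structures `⟨V i, r i⟩`. -/
def Recoverable (r : ∀ i, V i → V i → Prop) (inc : ∀ i, P i → Λ i → Prop)
    (mem : ∀ i, P i → V i → Prop) : Prop :=
  ∃ (α β : Type) (_ : Finite α) (_ : Finite β) (c : ∀ i, (α → V i) → P i → Prop)
    (d : ∀ i, (β → V i) → Λ i → Prop), IsCoding r c ∧ IsCoding r d ∧ DefBetween r c d inc ∧
    DefBetween r c (fun _ (t : Unit → _) A => t () = A) mem

theorem codeTuple_unique {c : ∀ i, (α → V i) → W i → Prop} (hc : IsCoding r c) {i : I}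
    {s : γ × α → V i} {t t' : γ → W i} (h : codeTuple c γ i s t) (h' : codeTuple c γ i s t') :
    t = t' :=
  funext fun a => hc.unique i _ _ _ (h a) (h' a)

/-- The coding of `P i` by codes of tuples. -/
def compCode (c : ∀ i, (α → V i) → W i → Prop) (d : ∀ i, (γ → W i) → P i → Prop) (i : I)
    (s : γ × α → V i) (p : P i) : Prop :=
  ∃ t, codeTuple c γ i s t ∧ d i t p

theorem IsCoding.defBetween_comp [Finite α] [Finite β] [Finite γ]
    {c : ∀ i, (α → V i) → W i → Prop}
    (hc : IsCoding r c) (hr : DefBetween r c c r') {d : ∀ i, (β → W i) → P i → Prop}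
    {e : ∀ i, (γ → W i) → Λ i → Prop} {R : ∀ i, P i → Λ i → Prop} (h : DefBetween r' d e R) :
    DefBetween r (compCode c d) (compCode c e) R := by
  refine ((hc.translate hr h).relabel fun x : (β ⊕ γ) × α =>
    (Equiv.sumProdDistrib β γ α) x).congr fun i s => ?_
  constructor
  · rintro ⟨p, l, ⟨t, ht, hp⟩, ⟨t', ht', hl⟩, h⟩
    refine ⟨Sum.elim t t', ?_, p, l, hp, hl, h⟩
    rintro (a | a)
    · exact ht a
    · exact ht' a
  · rintro ⟨t, ht, p, l, hp, hl, h⟩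
    exact ⟨p, l, ⟨_, fun a => ht (.inl a), hp⟩, ⟨_, fun a => ht (.inr a), hl⟩, h⟩

theorem IsCoding.comp [Finite α] [Finite γ] {c : ∀ i, (α → V i) → W i → Prop}
    (hc : IsCoding r c) (hr : DefBetween r c c r') {d : ∀ i, (γ → W i) → P i → Prop}
    (hd : IsCoding r' d) : IsCoding r (compCode c d) where
  unique := by
    rintro i s p q ⟨t, ht, hp⟩ ⟨t', ht', hq⟩
    obtain rfl := codeTuple_unique hc ht ht'
    exact hd.unique i _ _ _ hp hq
  exists_code i p := by
    obtain ⟨t, ht⟩ := hd.exists_code i p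
    choose s hs using fun a => hc.exists_code i (t a)
    exact ⟨fun x => s x.1 x.2, t, hs, ht⟩
  dom := by
    refine (hc.translate hr hd.dom).congr fun i s => ?_
    constructor
    · rintro ⟨p, t, ht, hp⟩
      exact ⟨t, ht, p, hp⟩
    · rintro ⟨t, ht, p, hp⟩
      exact ⟨p, t, ht, hp⟩
  same := hc.defBetween_comp hr hd.same

/-- Recoverability carries over along an interpretation of `⟨W i, r' i⟩` in `⟨V i, r i⟩`. -/
theorem Recoverable.of_interpretation [Finite α] {c : ∀ i, (α → V i) → W i → Prop}
    (hc : IsCoding r c) (hr : DefBetween r c c r') {inc : ∀ i, P i → Λ i → Prop}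
    {mem' : ∀ i, P i → W i → Prop} (h : Recoverable r' inc mem')
    {J : ∀ i, W i → V i → Prop} (hJ : DefBetween r c (fun _ (t : Unit → _) A => t () = A) J)
    {mem : ∀ i, P i → V i → Prop} (hmem : ∀ i p A, mem i p A ↔ ∃ w, mem' i p w ∧ J i w A) :
    Recoverable r inc mem := by
  obtain ⟨γ, δ, _, _, d, e, hd, he, hinc, hm⟩ := h
  refine ⟨γ × α, δ × α, inferInstance, inferInstance, compCode c d, compCode c e,
    hc.comp hr hd, hc.comp hr he, hc.defBetween_comp hr hinc, ?_⟩
  have h₁ := (hc.defBetween_comp hr hm).relabel (β := ((γ × α) ⊕ Unit) ⊕ α)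
    (Sum.elim (fun x => .inl (.inl x)) fun x => .inr x.2)
  have h₂ := Def.relabel (β := ((γ × α) ⊕ Unit) ⊕ α) hJ
    (Sum.elim (fun x => .inr x) fun x => .inl (.inr x))
  refine (Def.exs (β := α) (R := fun i s u => (∃ p w, compCode c d i (fun a => s (.inl a)) p ∧
    c i u w ∧ mem' i p w) ∧ ∃ w A, c i u w ∧ s (.inr ()) = A ∧ J i w A)
    ((h₁.and h₂).congr fun i s => ?_)).congr fun i s => ?_
  · refine and_congr ?_ Iff.rfl
    refine exists_congr fun p => ?_
    constructor
    · rintro ⟨w, hp, hw, h⟩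
      exact ⟨w, hp, ⟨fun _ => w, fun _ => hw, rfl⟩, h⟩
    · rintro ⟨w, hp, ⟨t, ht, rfl⟩, h⟩
      exact ⟨_, hp, ht (), h⟩
  · constructor
    · rintro ⟨p, A, hp, hA, h⟩
      obtain ⟨w, hpw, hw⟩ := (hmem i p A).1 h
      obtain ⟨u, hu⟩ := hc.exists_code i w
      exact ⟨u, ⟨p, w, hp, hu, hpw⟩, w, A, hu, hA, hw⟩
    · rintro ⟨u, ⟨p, w, hp, hu, hpw⟩, w', A, hu', hA, hw⟩
      obtain rfl := hc.unique i _ _ _ hu hu'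
      exact ⟨p, A, hp, hA, (hmem i p A).2 ⟨w, hpw, hw⟩⟩

theorem Recoverable.exists_scheme {inc : ∀ i, P i → Λ i → Prop} {mem : ∀ i, P i → V i → Prop}
    (h : Recoverable r inc mem) :
    ∃ S : DefinitionScheme, ∀ i, S.Defines (r i) (inc i) (mem i) := by
  obtain ⟨α, β, _, _, c, d, hc, hd, hinc, hmem⟩ := h
  obtain ⟨n, ⟨e⟩⟩ := Finite.exists_equiv_fin α
  obtain ⟨k, ⟨f⟩⟩ := Finite.exists_equiv_fin β
  obtain ⟨φ₁, h₁⟩ := hc.dom.relabel e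
  obtain ⟨φ₂, h₂⟩ := Def.relabel hc.same (Sum.map e e)
  obtain ⟨φ₃, h₃⟩ := hd.dom.relabel f
  obtain ⟨φ₄, h₄⟩ := Def.relabel hd.same (Sum.map f f)
  obtain ⟨φ₅, h₅⟩ := Def.relabel hinc (Sum.map e f)
  obtain ⟨φ₆, h₆⟩ := Def.relabel hmem (Sum.map e fun _ => (0 : Fin 1))
  refine ⟨⟨n, k, φ₁, φ₂, φ₃, φ₄, φ₅, φ₆⟩, fun i => ?_⟩
  choose pt hpt using fun s : {s : Fin n → V i // Holds (r i) φ₁ s} => (h₁ i s.1).2 s.2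
  choose ln hln using fun s : {s : Fin k → V i // Holds (r i) φ₃ s} => (h₃ i s.1).2 s.2
  refine ⟨pt, ln, ?_, ?_, ?_, ?_, ?_, ?_⟩
  · intro p
    obtain ⟨s, hs⟩ := hc.exists_code i p
    have hs' : c i (fun a => (fun j => s (e.symm j)) (e a)) p := by simpa using hs
    exact ⟨⟨fun j => s (e.symm j), (h₁ i _).1 ⟨p, hs'⟩⟩, hc.unique i _ _ _ (hpt _) hs'⟩
  · intro p
    obtain ⟨s, hs⟩ := hd.exists_code i p
    have hs' : d i (fun a => (fun j => s (f.symm j)) (f a)) p := by simpa using hs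
    exact ⟨⟨fun j => s (f.symm j), (h₃ i _).1 ⟨p, hs'⟩⟩, hd.unique i _ _ _ (hln _) hs'⟩
  · intro s s'
    refine Iff.trans ?_ (h₂ i _)
    constructor
    · intro h
      exact ⟨_, _, hpt s, hpt s', h⟩
    · rintro ⟨p, q, hp, hq, h⟩
      rw [hc.unique i _ _ _ (hpt s) hp, hc.unique i _ _ _ (hpt s') hq, h]
  · intro s s'
    refine Iff.trans ?_ (h₄ i _)
    constructor
    · intro h
      exact ⟨_, _, hln s, hln s', h⟩
    · rintro ⟨p, q, hp, hq, h⟩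
      rw [hd.unique i _ _ _ (hln s) hp, hd.unique i _ _ _ (hln s') hq, h]
  · intro s s'
    refine Iff.trans ?_ (h₅ i _)
    constructor
    · intro h
      exact ⟨_, _, hpt s, hln s', h⟩
    · rintro ⟨p, q, hp, hq, h⟩
      rwa [hc.unique i _ _ _ (hpt s) hp, hd.unique i _ _ _ (hln s') hq]
  · intro s A
    refine Iff.trans ?_ (h₆ i _)
    constructor
    · intro h
      exact ⟨_, _, hpt s, rfl, h⟩
    · rintro ⟨p, q, hp, hq, h⟩
      rw [hc.unique i _ _ _ (hpt s) hp]
      obtain rfl : A = q := hq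
      exact h

end Interpretation

end PolarGeometry

namespace PolarGeometry

/-! ### Definability of stars, pencils and parallelism -/

section Formulas

variable {I : Type x} {V : I → Type v} {r₀ r : ∀ i, V i → V i → Prop}
  {J : ∀ i, V i → V i → V i → Prop}

theorem Def.ne {α : Type} {t t' : ∀ i, (α → V i) → V i} (ht : IsVar t) (ht' : IsVar t') :
    Def r₀ fun i s => t i s ≠ t' i s :=
  (Def.eq ht ht').not

theorem Def₂.isTightPair (h : Def₂ r₀ r) : Def₂ r₀ fun i => IsTightPair (r i) := by
  unfold Def₂ IsTightPair
  apply_rules (maxDepth := 500) [Def.all, Def.imp, Def.or, Def.eq, h.comp, IsVar.intro]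

theorem Def₂.downStar (h : Def₂ r₀ r) : Def₃ r₀ fun i => DownStar (r i) := by
  have h' := h.isTightPair
  unfold Def₃ DownStar
  apply_rules (maxDepth := 500) [Def.ex, Def.or, Def.and, Def.eq, h.comp, h'.comp, IsVar.intro]

theorem Def₂.upPencil (h : Def₂ r₀ r) : Def₃ r₀ fun i => UpPencil (r i) := by
  unfold Def₃ UpPencil
  apply_rules (maxDepth := 500) [Def.all, Def.imp, Def.or, Def.and, Def.eq, h.comp, IsVar.intro]

theorem Def₂.isParallel (h : Def₂ r₀ r) (hJ : Def₃ r₀ J) :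
    Def₂ r₀ fun i => IsParallel (r i) (J i) := by
  unfold Def₂ IsParallel
  apply_rules (maxDepth := 500) [Def.all, Def.ex, Def.and, Def.ne, Def.not, Def.imp, h.comp,
    hJ.comp, IsVar.intro]

theorem Def₂.perpStar (h : Def₂ r₀ r) : Def₃ r₀ fun i => PerpStar (r i) := by
  unfold Def₃ PerpStar IsDominated
  apply_rules (maxDepth := 500) [Def.all, Def.ex, Def.and, Def.or, Def.ne, Def.imp, Def.eq,
    h.comp, IsVar.intro]

theorem Def₂.bothStar (h : Def₂ r₀ r) : Def₃ r₀ fun i => BothStar (r i) := by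
  have h' := h.perpStar
  unfold Def₃ BothStar StarStep
  apply_rules (maxDepth := 500) [h'.comp, Def.ex, Def.and, Def.or, Def.ne, h.comp, IsVar.intro]

theorem Def₂.isQuad (h : Def₂ r₀ r) {α : Type} {t₁ t₂ t₃ t₄ : ∀ i, (α → V i) → V i}
    (h₁ : IsVar t₁) (h₂ : IsVar t₂) (h₃ : IsVar t₃) (h₄ : IsVar t₄) :
    Def r₀ fun i s => IsQuad (r i) (t₁ i s) (t₂ i s) (t₃ i s) (t₄ i s) := by
  unfold IsQuad
  apply_rules (maxDepth := 500) [Def.and, Def.ne, Def.not, h.comp]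

theorem Def₂.prismPencil (h : Def₂ r₀ r) : Def₃ r₀ fun i => PrismPencil (r i) := by
  unfold Def₃ PrismPencil IsPrismBase
  apply_rules (maxDepth := 500) [h.isQuad, Def.ex, Def.and, Def.or, Def.eq, IsVar.intro]

theorem Def₂.prismStar (h : Def₂ r₀ r) : Def₃ r₀ fun i => PrismStar (r i) := by
  have h' := h.prismPencil
  unfold Def₃ PrismStar
  apply_rules (maxDepth := 500) [h'.comp, h.isQuad, Def.ex, Def.and, Def.or, IsVar.intro]

theorem Def₂.isNearlyAdjacent (h : Def₂ r₀ r) : Def₂ r₀ fun i => IsNearlyAdjacent (r i) := by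
  unfold Def₂ IsNearlyAdjacent
  apply_rules (maxDepth := 500) [Def.ex, Def.and, Def.or, Def.ne, h.comp, IsVar.intro]

theorem Def₂.both (h : Def₂ r₀ r) (hJ : Def₃ r₀ J) :
    Def₂ r₀ fun i A B => r i A B ∧ ¬ IsParallel (r i) (J i) A B :=
  Def.and h (Def.not (h.isParallel hJ))

end Formulas

end PolarGeometry

namespace PolarGeometry

variable {Q : Type u} {𝓛 : Set (Set Q)} {H : Set Q} {k m n : ℕ}

/-! ### The affine points and lines -/

theorem IsFinitePolarSpace.mem_line_iff (hP : IsFinitePolarSpace 𝓛) (hH : IsSubspace 𝓛 H)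
    {L : Set Q} (hL : L ∈ 𝓛) {a b p : Q} (ha : a ∈ L) (hb : b ∈ L) (hab : a ≠ b) (haH : a ∉ H) :
    p ∈ L ↔ ∀ x, x ∉ H → Perp 𝓛 x a → Perp 𝓛 x b → Perp 𝓛 x p := by
  constructor
  · exact fun hp x _ hxa hxb => hP.perp_of_two hL ha hb hab hxa hxb hp
  · intro h
    by_contra hp
    obtain ⟨u, hu, hup⟩ := hP.exists_separating_univ (hP.isStrong_line hL) hp
    -- A separating point u inside H is replaced by an affine one: all points of the line ua except
    -- u are affine and collinear with a and b, and at most one point of it is collinear with p.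
    by_cases huH : u ∈ H
    swap
    · exact hup (h u huH (hu a ha) (hu b hb))
    have hua : u ≠ a := fun e => haH (e ▸ huH)
    obtain ⟨N, hN, huN, haN⟩ := (hu a ha).exists_line hua
    obtain ⟨q, hqN, hpq⟩ := hP.exists_perp hN p
    obtain ⟨c, hcN, hcu, hcq⟩ := hP.exists_third hN u q
    have hcH : c ∉ H := fun hc => haH (hH N hN ⟨c, ⟨hcN, hc⟩, u, ⟨huN, huH⟩, hcu⟩ haN)
    have hpc := h c hcH (.of_mem hN hcN haN)
      (hP.perp_of_two hN huN haN hua (hu b hb).symm (.of_mem hL hb ha) hcN).symm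
    exact hup (hP.perp_of_two hN hcN hqN hcq hpc.symm hpq huN).symm

theorem IsHyperplane.exists_affine_pair (hH : IsHyperplane 𝓛 H) (hP : IsPolarSpace 𝓛) {L : Set Q}
    (hL : L ∈ 𝓛) (hLH : (L \ H).Nonempty) : ∃ a b, a ∈ L \ H ∧ b ∈ L \ H ∧ a ≠ b := by
  obtain ⟨a, haL, haH⟩ := hLH
  obtain ⟨h, hhL, hhH⟩ := hH.2.2 L hL
  obtain ⟨b, hbL, hba, hbh⟩ := hP.exists_third hL a h
  exact ⟨a, b, ⟨haL, haH⟩, ⟨hbL, fun hb => haH (hH.1 L hL ⟨b, ⟨hbL, hb⟩, h, ⟨hhL, hhH⟩, hbh⟩ haL)⟩,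
    hba.symm⟩

namespace Flat

theorem exists_eq_singleton (hP : IsFinitePolarSpace 𝓛) (A : Flat 𝓛 H 0) :
    ∃ p, p ∉ H ∧ A.1 = {p} := by
  obtain ⟨p, hp⟩ := hP.nonempty_of_rk (X := A.1) (by rw [A.rk_eq]; omega)
  have h : {p} = A.1 := hP.eq_of_subset (isStrong_singleton p) A.strong
    (Set.singleton_subset_iff.2 hp) (by rw [A.rk_eq, hP.rk_singleton])
  exact ⟨p, fun hpH => A.not_subset (h ▸ Set.singleton_subset_iff.2 hpH), h.symm⟩

/-- A point as a flat. -/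
def point (hP : IsFinitePolarSpace 𝓛) (p : Q) (hp : p ∉ H) : Flat 𝓛 H 0 :=
  ⟨{p}, isStrong_singleton p, hP.rk_singleton p, fun h => hp (h rfl)⟩

theorem up_zero_iff (hP : IsFinitePolarSpace 𝓛) {A B : Flat 𝓛 H 0} {a b : Q} (hA : A.1 = {a})
    (hB : B.1 = {b}) : Up A B ↔ a ≠ b ∧ Perp 𝓛 a b := by
  constructor
  · rintro ⟨hne, M, hM, -, h1, h2⟩
    rw [hA, Set.singleton_subset_iff] at h1
    rw [hB, Set.singleton_subset_iff] at h2
    exact ⟨fun h => hne (Subtype.ext (by rw [hA, hB, h])), hM.2 _ h1 _ h2⟩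
  · rintro ⟨hne, h⟩
    obtain ⟨L, hL, ha, hb⟩ := h.exists_line hne
    refine ⟨fun h => hne (Set.singleton_injective (by rw [← hA, ← hB, h])), L,
      hP.isStrong_line hL, hP.rk_line hL, ?_, ?_⟩ <;> simpa [hA, hB]

theorem eq_or_up_zero_iff (hP : IsFinitePolarSpace 𝓛) {A B : Flat 𝓛 H 0} {a b : Q}
    (hA : A.1 = {a}) (hB : B.1 = {b}) : (A = B ∨ Up A B) ↔ Perp 𝓛 a b := by
  rw [up_zero_iff hP hA hB, Subtype.ext_iff, hA, hB, Set.singleton_eq_singleton_iff]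
  constructor
  · rintro (rfl | h)
    exacts [.refl _, h.2]
  · intro h
    by_cases e : a = b
    exacts [.inl e, .inr ⟨e, h⟩]

end Flat

/-- `C` lies on the line through the adjacent points `A` and `B`. -/
def OnLine {T : Type v} (r : T → T → Prop) (A B C : T) : Prop :=
  ∀ D, (D = A ∨ r D A) → (D = B ∨ r D B) → (D = C ∨ r D C)

theorem Def₂.onLine {I : Type x} {V : I → Type v} {r₀ r : ∀ i, V i → V i → Prop}
    (h : Def₂ r₀ r) : Def₃ r₀ fun i => OnLine (r i) := by
  unfold Def₃ OnLine
  apply_rules [Def.all, Def.imp, Def.or, Def.eq, h.comp, IsVar.intro]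

theorem Flat.onLine_iff (hP : IsFinitePolarSpace 𝓛) (hH : IsSubspace 𝓛 H) {A B C : Flat 𝓛 H 0}
    (hAB : Up A B) {l : AfLine 𝓛 H} (hA : A.1 ⊆ l.1) (hB : B.1 ⊆ l.1) :
    OnLine Up A B C ↔ C.1 ⊆ l.1 := by
  obtain ⟨l, _, L, hL, rfl⟩ := l
  obtain ⟨a, haH, ha⟩ := A.exists_eq_singleton hP
  obtain ⟨b, hbH, hb⟩ := B.exists_eq_singleton hP
  obtain ⟨c, hcH, hc⟩ := C.exists_eq_singleton hP
  simp only [ha, hb, hc, Set.singleton_subset_iff] at hA hB ⊢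
  rw [up_zero_iff hP ha hb] at hAB
  have h := hP.mem_line_iff hH hL hA.1 hB.1 hAB.1 haH (p := c)
  rw [Set.mem_sdiff, and_iff_left hcH, h]
  constructor
  · intro h x hx hxa hxb
    have hx' : (point hP x hx).1 = {x} := rfl
    exact (eq_or_up_zero_iff hP hx' hc).1 (h (point hP x hx)
      ((eq_or_up_zero_iff hP hx' ha).2 hxa) ((eq_or_up_zero_iff hP hx' hb).2 hxb))
  · intro h D hDA hDB
    obtain ⟨x, hx, hx'⟩ := D.exists_eq_singleton hP
    exact (eq_or_up_zero_iff hP hx' hc).2 (h x hx ((eq_or_up_zero_iff hP hx' ha).1 hDA)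
      ((eq_or_up_zero_iff hP hx' hb).1 hDB))

/-! ### The family of all affine polar spaces of index `m` -/

/-- The affine polar spaces obtained from polar spaces of index `m`. -/
structure AffinePolarSpace (m : ℕ) : Type (u + 1) where
  /-- the points of the ambient polar space -/
  Point : Type u
  /-- the lines of the ambient polar space -/
  lines : Set (Set Point)
  /-- the deleted hyperplane -/
  horizon : Set Point
  isPolarSpace : IsPolarSpace lines
  hasIndex : HasIndex lines m
  isHyperplane : IsHyperplane lines horizon

namespace AffinePolarSpace

theorem hasRank (i : AffinePolarSpace.{u} m) : HasRank i.lines (m + 1) :=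
  i.hasIndex.hasRank i.isPolarSpace

theorem isFinitePolarSpace (i : AffinePolarSpace.{u} m) : IsFinitePolarSpace i.lines :=
  i.hasRank.toIsFinitePolarSpace

/-- The flats of dimension `k`. -/
abbrev Flats (m k : ℕ) (i : AffinePolarSpace.{u} m) : Type u := Flat i.lines i.horizon k

/-- The incidence of points and lines. -/
def inc (i : AffinePolarSpace.{u} m) (a : AfPoint i.horizon) (l : AfLine i.lines i.horizon) :
    Prop := a.1 ∈ l.1

/-- The incidence of points and flats. -/
def mem (k : ℕ) (i : AffinePolarSpace.{u} m) (a : AfPoint i.horizon) (A : Flats m k i) : Prop :=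
  a.1 ∈ A.1

/-- The incidence structure is recoverable from the flats of dimension `k` with the relations
`r i`. -/
def FlatRecoverable (r : ∀ i : AffinePolarSpace.{u} m, Flats m k i → Flats m k i → Prop) : Prop :=
  Recoverable r inc (mem k)

/-- The relation `Flat.Up` in all affine polar spaces. -/
abbrev up (m k : ℕ) (i : AffinePolarSpace.{u} m) : Flats m k i → Flats m k i → Prop := Flat.Up

/-- The relation `Flat.Down` in all affine polar spaces. -/
abbrev down (m k : ℕ) (i : AffinePolarSpace.{u} m) : Flats m k i → Flats m k i → Prop := Flat.Down

/-- The relation `Flat.Both` in all affine polar spaces. -/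
abbrev both (m k : ℕ) (i : AffinePolarSpace.{u} m) : Flats m k i → Flats m k i → Prop := Flat.Both

/-- Affine points are coded by themselves and affine lines by pairs of distinct collinear affine
points; `OnLine` then defines equality of lines and incidence. -/
theorem flatRecoverable_zero : FlatRecoverable (up.{u} m 0) := by
  have h : Def₂ (up.{u} m 0) (up.{u} m 0) := Def₂.base
  have h' := h.onLine
  have hpt : ∀ (i : AffinePolarSpace.{u} m) (A : Flats m 0 i),
      ∃ p : AfPoint i.horizon, A.1 = {p.1} := fun i A => by
    obtain ⟨p, hp, e⟩ := A.exists_eq_singleton i.isFinitePolarSpace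
    exact ⟨⟨p, hp⟩, e⟩
  have hline : ∀ (i : AffinePolarSpace.{u} m) (A B : Flats m 0 i), Flat.Up A B →
      ∃ l : AfLine i.lines i.horizon, Flat.Up A B ∧ A.1 ⊆ l.1 ∧ B.1 ⊆ l.1 := fun i A B hAB => by
    obtain ⟨a, ha⟩ := hpt i A
    obtain ⟨b, hb⟩ := hpt i B
    have h1 := (Flat.up_zero_iff i.isFinitePolarSpace ha hb).1 hAB
    obtain ⟨L, hL, haL, hbL⟩ := h1.2.exists_line h1.1
    refine ⟨⟨L \ i.horizon, ⟨a, haL, a.2⟩, L, hL, rfl⟩, hAB, ?_, ?_⟩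
    · rw [ha, Set.singleton_subset_iff]
      exact ⟨haL, a.2⟩
    · rw [hb, Set.singleton_subset_iff]
      exact ⟨hbL, b.2⟩
  have hon : ∀ (i : AffinePolarSpace.{u} m) {A B : Flats m 0 i}, Flat.Up A B →
      ∀ {l : AfLine i.lines i.horizon}, A.1 ⊆ l.1 → B.1 ⊆ l.1 → ∀ {C : Flats m 0 i},
      (OnLine Flat.Up A B C ↔ C.1 ⊆ l.1) := fun i _ _ hAB _ hA hB _ =>
    Flat.onLine_iff i.isFinitePolarSpace i.isHyperplane.1 hAB hA hB
  have heq : ∀ (i : AffinePolarSpace.{u} m) {A B : Flats m 0 i}, Flat.Up A B →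
      ∀ {l l' : AfLine i.lines i.horizon}, A.1 ⊆ l.1 → B.1 ⊆ l.1 → A.1 ⊆ l'.1 → B.1 ⊆ l'.1 →
      l = l' := fun i A B hAB l l' h1 h2 h3 h4 => by
    refine Subtype.ext (Set.ext fun p => ?_)
    have key : ∀ l : AfLine i.lines i.horizon, A.1 ⊆ l.1 → B.1 ⊆ l.1 → ∀ hp : p ∉ i.horizon,
        (p ∈ l.1 ↔ OnLine Flat.Up A B (Flat.point i.isFinitePolarSpace p hp)) :=
      fun l h1 h2 hp => by
        rw [hon i hAB h1 h2]
        exact Set.singleton_subset_iff.symm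
    have hsub : ∀ l : AfLine i.lines i.horizon, p ∈ l.1 → p ∉ i.horizon := by
      rintro ⟨_, _, L, _, rfl⟩ hp
      exact hp.2
    exact ⟨fun hp => (key l' h3 h4 (hsub l hp)).2 ((key l h1 h2 (hsub l hp)).1 hp),
      fun hp => (key l h1 h2 (hsub l' hp)).2 ((key l' h3 h4 (hsub l' hp)).1 hp)⟩
  refine ⟨Unit, Fin 2, inferInstance, inferInstance, fun i s p => (s ()).1 = {p.1},
    fun i s l => Flat.Up (s 0) (s 1) ∧ (s 0).1 ⊆ l.1 ∧ (s 1).1 ⊆ l.1, ⟨?_, ?_, ?_, ?_⟩,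
    ⟨?_, ?_, ?_, ?_⟩, ?_, ?_⟩
  · exact fun i s p q hp hq => Subtype.ext (Set.singleton_injective (hp.symm.trans hq))
  · exact fun i p => ⟨fun _ => Flat.point i.isFinitePolarSpace p.1 p.2, rfl⟩
  · exact Def.true.congr fun i s => ⟨fun _ => trivial, fun _ => hpt i _⟩
  · refine (Def.eq (IsVar.intro (.inl ())) (IsVar.intro (.inr ()))).congr fun i s => ?_
    constructor
    · rintro ⟨p, q, hp, hq, rfl⟩
      exact Subtype.ext (hp.trans hq.symm)
    · intro e
      obtain ⟨p, hp⟩ := hpt i (s (.inl ()))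
      exact ⟨p, p, hp, (congrArg Subtype.val e).symm.trans hp, rfl⟩
  · exact fun i s p q hp hq => heq i hp.1 hp.2.1 hp.2.2 hq.2.1 hq.2.2
  · rintro i ⟨_, hne, L, hL, rfl⟩
    obtain ⟨a, b, ha, hb, hab⟩ := i.isHyperplane.exists_affine_pair i.isPolarSpace hL hne
    refine ⟨![Flat.point i.isFinitePolarSpace a ha.2, Flat.point i.isFinitePolarSpace b hb.2],
      (Flat.up_zero_iff i.isFinitePolarSpace rfl rfl).2 ⟨hab, .of_mem hL ha.1 hb.1⟩,
      Set.singleton_subset_iff.2 ha, Set.singleton_subset_iff.2 hb⟩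
  · refine (h.comp (IsVar.intro 0) (IsVar.intro 1)).congr fun i s => ?_
    exact ⟨fun ⟨l, hl⟩ => hl.1, fun hl => hline i _ _ hl⟩
  · refine ((h.comp (IsVar.intro (.inl 0)) (IsVar.intro (.inl 1))).and
      ((h.comp (IsVar.intro (.inr 0)) (IsVar.intro (.inr 1))).and
      ((h'.comp (IsVar.intro (.inl 0)) (IsVar.intro (.inl 1)) (IsVar.intro (.inr 0))).and
      (h'.comp (IsVar.intro (.inl 0)) (IsVar.intro (.inl 1)) (IsVar.intro (.inr 1)))))).congr
      fun i s => ?_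
    constructor
    · rintro ⟨p, q, ⟨h1, h2, h3⟩, ⟨h4, h5, h6⟩, rfl⟩
      exact ⟨h1, h4, (hon i h1 h2 h3).2 h5, (hon i h1 h2 h3).2 h6⟩
    · rintro ⟨h1, h2, h3, h4⟩
      obtain ⟨l, -, g1, g2⟩ := hline i _ _ h1
      exact ⟨l, l, ⟨h1, g1, g2⟩, ⟨h2, (hon i h1 g1 g2).1 h3, (hon i h1 g1 g2).1 h4⟩, rfl⟩
  · refine ((h.comp (IsVar.intro (.inr 0)) (IsVar.intro (.inr 1))).and
      (h'.comp (IsVar.intro (.inr 0)) (IsVar.intro (.inr 1)) (IsVar.intro (.inl ())))).congr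
      fun i s => ?_
    constructor
    · rintro ⟨p, l, hp, ⟨h1, h2, h3⟩, hpl⟩
      refine ⟨h1, (hon i h1 h2 h3).2 ?_⟩
      rw [hp]
      exact Set.singleton_subset_iff.2 hpl
    · rintro ⟨h1, h2⟩
      obtain ⟨l, -, g1, g2⟩ := hline i _ _ h1
      obtain ⟨p, hp⟩ := hpt i (s (.inl ()))
      refine ⟨p, l, hp, ⟨h1, g1, g2⟩, (hon i h1 g1 g2).1 h2 ?_⟩
      rw [hp]
      rfl
  · refine (Def.eq (IsVar.intro (.inl ())) (IsVar.intro (.inr ()))).congr fun i s => ?_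
    constructor
    · rintro ⟨p, A, hp, hA, h⟩
      obtain ⟨q, hq⟩ := hpt i (s (.inr ()))
      have h1 : s (.inr ()) = A := hA
      have h2 : p.1 ∈ (s (.inr ())).1 := by rw [h1]; exact h
      rw [hq] at h2
      exact Subtype.ext (hp.trans (by rw [hq]; exact congrArg _ h2))
    · intro e
      obtain ⟨p, hp⟩ := hpt i (s (.inl ()))
      refine ⟨p, s (.inr ()), hp, rfl, ?_⟩
      rw [← e]
      change p.1 ∈ (s (.inl ())).1
      rw [hp]
      rfl

end AffinePolarSpace
end PolarGeometry

namespace PolarGeometry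

/-! ### Transfer along bijections and definable relations -/

section Transfer

variable {I : Type x} {V W P Λ : I → Type*} {r : ∀ i, V i → V i → Prop}
  {r' : ∀ i, W i → W i → Prop} {inc : ∀ i, P i → Λ i → Prop} {mem : ∀ i, P i → V i → Prop}
  {mem' : ∀ i, P i → W i → Prop}

/-- Recoverability carries over along a bijection that makes the relation definable. -/
theorem Recoverable.of_equiv (h : Recoverable r' inc mem') (e : ∀ i, V i ≃ W i)
    (hr : Def₂ r fun i a b => r' i (e i a) (e i b))
    (hmem : ∀ i p A, mem i p A ↔ mem' i p (e i A)) : Recoverable r inc mem := by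
  have hc : IsCoding r fun i (s : Unit → V i) w => e i (s ()) = w := by
    refine ⟨fun i s p q hp hq => hp.symm.trans hq,
      fun i p => ⟨fun _ => (e i).symm p, (e i).apply_symm_apply p⟩, ?_, ?_⟩
    · exact Def.true.congr fun i s => ⟨fun _ => trivial, fun _ => ⟨_, rfl⟩⟩
    · refine (Def.eq (IsVar.intro (.inl ())) (IsVar.intro (.inr ()))).congr fun i s => ?_
      constructor
      · rintro ⟨p, q, hp, hq, rfl⟩
        exact (e i).injective (hp.trans hq.symm)
      · exact fun h => ⟨_, _, rfl, rfl, congrArg (e i) h⟩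
  refine Recoverable.of_interpretation hc ?_ h (J := fun i w A => e i A = w) ?_ fun i p A => ?_
  · refine (hr.comp (IsVar.intro (.inl ())) (IsVar.intro (.inr ()))).congr fun i s => ?_
    constructor
    · rintro ⟨p, q, rfl, rfl, h⟩
      exact h
    · exact fun h => ⟨_, _, rfl, rfl, h⟩
  · refine (Def.eq (IsVar.intro (.inl ())) (IsVar.intro (.inr ()))).congr fun i s => ?_
    constructor
    · rintro ⟨p, A, hp, rfl, h⟩
      exact (e i).injective (hp.trans h.symm)
    · exact fun h => ⟨_, _, rfl, rfl, congrArg (e i) h.symm⟩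
  · rw [hmem]
    exact ⟨fun h => ⟨_, h, rfl⟩, fun ⟨w, h, e⟩ => e ▸ h⟩

/-- Recoverability from a definable relation. -/
theorem Recoverable.of_def₂ {r₁ : ∀ i, V i → V i → Prop} (h : Recoverable r₁ inc mem)
    (hr : Def₂ r r₁) : Recoverable r inc mem :=
  h.of_equiv (fun _ => .refl _) hr fun _ _ _ => Iff.rfl

end Transfer

/-! ### Descent in the dimension -/

namespace AffinePolarSpace

variable {m k : ℕ}

/-- If the flats of dimension `k` are coded by pairs of flats of dimension `k + 1` that meet in
them, then the recovery from the former carries over to the latter. -/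
theorem FlatRecoverable.succ {r G : ∀ i : AffinePolarSpace.{u} m,
      Flats m (k + 1) i → Flats m (k + 1) i → Prop}
    {St : ∀ i : AffinePolarSpace.{u} m,
      Flats m (k + 1) i → Flats m (k + 1) i → Flats m (k + 1) i → Prop}
    (hG : Def₂ r G) (hS : Def₃ r St) (hdown : ∀ i A B, G i A B → Flat.Down A B)
    (hex : ∀ i (Y : Flats m k i), ∃ A B, G i A B ∧ A.1 ∩ B.1 = Y.1)
    (hst : ∀ i A B C, G i A B → (St i A B C ↔ A.1 ∩ B.1 ⊆ C.1))
    (h : FlatRecoverable (up.{u} m k)) : FlatRecoverable r := by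
  let c : ∀ i, (Fin 2 → Flats.{u} m (k + 1) i) → Flats m k i → Prop := fun i s Y =>
    G i (s 0) (s 1) ∧ (s 0).1 ∩ (s 1).1 = Y.1
  have hmeet : ∀ i (A B : Flats.{u} m (k + 1) i), G i A B → ∃ Y : Flats m k i,
      G i A B ∧ A.1 ∩ B.1 = Y.1 := fun i A B hAB =>
    ⟨⟨A.1 ∩ B.1, A.strong_inter B, hdown i A B hAB⟩, hAB, rfl⟩
  have hsame : ∀ i (A B A' B' : Flats.{u} m (k + 1) i), G i A B → G i A' B' →
      (A.1 ∩ B.1 = A'.1 ∩ B'.1 ↔ St i A B A' ∧ St i A B B') := fun i A B A' B' h1 h2 => by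
    rw [hst i A B A' h1, hst i A B B' h1, ← Set.subset_inter_iff]
    refine ⟨fun e => e.subset, fun h => i.isFinitePolarSpace.eq_of_subset (A.strong_inter B)
      (A'.strong_inter B') h ?_⟩
    rw [(hdown i A B h1).1, (hdown i A' B' h2).1]
  have dG {α : Type} (a b : α) : Def r fun i s => G i (s a) (s b) :=
    hG.comp (IsVar.intro a) (IsVar.intro b)
  have dS {α : Type} (a b c : α) : Def r fun i s => St i (s a) (s b) (s c) :=
    hS.comp (IsVar.intro a) (IsVar.intro b) (IsVar.intro c)
  have hc : IsCoding r c := by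
    refine ⟨fun i s p q hp hq => Subtype.ext (hp.2.symm.trans hq.2), fun i Y => ?_, ?_, ?_⟩
    · obtain ⟨A, B, hAB, hY⟩ := hex i Y
      exact ⟨![A, B], hAB, hY⟩
    · exact (dG 0 1).congr fun i s => ⟨fun ⟨Y, hY⟩ => hY.1, fun h => hmeet i _ _ h⟩
    · refine ((dG (.inl 0) (.inl 1)).and ((dG (.inr 0) (.inr 1)).and
        ((dS (.inl 0) (.inl 1) (.inr 0)).and (dS (.inl 0) (.inl 1) (.inr 1))))).congr fun i s => ?_
      constructor
      · rintro ⟨Y, _, ⟨h1, h2⟩, ⟨h3, h4⟩, rfl⟩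
        exact ⟨h1, h3, (hsame i _ _ _ _ h1 h3).1 (h2.trans h4.symm)⟩
      · rintro ⟨h1, h2, h3⟩
        obtain ⟨Y, hY⟩ := hmeet i _ _ h1
        exact ⟨Y, Y, hY, ⟨h2, ((hsame i _ _ _ _ h1 h2).2 h3).symm.trans hY.2⟩, rfl⟩
  refine Recoverable.of_interpretation hc ?_ h (J := fun i Y A => Y.1 ⊆ A.1) ?_ fun i p A => ?_
  -- The relation ∼⁺ on coded flats: they are distinct, and some flat C of dimension k + 1 contains
  -- both. The strong subspace in `Flat.Up` is such a flat, since it is not inside H.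
  · refine ((dG (.inl 0) (.inl 1)).and ((dG (.inr 0) (.inr 1)).and
      (((dS (.inl 0) (.inl 1) (.inr 0)).and (dS (.inl 0) (.inl 1) (.inr 1))).not.and
      (Def.ex (R := fun i (s : Fin 2 ⊕ Fin 2 → _) C => St i (s (.inl 0)) (s (.inl 1)) C ∧
        St i (s (.inr 0)) (s (.inr 1)) C)
        ((dS (some (Sum.inl 0)) (some (Sum.inl 1)) none).and
        (dS (some (Sum.inr 0)) (some (Sum.inr 1)) none)))))).congr fun i s => ?_
    constructor
    · rintro ⟨Y, Z, ⟨h1, h2⟩, ⟨h3, h4⟩, hne, M, hM, hr, hYM, hZM⟩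
      refine ⟨h1, h3, fun h => hne (Subtype.ext ?_), ⟨M, hM, hr, fun h => ?_⟩, ?_, ?_⟩
      · rw [← h2, ← h4]
        exact (hsame i _ _ _ _ h1 h3).2 h
      · exact Y.not_subset (hYM.trans h)
      · exact (hst i _ _ _ h1).2 (h2.subset.trans hYM)
      · exact (hst i _ _ _ h3).2 (h4.subset.trans hZM)
    · rintro ⟨h1, h2, h3, C, h4, h5⟩
      obtain ⟨Y, hY⟩ := hmeet i _ _ h1
      obtain ⟨Z, hZ⟩ := hmeet i _ _ h2
      refine ⟨Y, Z, hY, hZ, fun e => h3 ((hsame i _ _ _ _ h1 h2).1 ?_), C.1, C.strong, C.rk_eq,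
        hY.2.symm.subset.trans ((hst i _ _ _ h1).1 h4),
        hZ.2.symm.subset.trans ((hst i _ _ _ h2).1 h5)⟩
      rw [hY.2, hZ.2, e]
  · refine ((dG (.inl 0) (.inl 1)).and (dS (.inl 0) (.inl 1) (.inr ()))).congr fun i s => ?_
    constructor
    · rintro ⟨Y, A, ⟨h1, h2⟩, rfl, h⟩
      exact ⟨h1, (hst i _ _ _ h1).2 (h2.subset.trans h)⟩
    · rintro ⟨h1, h2⟩
      obtain ⟨Y, hY⟩ := hmeet i _ _ h1
      exact ⟨Y, _, hY, rfl, hY.2.symm.subset.trans ((hst i _ _ _ h1).1 h2)⟩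
  · constructor
    · intro hp
      have hP := i.isFinitePolarSpace
      obtain ⟨Y, hY, h1, h2, h3⟩ := hP.exists_between (isStrong_singleton p.1) A.strong
        (Set.singleton_subset_iff.2 hp) (n := k + 1) (by rw [hP.rk_singleton]; omega)
        (by rw [A.rk_eq]; omega)
      exact ⟨⟨Y, hY, h3, fun h => p.2 (h (h1 rfl))⟩, h1 rfl, h2⟩
    · rintro ⟨Y, hp, hY⟩
      exact hY hp

theorem exists_down (i : AffinePolarSpace.{u} m) (hk : k + 1 ≤ m) (Y : Flats m k i) :
    ∃ A B : Flats m (k + 1) i, Flat.Down A B ∧ A.1 ∩ B.1 = Y.1 := by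
  have hP := i.isFinitePolarSpace
  have hYr := Y.rk_eq
  obtain ⟨A, hA, hYA, hAr⟩ := i.hasRank.exists_super Y.strong (j := k + 2) (by omega) (by omega)
  obtain ⟨a, haA, haY⟩ := Set.not_subset.1 fun h : A ⊆ Y.1 => by
    have := hP.rk_mono hA Y.strong h
    omega
  obtain ⟨D, hD, hYD, hDr, d, hd, hda⟩ := hP.exists_not_perp Y.strong hYr haY
    fun y hy => hA.2 a haA y (hYA hy)
  let A' : Flats m (k + 1) i := ⟨A, hA, hAr, fun h => Y.not_subset (hYA.trans h)⟩
  let D' : Flats m (k + 1) i := ⟨D, hD, hDr, fun h => Y.not_subset (hYD.trans h)⟩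
  have hne : A' ≠ D' := fun e => hda (hD.2 d hd a (congrArg Subtype.val e ▸ haA : a ∈ D'.1))
  exact ⟨A', D', Flat.down_of_subset hP Y.strong hYr Y.not_subset hYA hYD hne,
    Flat.rk_inter_of_subset hP Y.strong hYr hYA hYD hne⟩

theorem exists_both (i : AffinePolarSpace.{u} m) (hk : k + 2 ≤ m) (Y : Flats m k i) :
    ∃ A B : Flats m (k + 1) i, Flat.Both A B ∧ A.1 ∩ B.1 = Y.1 := by
  have hP := i.isFinitePolarSpace
  have hYr := Y.rk_eq
  obtain ⟨M, hM, hYM, hMr⟩ := i.hasRank.exists_super Y.strong (j := k + 3) (by omega) (by omega)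
  obtain ⟨A, hA, hYA, hAM, hAr⟩ := hP.exists_between Y.strong hM hYM (n := k + 2) (by omega)
    (by omega)
  obtain ⟨a, haA, haY⟩ := Set.not_subset.1 fun h : A ⊆ Y.1 => by
    have := hP.rk_mono hA Y.strong h
    omega
  obtain ⟨B, hB, hYB, hBM, hBr, haB⟩ := hP.exists_between_avoiding Y.strong hM hYM (hAM haA) haY
    (n := k + 2) (by omega) (by omega)
  let A' : Flats m (k + 1) i := ⟨A, hA, hAr, fun h => Y.not_subset (hYA.trans h)⟩
  let B' : Flats m (k + 1) i := ⟨B, hB, hBr, fun h => Y.not_subset (hYB.trans h)⟩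
  have hne : A' ≠ B' := fun e => haB (congrArg Subtype.val e ▸ haA : a ∈ B'.1)
  exact ⟨A', B', ⟨Flat.down_of_subset hP Y.strong hYr Y.not_subset hYA hYB hne,
    Flat.up_of_subset hM hMr hAM hBM hne⟩, Flat.rk_inter_of_subset hP Y.strong hYr hYA hYB hne⟩

/-- Parallelism is defined from pencils. The maximal rank is m + 1, so k + 2 ≤ m leaves room above
the joins and common neighbours suffice, while m = k + 1 is the case of prisms. -/
theorem def₂_both (hk : 0 < k) (hkm : k + 1 ≤ m) : Def₂ (up.{u} m k) (both m k) := by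
  have h : Def₂ (up.{u} m k) (up m k) := Def₂.base
  by_cases hm : k + 2 ≤ m
  · refine (h.both h.upPencil).congr fun i A B => ?_
    have hU : ∀ A B C : Flats m k i, Flat.Up A B →
        (UpPencil Flat.Up A B C ↔ Flat.InPencil A B C) := fun A B C hAB =>
      Flat.upPencil_iff i.hasRank i.isHyperplane.1 hk (by omega) hAB
    exact Flat.both_iff_not_isParallel i.isFinitePolarSpace i.isHyperplane hk
      (fun A B C hAB => (hU A B C hAB).1) (fun A B C hAB => (hU A B C hAB.2).2)
  · obtain rfl : m = k + 1 := by omega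
    refine (h.both h.prismPencil).congr fun i A B => ?_
    exact Flat.both_iff_not_isParallel i.isFinitePolarSpace i.isHyperplane hk
      (fun A B C hAB => Flat.inPencil_of_prismPencil i.hasRank hAB)
      (fun A B C hAB => Flat.prismPencil_of_inPencil i.hasRank hAB)

theorem flatRecoverable_up (k : ℕ) (hk : k + 1 ≤ m) : FlatRecoverable (up.{u} m k) := by
  induction k with
  | zero => exact flatRecoverable_zero
  | succ k ih =>
    have hb := def₂_both.{u} (Nat.succ_pos k) hk
    have hex := fun i Y => exists_both.{u} i hk Y
    by_cases hm : k + 3 ≤ m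
    · exact FlatRecoverable.succ hb hb.bothStar (fun _ _ _ h => h.1) hex
        (fun i A B C h => Flat.bothStar_iff i.hasRank i.isHyperplane (by omega) h)
        (ih (by omega))
    -- The flats of dimension k + 1 are now hyperplanes of maximal strong subspaces, so the star is
    -- defined by prisms over ∼⁺ itself.
    · obtain rfl : m = k + 2 := by omega
      exact FlatRecoverable.succ hb Def₂.base.prismStar (fun _ _ _ h => h.1) hex
        (fun i A B C h => Flat.prismStar_iff i.hasRank h) (ih (by omega))

theorem flatRecoverable_down (hk : k + 1 ≤ m) : FlatRecoverable (down.{u} m (k + 1)) :=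
  FlatRecoverable.succ Def₂.base Def₂.base.downStar (fun _ _ _ h => h)
    (fun i Y => exists_down i hk Y)
    (fun i _ _ _ h => Flat.downStar_iff i.isFinitePolarSpace i.isHyperplane.1 k.succ_pos h)
    (flatRecoverable_up k hk)

theorem flatRecoverable_both (hk : k + 2 ≤ m) : FlatRecoverable (both.{u} m (k + 1)) := by
  by_cases hm : k + 3 ≤ m
  · exact FlatRecoverable.succ Def₂.base Def₂.base.bothStar (fun _ _ _ h => h.1)
      (fun i Y => exists_both i hk Y)
      (fun i A B C h => Flat.bothStar_iff i.hasRank i.isHyperplane (by omega) h)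
      (flatRecoverable_up k (by omega))
  · obtain rfl : m = k + 2 := by omega
    refine (flatRecoverable_up (k + 1) hk).of_def₂ (Def₂.base.isNearlyAdjacent.congr
      fun i A B => ?_)
    exact (Flat.isNearlyAdjacent_iff i.hasRank i.isHyperplane.1 k.succ_pos).symm

/-! ### The affine subspaces as flats -/

variable {Q : Type u} {𝓛 : Set (Set Q)} {H : Set Q}

theorem mem_afSub_iff (hP : IsFinitePolarSpace 𝓛) {A : Set Q} :
    A ∈ afSub 𝓛 H k ↔ ∃ X : Flat 𝓛 H k, X.1 \ H = A := by
  constructor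
  · rintro ⟨X, hX, h, rfl⟩
    rw [hP.mem_sub_iff] at hX
    exact ⟨⟨X, hX.1, by omega, h (by omega)⟩, rfl⟩
  · rintro ⟨X, rfl⟩
    exact ⟨X.1, hP.mem_sub_iff.2 ⟨X.strong, by rw [X.rk_eq]; simp⟩, fun _ => X.not_subset, rfl⟩

theorem diff_subset_iff (hP : IsPolarSpace 𝓛) (hH : IsHyperplane 𝓛 H) (A : Flat 𝓛 H k)
    {S : Set Q} (hS : IsSubspace 𝓛 S) : A.1 \ H ⊆ S ↔ A.1 ⊆ S :=
  ⟨hH.subset_of_diff_subset hP A.strong A.not_subset hS, Set.sdiff_subset.trans⟩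

/-- The subspaces of the affine polar space correspond to the flats. -/
noncomputable def flatEquiv (hP : IsFinitePolarSpace 𝓛) (hH : IsHyperplane 𝓛 H) (k : ℕ) :
    Flat 𝓛 H k ≃ AfSub 𝓛 H k :=
  Equiv.ofBijective (fun X => ⟨X.1 \ H, (mem_afSub_iff hP).2 ⟨X, rfl⟩⟩)
    ⟨fun A B h => by
      have h' : A.1 \ H = B.1 \ H := congrArg Subtype.val h
      exact Flat.eq_of_subset hP ((diff_subset_iff hP.toIsPolarSpace hH A B.strong.1).1
        (h'.subset.trans Set.sdiff_subset)),
    fun ⟨A, hA⟩ => by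
      obtain ⟨X, hX⟩ := (mem_afSub_iff hP).1 hA
      exact ⟨X, Subtype.ext hX⟩⟩

theorem afJoin_diff (hP : IsPolarSpace 𝓛) (hH : IsHyperplane 𝓛 H) (A B : Flat 𝓛 H k) :
    afJoin 𝓛 H (A.1 \ H) (B.1 \ H) = join 𝓛 A.1 B.1 \ H := by
  refine Set.Subset.antisymm (Set.sInter_subset_of_mem ⟨⟨_, isSubspace_span, rfl⟩,
    Set.union_subset (Set.sdiff_subset_sdiff_left left_subset_join)
      (Set.sdiff_subset_sdiff_left right_subset_join)⟩) (Set.subset_sInter ?_)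
  rintro _ ⟨⟨X, hX, rfl⟩, h⟩
  refine Set.sdiff_subset_sdiff_left (join_subset hX ?_ ?_)
  · exact (diff_subset_iff hP hH A hX).1
      ((Set.subset_union_left.trans h).trans Set.sdiff_subset)
  · exact (diff_subset_iff hP hH B hX).1
      ((Set.subset_union_right.trans h).trans Set.sdiff_subset)

theorem upAdj_iff (hP : IsFinitePolarSpace 𝓛) (hH : IsHyperplane 𝓛 H) {A B : Flat 𝓛 H k} :
    UpAdj 𝓛 H k (flatEquiv hP hH k A) (flatEquiv hP hH k B) ↔ Flat.Up A B := by
  have e : UpAdj 𝓛 H k (flatEquiv hP hH k A) (flatEquiv hP hH k B) ↔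
      join 𝓛 A.1 B.1 \ H ∈ afSub 𝓛 H (k + 1 : ℕ) := by
    rw [← afJoin_diff hP.toIsPolarSpace hH]
    rfl
  rw [e, mem_afSub_iff hP]
  constructor
  · rintro ⟨M, hM⟩
    have h : ∀ C : Flat 𝓛 H k, C.1 ⊆ join 𝓛 A.1 B.1 → C.1 ⊆ M.1 := fun C hC =>
      (diff_subset_iff hP.toIsPolarSpace hH C M.strong.1).1
        (((Set.sdiff_subset_sdiff_left hC).trans hM.symm.subset).trans Set.sdiff_subset)
    refine ⟨?_, M.1, M.strong, M.rk_eq, h A left_subset_join, h B right_subset_join⟩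
    -- Distinctness is automatic: the join of a flat with itself has rank k + 1, not k + 2.
    rintro rfl
    have h1 : M.1 ⊆ A.1 := (diff_subset_iff hP.toIsPolarSpace hH M A.strong.1).1
      ((hM.subset.trans Set.sdiff_subset).trans (join_subset A.strong.1 subset_rfl subset_rfl))
    have := hP.rk_mono M.strong A.strong h1
    rw [M.rk_eq, A.rk_eq] at this
    omega
  · intro h
    exact ⟨⟨_, h.strong_join hP, h.rk_join hP,
      fun h' => A.not_subset (left_subset_join.trans h')⟩, rfl⟩

theorem downAdj_iff (hP : IsFinitePolarSpace 𝓛) (hH : IsHyperplane 𝓛 H)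
    {A B : Flat 𝓛 H (k + 1)} :
    DownAdj 𝓛 H (k + 1 : ℕ) (flatEquiv hP hH (k + 1) A) (flatEquiv hP hH (k + 1) B) ↔
      Flat.Down A B := by
  have e : DownAdj 𝓛 H (k + 1 : ℕ) (flatEquiv hP hH (k + 1) A) (flatEquiv hP hH (k + 1) B) ↔
      (A.1 ∩ B.1) \ H ∈ afSub 𝓛 H k := by
    have h : (A.1 ∩ B.1) \ H = (A.1 \ H) ∩ (B.1 \ H) := inf_sdiff
    have hk : ((k + 1 : ℕ) : ℤ) - 1 = k := by rw [Nat.cast_succ, add_sub_cancel_right]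
    rw [h, DownAdj, hk]
    rfl
  rw [e, mem_afSub_iff hP]
  constructor
  · rintro ⟨Y, hY⟩
    have hs := A.strong_inter B
    have h1 := (diff_subset_iff hP.toIsPolarSpace hH Y hs.1).1 (hY.subset.trans Set.sdiff_subset)
    have h2 : ¬ A.1 ∩ B.1 ⊆ H := fun h => Y.not_subset (h1.trans h)
    have h3 := hH.subset_of_diff_subset hP.toIsPolarSpace hs h2 Y.strong.1
      (hY.symm.subset.trans Set.sdiff_subset)
    refine ⟨?_, h2⟩
    rw [← h1.antisymm h3, Y.rk_eq]
  · exact fun h => ⟨⟨_, A.strong_inter B, h⟩, rfl⟩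

theorem bothAdj_iff (hP : IsFinitePolarSpace 𝓛) (hH : IsHyperplane 𝓛 H)
    {A B : Flat 𝓛 H (k + 1)} :
    BothAdj 𝓛 H (k + 1 : ℕ) (flatEquiv hP hH (k + 1) A) (flatEquiv hP hH (k + 1) B) ↔
      Flat.Both A B :=
  and_congr (downAdj_iff hP hH) (upAdj_iff hP hH)

/-- Dimension 0 is separate: `DownAdj` accepts the empty meet as the subspace of dimension -1,
whereas `Flat.Down` never holds there because the empty set lies in H. Distinct points meet in the
empty set anyway. -/
theorem bothAdj_zero_iff (hP : IsFinitePolarSpace 𝓛) (hH : IsHyperplane 𝓛 H)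
    {A B : Flat 𝓛 H 0} :
    BothAdj 𝓛 H (0 : ℕ) (flatEquiv hP hH 0 A) (flatEquiv hP hH 0 B) ↔ Flat.Up A B := by
  refine ⟨fun h => (upAdj_iff hP hH).1 h.2, fun h => ⟨?_, (upAdj_iff hP hH).2 h⟩⟩
  obtain ⟨a, ha, hA⟩ := A.exists_eq_singleton hP
  obtain ⟨b, hb, hB⟩ := B.exists_eq_singleton hP
  have hab := ((Flat.up_zero_iff hP hA hB).1 h).1
  refine ⟨∅, hP.mem_sub_iff.2 ⟨isStrong_empty, by rw [hP.rk_empty]⟩, fun h => by omega, ?_⟩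
  rw [Set.empty_sdiff]
  refine (Set.eq_empty_iff_forall_notMem.2 fun x hx => hab ?_)
  have h1 : x ∈ A.1 := hx.1.1
  have h2 : x ∈ B.1 := hx.2.1
  rw [hA] at h1
  rw [hB] at h2
  exact h1.symm.trans h2

/-- Transfer of the recovery from flats to the subspaces of the affine polar space. -/
theorem FlatRecoverable.exists_scheme
    {r : ∀ i : AffinePolarSpace.{u} m, Flats m k i → Flats m k i → Prop} (h : FlatRecoverable r)
    (r' : ∀ (Q : Type u) (𝓛 : Set (Set Q)) (H : Set Q), AfSub 𝓛 H k → AfSub 𝓛 H k → Prop)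
    (hr : ∀ (i : AffinePolarSpace.{u} m) (A B : Flats m k i), r' _ _ _
      (flatEquiv i.isFinitePolarSpace i.isHyperplane k A)
      (flatEquiv i.isFinitePolarSpace i.isHyperplane k B) ↔ r i A B) :
    ∃ S : DefinitionScheme, ∀ (Q : Type u) (𝓛 : Set (Set Q)) (H : Set Q),
      IsPolarSpace 𝓛 → HasIndex 𝓛 m → IsHyperplane 𝓛 H →
      RecoveredBy S 𝓛 H k (r' Q 𝓛 H) := by
  have h' : Recoverable (fun i : AffinePolarSpace.{u} m => r' i.Point i.lines i.horizon) inc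
      (fun _ a A => a.1 ∈ A.1) := by
    refine Recoverable.of_equiv h
      (fun i => (flatEquiv i.isFinitePolarSpace i.isHyperplane k).symm) ?_ fun i p A => ?_
    · refine Def₂.base.congr fun i A B => ?_
      rw [← hr, Equiv.apply_symm_apply, Equiv.apply_symm_apply]
    · obtain ⟨X, rfl⟩ := (flatEquiv i.isFinitePolarSpace i.isHyperplane k).surjective A
      rw [Equiv.symm_apply_apply]
      exact and_iff_left p.2
  obtain ⟨S, hS⟩ := h'.exists_scheme
  exact ⟨S, fun Q 𝓛 H hP hm hH => hS ⟨Q, 𝓛, H, hP, hm, hH⟩⟩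

end AffinePolarSpace

end PolarGeometry


theorem theorem1p5 (m k : ℕ) :
    (0 < k → k ≤ m →
      ∃ S : PolarGeometry.DefinitionScheme, ∀ (Q : Type u) (𝓛 : Set (Set Q)) (H : Set Q),
        PolarGeometry.IsPolarSpace 𝓛 → PolarGeometry.HasIndex 𝓛 m →
        PolarGeometry.IsHyperplane 𝓛 H →
        PolarGeometry.RecoveredBy S 𝓛 H k (PolarGeometry.DownAdj 𝓛 H k)) ∧
    (k + 1 ≤ m →
      ∃ S : PolarGeometry.DefinitionScheme, ∀ (Q : Type u) (𝓛 : Set (Set Q)) (H : Set Q),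
        PolarGeometry.IsPolarSpace 𝓛 → PolarGeometry.HasIndex 𝓛 m →
        PolarGeometry.IsHyperplane 𝓛 H →
        PolarGeometry.RecoveredBy S 𝓛 H k (PolarGeometry.UpAdj 𝓛 H k)) ∧
    (k + 1 ≤ m →
      ∃ S : PolarGeometry.DefinitionScheme, ∀ (Q : Type u) (𝓛 : Set (Set Q)) (H : Set Q),
        PolarGeometry.IsPolarSpace 𝓛 → PolarGeometry.HasIndex 𝓛 m →
        PolarGeometry.IsHyperplane 𝓛 H →
        PolarGeometry.RecoveredBy S 𝓛 H k (PolarGeometry.BothAdj 𝓛 H k)) := by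
  refine ⟨fun hk hm => ?_, fun hm => ?_, fun hm => ?_⟩
  · obtain ⟨k, rfl⟩ := Nat.exists_eq_add_of_lt hk
    rw [zero_add] at hm ⊢
    exact (PolarGeometry.AffinePolarSpace.flatRecoverable_down hm).exists_scheme
      (fun _ 𝓛 H => PolarGeometry.DownAdj 𝓛 H _) fun _ _ _ => PolarGeometry.AffinePolarSpace.downAdj_iff _ _
  · exact (PolarGeometry.AffinePolarSpace.flatRecoverable_up k hm).exists_scheme
      (fun _ 𝓛 H => PolarGeometry.UpAdj 𝓛 H _) fun _ _ _ => PolarGeometry.AffinePolarSpace.upAdj_iff _ _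
  · rcases k with _ | k
    · exact (PolarGeometry.AffinePolarSpace.flatRecoverable_up 0 hm).exists_scheme
        (fun _ 𝓛 H => PolarGeometry.BothAdj 𝓛 H _) fun _ _ _ =>
          PolarGeometry.AffinePolarSpace.bothAdj_zero_iff _ _
    · exact (PolarGeometry.AffinePolarSpace.flatRecoverable_both hm).exists_scheme
        (fun _ 𝓛 H => PolarGeometry.BothAdj 𝓛 H _) fun _ _ _ => PolarGeometry.AffinePolarSpace.bothAdj_iff _ _
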